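/- Let $M$ be an $m$-dimensional manifold with a volume form $\eta$ and let $\pi\colon E\to M$ be a surjective submersion with $\dim E=m+n$ (in particular, any fibre bundle); manifolds, maps and forms are smooth. Let $\mathcal L=L\,(\bar\pi^2)^*\eta$ with $L\in C^\infty(J^2\pi)$ be a second-order Lagrangian density. In adapted coordinates $(x^i,u^\alpha)$ of $E$ write $\mathcal L=\mathscr L\,d^mx$ with $d^mx=dx^1\wedge\dots\wedge dx^m$ (so $\mathscr L=L$ if $\eta=d^mx$) and $d^{m-1}x_j=i(\partial/\partial x^j)d^mx$; jet coordinates are $u^\alpha_I$, and $n(ij)=1$ if $i=j$, $n(ij)=2$ if $i\neq j$. Let $J^2\pi^\dagger$ be the bundle over $J^1\pi$ of the $m$-forms $p\,d^mx+p^i_\alpha du^\alpha\wedge d^{m-1}x_i+p^{ij}_\alpha du^\alpha_i\wedge d^{m-1}x_j$ with $p^{ij}_\alpha=p^{ji}_\alpha$, with coordinates $p$, $p^i_\alpha$ and $p_\alpha^{1_i+1_j}=n(ij)\,p_\alpha^{ij}$; let $\Theta_1^s$ be its tautological $m$-form and $\Omega_1^s=-d\Theta_1^s$. Let $J^2\pi^\ddagger$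 be its quotient by the $m$-forms $p\,d^mx$. Put $\mathcal W=J^3\pi\times_{J^1\pi}J^2\pi^\dagger$ and $\mathcal W_r=J^3\pi\times_{J^1\pi}J^2\pi^\ddagger$, with projections $\rho_2\colon\mathcal W\to J^2\pi^\dagger$, $\rho_1^r\colon\mathcal W_r\to J^3\pi$ and $\rho_M^r\colon\mathcal W_r\to M$. Let $\hat h\colon\mathcal W_r\to\mathcal W$ be the section of the quotient map $\mathcal W\to\mathcal W_r$ with image $\{(j^3_x\phi,\omega): (j^1\phi)^*_{j^1_x\phi}\,\omega=L(j^2_x\phi)\,\eta_x\}$, and put $\Omega_r=\hat h^*\rho_2^*\Omega_1^s$. Let $j_{\mathcal L}\colon\mathcal W_{\mathcal L}\hookrightarrow\mathcal W_r$ be the subset given in all natural coordinates by $$p^i_\alpha=\frac{\partial\mathscr L}{\partial u^\alpha_i}-\sum_{j=1}^m\frac1{n(ij)}\frac{d}{dx^j}\frac{\partial\mathscr L}{\partial u^\alpha_{1_i+1_j}},\qquad p^I_\alpha=\frac{\partial\mathscr L}{\partial u^\alpha_I}\quad(|I|=2),$$ let $\rho_1^{\mathcal L}=\rho_1^r\circ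 j_{\mathcal L}\colon\mathcal W_{\mathcal L}\to J^3\pi$, let $\widetilde{\mathcal{FL}}=\rho_2\circ\hat h\circ j_{\mathcal L}\circ(\rho_1^{\mathcal L})^{-1}\colon J^3\pi\to J^2\pi^\dagger$ be the extended Legendre map, and let $\Omega_{\mathcal L}=\widetilde{\mathcal{FL}}{}^*\Omega_1^s$ be the Poincaré–Cartan $(m+1)$-form. A section $\psi_{\mathcal L}$ of $J^3\pi\to M$ over an open set $U\subseteq M$ is called holonomic if it is the third prolongation $j^3\phi$ of the section $\phi$ of $\pi$ that it projects to; a section $\psi$ of $\rho_M^r$ is called holonomic if $\rho_1^r\circ\psi$ is. **Proposition.** The map $\rho_1^{\mathcal L}\colon\mathcal W_{\mathcal L}\to J^3\pi$ is bijective. Let $\psi_{\mathcal L}$ be a holonomic section of $J^3\pi\to M$ over an open set $U\subseteq M$ (for instance $U=M$) such that $$\psi_{\mathcal L}^*\,i(X)\Omega_{\mathcal L}=0\quad\text{for every vector field }X\text{ on }J^3\pi .$$ Then $\psi=j_{\mathcal L}\circ(\rho_1^{\mathcal L})^{-1}\circ\psi_{\mathcal L}$ is a (smooth) holonomic section of $\rho_M^r$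 over $U$, and $$\psi^*\,i(X)\Omega_r=0\quad\text{for every vector field }X\text{ on }\mathcal W_r .$$ -/

import Mathlib

open scoped Manifold ContDiff Topology

noncomputable section

namespace SecondOrderField

/-! ### Multi-indices, jet coordinates and iterated partial derivatives -/

/-- The coordinate space of the base. -/
abbrev BaseV (m : ℕ) : Type := EuclideanSpace ℝ (Fin m)

/-- The coordinate space of the fibres. -/
abbrev FibV (n : ℕ) : Type := EuclideanSpace ℝ (Fin n)

/-- The multi-indices `I` with `|I| ≤ k`. -/
def multiIdx (m k : ℕ) : Finset (Fin m → ℕ) :=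
  (Fintype.piFinset fun _ => Finset.range (k + 1)).filter fun I => ∑ i, I i ≤ k

theorem mem_multiIdx {m k : ℕ} {I : Fin m → ℕ} : I ∈ multiIdx m k ↔ ∑ i, I i ≤ k := by
  simp only [multiIdx, Finset.mem_filter, Fintype.mem_piFinset, Finset.mem_range]
  refine ⟨fun h => h.2, fun h => ⟨fun i => ?_, h⟩⟩
  have := Finset.single_le_sum (f := I) (fun _ _ => Nat.zero_le _) (Finset.mem_univ i)
  omega

/-- The multi-indices `I` with `|I| = k`. -/
def multiIdxEq (m k : ℕ) : Finset (Fin m → ℕ) :=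
  (multiIdx m k).filter fun I => ∑ i, I i = k

/-- The multi-index `1_i`. -/
def one {m : ℕ} (i : Fin m) : Fin m → ℕ := Pi.single i 1

/-- The space of the coordinates `(x^i, u^α_I)`, `0 ≤ |I| ≤ k`, with `u^α = u^α_0`. -/
abbrev JetV (m n k : ℕ) : Type := BaseV m × (multiIdx m k → FibV n)

/-- The coordinate `u_I` of a point of `JetV m n k` (it is `0` for `|I| > k`). -/
def JetV.u {m n k : ℕ} (v : JetV m n k) (I : Fin m → ℕ) : FibV n :=
  if h : I ∈ multiIdx m k then v.2 ⟨I, h⟩ else 0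

/-- The coordinate vector `∂/∂x^i`. -/
def dX {m n k : ℕ} (i : Fin m) : JetV m n k := (EuclideanSpace.single i 1, 0)

/-- The coordinate vector `∂/∂u^α_I`. -/
def dU {m n k : ℕ} (I : Fin m → ℕ) (α : Fin n) : JetV m n k :=
  (0, fun J => if J.1 = I then EuclideanSpace.single α 1 else 0)

/-- The coordinate expression `(x, u_I)_{|I| ≤ k} ↦ (x, u_I)_{|I| ≤ r}` of the projection between
jet spaces. -/
def JetV.trunc {m n k : ℕ} (r : ℕ) (v : JetV m n k) : JetV m n r := (v.1, fun I => v.u I.1)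

/-- The total derivative `d F / d x^j = ∂F/∂x^j + ∑_{|I| ≤ k} u^α_{I + 1_j} ∂F/∂u^α_I`. -/
def totalDeriv {m n k : ℕ} (j : Fin m) (F : JetV m n k → ℝ) (v : JetV m n (k + 1)) : ℝ :=
  fderiv ℝ F (v.trunc k) (EuclideanSpace.single j 1, fun I => v.u (I.1 + one j))

/-- The iterated partial derivative `∂^{|I|} f / ∂x^I`. -/
def iterPartial {m n : ℕ} (I : Fin m → ℕ) (f : BaseV m → FibV n) : BaseV m → FibV n :=
  (List.finRange m).foldr
    (fun i g => (fun h : BaseV m → FibV n => fun x => fderiv ℝ h x (EuclideanSpace.single i 1))^[I i] g)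
    f

/-- The combinatorial factor `n(ij)`: `1` if `i = j` and `2` otherwise. -/
def nn {m : ℕ} (i j : Fin m) : ℝ := if i = j then 1 else 2

section Bundle

variable {m n : ℕ} {M : Type*} [TopologicalSpace M] [ChartedSpace (BaseV m) M]
  {E : Type*} [TopologicalSpace E] [ChartedSpace (BaseV m × FibV n) E]

/-! ### Adapted charts, local sections and jets -/

variable (m n) in
/-- A chart of `E` with coordinates `(x^i, u^α)` over a chart of `M` with coordinates `(x^i)`,
in which `π` is `(x, u) ↦ x`. -/
structure AdaptedChart (π : E → M) where
  e : OpenPartialHomeomorph E (BaseV m × FibV n)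
  b : OpenPartialHomeomorph M (BaseV m)
  e_mem : e ∈ IsManifold.maximalAtlas 𝓘(ℝ, BaseV m × FibV n) ∞ E
  b_mem : b ∈ IsManifold.maximalAtlas (𝓡 m) ∞ M
  maps : ∀ p ∈ e.source, π p ∈ b.source
  fst_eq : ∀ p ∈ e.source, (e p).1 = b (π p)

variable (m n) in
/-- `φ` is a smooth section of `π` on a neighbourhood of `x`. -/
def IsLocSec (π : E → M) (φ : M → E) (x : M) : Prop :=
  ∀ᶠ y in 𝓝 x, ContMDiffAt (𝓡 m) 𝓘(ℝ, BaseV m × FibV n) ∞ φ y ∧ π (φ y) = y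

variable (m n) in
/-- A smooth local section of `π` around a point. Values away from the point are irrelevant. -/
structure LocSec (π : E → M) where
  pt : M
  toFun : M → E
  isLocSec : IsLocSec m n π toFun pt

/-- The component functions `φ^α` of a section in an adapted chart. -/
def comps {π : E → M} (c : AdaptedChart m n π) (φ : M → E) : BaseV m → FibV n :=
  fun x => (c.e (φ (c.b.symm x))).2

variable (m n) in
/-- Two local sections have the same `k`-jet: same base point, same value, and the same partial
derivatives up to order `k` in all adapted charts. -/
def jetSetoid (π : E → M) (k : ℕ) : Setoid (LocSec m n π) where
  r s t := s.pt = t.pt ∧ s.toFun s.pt = t.toFun t.pt ∧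
    ∀ c : AdaptedChart m n π, s.toFun s.pt ∈ c.e.source → ∀ I ∈ multiIdx m k,
      iterPartial I (comps c s.toFun) (c.b s.pt) = iterPartial I (comps c t.toFun) (c.b t.pt)
  iseqv :=
    { refl := fun _ => ⟨rfl, rfl, fun _ _ _ _ => rfl⟩
      symm := fun h => ⟨h.1.symm, h.2.1.symm, fun c hc I hI =>
        (h.2.2 c (by rw [h.2.1]; exact hc) I hI).symm⟩
      trans := fun h h' => ⟨h.1.trans h'.1, h.2.1.trans h'.2.1, fun c hc I hI =>
        (h.2.2 c hc I hI).trans (h'.2.2 c (by rw [← h.2.1]; exact hc) I hI)⟩ }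

variable (m n) in
/-- The set of points of the jet bundle `J^k π`. -/
def Jet (π : E → M) (k : ℕ) : Type _ := Quotient (jetSetoid m n π k)

namespace Jet

variable {π : E → M} {k : ℕ}

/-- The `k`-jet `j^k_x φ` of a local section at its base point. -/
def mk (k : ℕ) (s : LocSec m n π) : Jet m n π k := Quotient.mk (jetSetoid m n π k) s

/-- The projection to `M`. -/
def base (j : Jet m n π k) : M := Quotient.lift (s := jetSetoid m n π k) (fun s => s.pt) (fun _ _ h => h.1) j

/-- The projection to `E`. -/
def eval (j : Jet m n π k) : E :=
  Quotient.lift (s := jetSetoid m n π k) (fun s => s.toFun s.pt) (fun _ _ h => h.2.1) j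

/-- The projection `J^k π → J^r π` for `r ≤ k`. -/
def proj (r : ℕ) (hr : r ≤ k) (j : Jet m n π k) : Jet m n π r :=
  Quotient.lift (s := jetSetoid m n π k) (fun s => mk r s)
    (fun _ _ h => Quotient.sound ⟨h.1, h.2.1, fun c hc I hI =>
      h.2.2 c hc I (mem_multiIdx.2 ((mem_multiIdx.1 hI).trans hr))⟩) j

open Classical in
/-- The natural coordinates `(x^i, u^α_I)` of a jet induced by an adapted chart
(used only when the value of the jet lies in the chart). -/
def coord (c : AdaptedChart m n π) (j : Jet m n π k) : JetV m n k :=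
  Quotient.lift (s := jetSetoid m n π k)
    (fun s => ((c.b s.pt, fun I => if s.toFun s.pt ∈ c.e.source then
      iterPartial I.1 (comps c s.toFun) (c.b s.pt) else 0) : JetV m n k))
    (fun s t h => by
      refine Prod.ext (congrArg c.b h.1) (funext fun I => ?_)
      by_cases hs : s.toFun s.pt ∈ c.e.source
      · have ht : t.toFun t.pt ∈ c.e.source := by rw [← h.2.1]; exact hs
        simp only [hs, ht, if_true]
        exact h.2.2 c hs I.1 I.2
      · have ht : t.toFun t.pt ∉ c.e.source := by rw [← h.2.1]; exact hs
        simp only [hs, ht, if_false]) j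

end Jet

open Classical in
/-- The `k`-th prolongation `y ↦ j^k_y φ` of a local section, on the neighbourhood where it is
a smooth section. -/
def LocSec.prol {π : E → M} (k : ℕ) (s : LocSec m n π) (y : M) : Jet m n π k :=
  if h : IsLocSec m n π s.toFun y then Jet.mk k ⟨y, s.toFun, h⟩ else Jet.mk k s

/-! ### Spaces with coordinates induced by adapted charts

All the bundles below lie over `E`, and every adapted chart of `E` induces natural coordinates on the
part of the bundle over its domain. Functions, vector fields and forms on such a bundle are given
by their local expressions in these charts. -/

variable (m n) in
/-- The charts on `P`, with values in `V`, induced by the adapted charts. -/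
structure Charts (π : E → M) (P : Type*) (V : Type*) where
  dom : AdaptedChart m n π → Set P
  coord : AdaptedChart m n π → P → V

namespace Charts

variable {π : E → M} {P Q V V' : Type*} [NormedAddCommGroup V] [NormedSpace ℝ V]
  [NormedAddCommGroup V'] [NormedSpace ℝ V']

/-- The set of values of the coordinates. -/
def target (A : Charts m n π P V) (c : AdaptedChart m n π) : Set V := A.coord c '' A.dom c

open Classical in
/-- The local expression of a map `g` on `P` in the chart `c` (extended by zero). -/
def inChart (A : Charts m n π P V) (c : AdaptedChart m n π) (g : P → V') (v : V) : V' :=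
  if h : ∃ p ∈ A.dom c, A.coord c p = v then g h.choose else 0

/-- The coordinate change from the chart `c` to the chart `c'`. -/
def trans (A : Charts m n π P V) (c c' : AdaptedChart m n π) : V → V := A.inChart c (A.coord c')

/-- Smooth functions. -/
def SmoothFun (A : Charts m n π P V) (f : P → ℝ) : Prop :=
  ∀ c, ContDiffOn ℝ ∞ (A.inChart c f) (A.target c)

/-- Smooth vector fields: smooth components in every chart, related by the coordinate changes. -/
structure VField (A : Charts m n π P V) where
  val : AdaptedChart m n π → V → V
  smooth : ∀ c, ContDiffOn ℝ ∞ (val c) (A.target c)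
  compat : ∀ c c', ∀ p ∈ A.dom c ∩ A.dom c',
    val c' (A.coord c' p) = fderiv ℝ (A.trans c c') (A.coord c p) (val c (A.coord c p))

/-- Local expressions of a `k`-form (only the values on `A.target c` matter). -/
def Form (_A : Charts m n π P V) (k : ℕ) : Type _ := AdaptedChart m n π → V → V [⋀^Fin k]→L[ℝ] ℝ

/-- Minus the exterior derivative. -/
def negExtDeriv {A : Charts m n π P V} {k : ℕ} (θ : A.Form k) : A.Form (k + 1) :=
  fun c v => -extDeriv (θ c) v

/-- The pull-back `f^* θ` of a form by a map `f : P → Q` over `E`. -/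
def pullback (A : Charts m n π P V) {B : Charts m n π Q V'} {k : ℕ} (f : P → Q) (θ : B.Form k) :
    A.Form k :=
  fun c v => (θ c (A.inChart c (B.coord c ∘ f) v)).compContinuousLinearMap
    (fderiv ℝ (A.inChart c (B.coord c ∘ f)) v)

/-- `ψ` is a smooth section, over the open set `U ⊆ M`, of the projection `pr : P → M`. -/
def IsSection (A : Charts m n π P V) (pr : P → M) (ψ : M → P) (U : Set M) : Prop :=
  ∀ x ∈ U, pr (ψ x) = x ∧ ∀ c, ψ x ∈ A.dom c →
    (∀ᶠ y in 𝓝 x, ψ y ∈ A.dom c) ∧ ContMDiffAt (𝓡 m) 𝓘(ℝ, V) ∞ (A.coord c ∘ ψ) x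

/-- The equation `ψ^* i(X) Ω = 0` on `U` for every vector field `X` on `P`. -/
def FieldEq (A : Charts m n π P V) (Ω : A.Form (m + 1)) (ψ : M → P) (U : Set M) : Prop :=
  ∀ X : A.VField, ∀ x ∈ U, ∀ c, ψ x ∈ A.dom c →
    ((Ω c (A.coord c (ψ x))).curryLeft (X.val c (A.coord c (ψ x)))).compContinuousLinearMap
      (fderiv ℝ (A.coord c ∘ ψ ∘ c.b.symm) (c.b x)) = 0

end Charts

variable (m n) in
/-- The natural charts of `J^k π`. -/
def jetCharts (π : E → M) (k : ℕ) : Charts m n π (Jet m n π k) (JetV m n k) where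
  dom c := {j | j.eval ∈ c.e.source}
  coord c := Jet.coord c

/-- `ψ` is holonomic on `U`: it is the `k`-th prolongation of the section `π^k ∘ ψ`. -/
def IsHolonomic {π : E → M} {k : ℕ} (ψ : M → Jet m n π k) (U : Set M) : Prop :=
  ∀ x ∈ U, ∃ h : IsLocSec m n π (fun y => (ψ y).eval) x,
    ψ x = Jet.mk k ⟨x, fun y => (ψ y).eval, h⟩

/-! ### Volume form and Lagrangian density -/

/-- The local expression of an `m`-form on `M` in a chart. -/
def formRep (η : (x : M) → (TangentSpace (𝓡 m) x) [⋀^Fin m]→L[ℝ] ℝ)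
    (b : OpenPartialHomeomorph M (BaseV m)) (x : BaseV m) : BaseV m [⋀^Fin m]→L[ℝ] ℝ :=
  (η (b.symm x)).compContinuousLinearMap (mfderiv 𝓘(ℝ, BaseV m) (𝓡 m) b.symm x)

/-- A volume form on `M`: a smooth nowhere vanishing `m`-form. -/
structure IsVolumeForm (η : (x : M) → (TangentSpace (𝓡 m) x) [⋀^Fin m]→L[ℝ] ℝ) : Prop where
  smooth : ∀ b ∈ IsManifold.maximalAtlas (𝓡 m) ∞ M, ContDiffOn ℝ ∞ (formRep η b) b.target
  ne_zero : ∀ x, η x ≠ 0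

/-- The function `𝓛_c` with `𝓛 = L · η = 𝓛_c dx^1 ∧ … ∧ dx^m` in the chart `c`. It is the local
expression of `L` when `η = dx^1 ∧ … ∧ dx^m` in the chart. -/
def lagRep {π : E → M} (L : Jet m n π 2 → ℝ)
    (η : (x : M) → (TangentSpace (𝓡 m) x) [⋀^Fin m]→L[ℝ] ℝ) (c : AdaptedChart m n π)
    (v : JetV m n 2) : ℝ :=
  (jetCharts m n π 2).inChart c L v * formRep η c.b v.1 (fun i => EuclideanSpace.single i 1)

/-! ### Symmetric multimomenta -/

variable (m n) in
/-- A point of the extended 2-symmetric multimomentum bundle `J²π†`: an `m`-form at a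
point of `J¹π`, given by its compatible expressions in the natural charts around the point, that is
annihilated by two vertical vectors and whose components `p_α^{ij}` are symmetric in `i, j`.
As `d^{m-1}x_j = i(∂_j) d^m x`, the component along `du_i^α ∧ d^{m-1}x_j` is obtained by
putting `∂/∂u_i^α` in the `j`-th place of `(∂/∂x^1, …, ∂/∂x^m)`. -/
@[ext] structure Mom (π : E → M) where
  base : Jet m n π 1
  val : AdaptedChart m n π → JetV m n 1 [⋀^Fin m]→L[ℝ] ℝ
  val_zero : ∀ c, base ∉ (jetCharts m n π 1).dom c → val c = 0
  compat : ∀ c c', base ∈ (jetCharts m n π 1).dom c → base ∈ (jetCharts m n π 1).dom c' →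
    val c = (val c').compContinuousLinearMap
      (fderiv ℝ ((jetCharts m n π 1).trans c c') ((jetCharts m n π 1).coord c base))
  two_vert : ∀ c, ∀ v : Fin m → JetV m n 1,
    (∃ i j, i ≠ j ∧ (v i).1 = 0 ∧ (v j).1 = 0) → val c v = 0
  symm : ∀ c i j α, val c (Function.update dX j (dU (one i) α)) =
    val c (Function.update dX i (dU (one j) α))

namespace Mom

variable {π : E → M}

/-- The coordinate `p`. -/
def p (τ : Mom m n π) (c : AdaptedChart m n π) : ℝ := τ.val c dX

/-- The coordinate `p_α^i`. -/
def pi (τ : Mom m n π) (c : AdaptedChart m n π) (i : Fin m) (α : Fin n) : ℝ :=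
  τ.val c (Function.update dX i (dU 0 α))

/-- The coordinate `p_α^{ij}`. -/
def pij (τ : Mom m n π) (c : AdaptedChart m n π) (i j : Fin m) (α : Fin n) : ℝ :=
  τ.val c (Function.update dX j (dU (one i) α))

/-- The coordinate `p_α^I`, `|I| = 2`, with `p_α^{ij} = p_α^{1_i+1_j} / n(ij)`. -/
def pI (τ : Mom m n π) (c : AdaptedChart m n π) (I : Fin m → ℕ) (α : Fin n) : ℝ :=
  ∑ i, ∑ j, if one i + one j = I then τ.pij c i j α else 0

variable (m n) in
/-- Equality modulo `Λ_1^m(J¹π)`: the difference is annihilated by one vertical vector. -/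
def setoid (π : E → M) : Setoid (Mom m n π) where
  r τ τ' := τ.base = τ'.base ∧ ∀ c, ∀ v : Fin m → JetV m n 1,
    (∃ i, (v i).1 = 0) → τ.val c v = τ'.val c v
  iseqv :=
    { refl := fun _ => ⟨rfl, fun _ _ _ => rfl⟩
      symm := fun h => ⟨h.1.symm, fun c v hv => (h.2 c v hv).symm⟩
      trans := fun h h' => ⟨h.1.trans h'.1, fun c v hv => (h.2 c v hv).trans (h'.2 c v hv)⟩ }

/-- The zero form at a point. -/
def zero (u : Jet m n π 1) : Mom m n π where
  base := u
  val := 0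
  val_zero := fun _ _ => rfl
  compat := fun _ _ _ _ => by ext; simp
  two_vert := fun _ _ _ => rfl
  symm := fun _ _ _ _ => rfl

end Mom

variable (m n) in
/-- The restricted 2-symmetric multimomentum bundle `J²π‡ = J²π† / Λ_1^m(J¹π)`. -/
def RMom (π : E → M) : Type _ := Quotient (Mom.setoid m n π)

namespace RMom

variable {π : E → M}

/-- The quotient map `μ`. -/
def mk (τ : Mom m n π) : RMom m n π := Quotient.mk (Mom.setoid m n π) τ

/-- The projection to `J¹π`. -/
def base (q : RMom m n π) : Jet m n π 1 := Quotient.lift (s := Mom.setoid m n π) Mom.base (fun _ _ h => h.1) q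

/-- The coordinate `p_α^i`. -/
def pi (q : RMom m n π) (c : AdaptedChart m n π) (i : Fin m) (α : Fin n) : ℝ :=
  Quotient.lift (s := Mom.setoid m n π) (fun τ => τ.pi c i α)
    (fun _ _ h => h.2 c _ ⟨i, by simp [dU]⟩) q

/-- The coordinate `p_α^I`. -/
def pI (q : RMom m n π) (c : AdaptedChart m n π) (I : Fin m → ℕ) (α : Fin n) : ℝ :=
  Quotient.lift (s := Mom.setoid m n π) (fun τ => τ.pI c I α)
    (fun τ τ' h => by
      simp only [Mom.pI]
      refine Finset.sum_congr rfl fun i _ => Finset.sum_congr rfl fun j _ => ?_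
      rw [show τ.pij c i j α = τ'.pij c i j α from h.2 c _ ⟨j, by simp [dU]⟩]) q

end RMom

/-- The space of the momentum coordinates `(p_α^i, p_α^I)`, `|I| = 2`. -/
abbrev MomV (m n : ℕ) : Type := (Fin m → Fin n → ℝ) × (multiIdxEq m 2 → Fin n → ℝ)

variable (m n) in
/-- The natural charts `(x^i, u^α, u_i^α, p, p_α^i, p_α^I)` of `J²π†`. -/
def momCharts (π : E → M) : Charts m n π (Mom m n π) (JetV m n 1 × ℝ × MomV m n) where
  dom c := {τ | τ.base ∈ (jetCharts m n π 1).dom c}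
  coord c τ := ((jetCharts m n π 1).coord c τ.base, τ.p c, τ.pi c, fun I => τ.pI c I.1)

variable (m n) in
/-- The symmetrized Liouville form `Θ_1^s`, the tautological `m`-form of `J²π†`. -/
def liouville (π : E → M) : (momCharts m n π).Form m := fun c v =>
  ((momCharts m n π).inChart c (fun τ => τ.val c) v).compContinuousLinearMap
    (fderiv ℝ ((momCharts m n π).inChart c fun τ => (jetCharts m n π 1).coord c τ.base) v)

variable (m n) in
/-- The symmetrized Liouville form `Ω_1^s = -dΘ_1^s`. -/
def liouvilleOmega (π : E → M) : (momCharts m n π).Form (m + 1) := Charts.negExtDeriv (liouville m n π)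

/-! ### The unified jet-multimomentum bundles -/

variable (m n) in
/-- `𝓦 = J³π ×_{J¹π} J²π†`. -/
def W (π : E → M) : Type _ :=
  {z : Jet m n π 3 × Mom m n π // z.1.proj 1 (by norm_num) = z.2.base}

variable (m n) in
/-- `𝓦_r = J³π ×_{J¹π} J²π‡`. -/
def Wr (π : E → M) : Type _ :=
  {z : Jet m n π 3 × RMom m n π // z.1.proj 1 (by norm_num) = z.2.base}

variable (m n) in
/-- The natural charts of `𝓦`. -/
def wCharts (π : E → M) : Charts m n π (W m n π) (JetV m n 3 × ℝ × MomV m n) where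
  dom c := {w | w.1.1 ∈ (jetCharts m n π 3).dom c}
  coord c w := ((jetCharts m n π 3).coord c w.1.1, w.1.2.p c, w.1.2.pi c, fun I => w.1.2.pI c I.1)

variable (m n) in
/-- The natural charts of `𝓦_r`. -/
def wrCharts (π : E → M) : Charts m n π (Wr m n π) (JetV m n 3 × MomV m n) where
  dom c := {w | w.1.1 ∈ (jetCharts m n π 3).dom c}
  coord c w := ((jetCharts m n π 3).coord c w.1.1, w.1.2.pi c, fun I => w.1.2.pI c I.1)

variable {π : E → M}

/-- The projection `ρ_2 : 𝓦 → J²π†`. -/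
def rho2 (w : W m n π) : Mom m n π := w.1.2

/-- The projection `ρ_1^r : 𝓦_r → J³π`. -/
def rho1r (w : Wr m n π) : Jet m n π 3 := w.1.1

/-- The projection `ρ_M^r : 𝓦_r → M`. -/
def rhoMr (w : Wr m n π) : M := w.1.1.base

/-- The quotient map `μ_𝓦 : 𝓦 → 𝓦_r`. -/
def muW (w : W m n π) : Wr m n π := ⟨(w.1.1, RMom.mk w.1.2), w.2⟩

theorem muW_surjective (w : Wr m n π) : ∃ z : W m n π, muW z = w := by
  obtain ⟨⟨j, q⟩, h⟩ := w
  induction q using Quotient.inductionOn with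
  | h τ => exact ⟨⟨(j, τ), h⟩, rfl⟩

/-- The pairing `(j¹φ)^*_{j¹_x φ} τ`, an `m`-form at `x`, in the coordinates of the chart `c`. -/
def pairing (c : AdaptedChart m n π) (s : LocSec m n π) (τ : Mom m n π) : BaseV m [⋀^Fin m]→L[ℝ] ℝ :=
  (τ.val c).compContinuousLinearMap
    (fderiv ℝ ((jetCharts m n π 1).coord c ∘ s.prol 1 ∘ c.b.symm) (c.b s.pt))

/-- The Hamiltonian submanifold `𝓦_o ⊆ 𝓦`, where the coupling form equals the Lagrangian density
`𝓛 = L · η`. -/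
def Wo (L : Jet m n π 2 → ℝ) (η : (x : M) → (TangentSpace (𝓡 m) x) [⋀^Fin m]→L[ℝ] ℝ) : Set (W m n π) :=
  {w | ∀ s : LocSec m n π, Jet.mk 3 s = w.1.1 → ∀ c, w ∈ (wCharts m n π).dom c →
    pairing c s w.1.2 = L (w.1.1.proj 2 (by norm_num)) • formRep η c.b (c.b s.pt)}

open Classical in
/-- The Hamiltonian section `ĥ = j_o ∘ Φ⁻¹ : 𝓦_r → 𝓦`, where `Φ = μ_𝓦 ∘ j_o : 𝓦_o → 𝓦_r`. -/
def ham (L : Jet m n π 2 → ℝ) (η : (x : M) → (TangentSpace (𝓡 m) x) [⋀^Fin m]→L[ℝ] ℝ)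
    (w : Wr m n π) : W m n π :=
  if h : ∃ z ∈ Wo L η, muW z = w then h.choose else (muW_surjective w).choose

/-- The form `Ω_r = ĥ^* ρ_2^* Ω_1^s` on `𝓦_r`. -/
def omegaR (L : Jet m n π 2 → ℝ) (η : (x : M) → (TangentSpace (𝓡 m) x) [⋀^Fin m]→L[ℝ] ℝ) :
    (wrCharts m n π).Form (m + 1) :=
  (wrCharts m n π).pullback (ham L η) ((wCharts m n π).pullback rho2 (liouvilleOmega m n π))

/-! ### The Legendre map and the Poincaré–Cartan form -/

/-- The local function `∂𝓛/∂u_I^α`, `|I| = 2`. -/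
def legI (L : Jet m n π 2 → ℝ) (η : (x : M) → (TangentSpace (𝓡 m) x) [⋀^Fin m]→L[ℝ] ℝ)
    (c : AdaptedChart m n π) (I : Fin m → ℕ) (α : Fin n) (v : JetV m n 2) : ℝ :=
  fderiv ℝ (lagRep L η c) v (dU I α)

/-- The local function `∂𝓛/∂u_i^α - ∑_j (1 / n(ij)) d/dx^j (∂𝓛/∂u_{1_i+1_j}^α)`. -/
def legi (L : Jet m n π 2 → ℝ) (η : (x : M) → (TangentSpace (𝓡 m) x) [⋀^Fin m]→L[ℝ] ℝ)
    (c : AdaptedChart m n π) (i : Fin m) (α : Fin n) (v : JetV m n 3) : ℝ :=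
  fderiv ℝ (lagRep L η c) (v.trunc 2) (dU (one i) α) -
    ∑ j, (1 / nn i j) * totalDeriv j (legI L η c (one i + one j) α) v

/-- The submanifold `𝓦_𝓛 ⊆ 𝓦_r`, the graph of the restricted Legendre map. -/
def WL (L : Jet m n π 2 → ℝ) (η : (x : M) → (TangentSpace (𝓡 m) x) [⋀^Fin m]→L[ℝ] ℝ) : Set (Wr m n π) :=
  {w | ∀ c, w ∈ (wrCharts m n π).dom c →
    (∀ i α, w.1.2.pi c i α = legi L η c i α ((jetCharts m n π 3).coord c w.1.1)) ∧
    (∀ I ∈ multiIdxEq m 2, ∀ α, w.1.2.pI c I α =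
      legI L η c I α (((jetCharts m n π 3).coord c w.1.1).trunc 2))}

/-- The map `ρ_1^𝓛 = ρ_1^r ∘ j_𝓛 : 𝓦_𝓛 → J³π`. -/
def rho1L (L : Jet m n π 2 → ℝ) (η : (x : M) → (TangentSpace (𝓡 m) x) [⋀^Fin m]→L[ℝ] ℝ)
    (w : WL L η) : Jet m n π 3 := rho1r w.1

open Classical in
/-- The extended Legendre map `J³π → J²π†`, that is `ρ_2 ∘ ĥ ∘ j_𝓛 ∘ (ρ_1^𝓛)⁻¹`. -/
def extLegendre (L : Jet m n π 2 → ℝ) (η : (x : M) → (TangentSpace (𝓡 m) x) [⋀^Fin m]→L[ℝ] ℝ)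
    (j : Jet m n π 3) : Mom m n π :=
  if h : ∃ w : WL L η, rho1L L η w = j then rho2 (ham L η h.choose.1)
  else Mom.zero (j.proj 1 (by norm_num))

/-- The Poincaré–Cartan form `Ω_𝓛` on `J³π`, the pull-back of `Ω_1^s` by the extended
Legendre map. -/
def omegaL (L : Jet m n π 2 → ℝ) (η : (x : M) → (TangentSpace (𝓡 m) x) [⋀^Fin m]→L[ℝ] ℝ) :
    (jetCharts m n π 3).Form (m + 1) :=
  (jetCharts m n π 3).pullback (extLegendre L η) (liouvilleOmega m n π)

end Bundle

end SecondOrderField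

end

/-! The Legendre formulas define a section `s` of `𝓦_r → J³π` with image `𝓦_𝓛`, and `ψ = s ∘ ψ_𝓛`.
The extended Legendre map is `ρ₂ ∘ ĥ ∘ s`, hence `Ω_𝓛 = s^* Ω_r` (`omegaL_eq`). At a point of the
image of `s`, a tangent vector `Z` of `𝓦_r` splits as `Ts(Z₁) + (0, μ)`, where `Z₁` is its
projection to `J³π` and `(0, μ)` points in the momentum directions.

The contribution of `Ts(Z₁)` to `ψ^* i(Z) Ω_r` is `ψ_𝓛^* i(Z₁) Ω_𝓛`. It vanishes by hypothesis,
because `Z₁` extends to a vector field by a cut-off (`exists_vField`). The contribution of `(0, μ)`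
vanishes by holonomy alone. On the image of `ĥ` one has `p = 𝓛 - C(ν)`, where `C(ν)` is the value of
the form with momenta `ν` and `p = 0` on the total derivatives (`coupling`). So `Tĥ` sends `(0, μ)`
to `(0, -C(μ), μ)`. Contracting `dΘ` with a momentum vector returns the form with these momenta
(`extDeriv_stdTheta_vertical`). Vectors tangent to a holonomic section project to total derivatives
on `J¹π`, where this form takes the value `-C(μ) + C(μ) = 0` (`omegaR_vertical`).

In a chart `𝓦_𝓛` is a graph, so `ρ_1^𝓛` is injective. Surjectivity says that the Legendre formulas
of different adapted charts describe the same point of `J²π‡` (`Transition.momOf_comp_cLeg`). This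
rests on a characterization by the first variation (`VarEq`): along a section, and for variations
`ξ` that vanish at the point considered, `δ𝓛` is the divergence of the flux of the momenta through
`j¹ξ`. As `ξ` vanishes there, no Euler–Lagrange term appears, and comparing the coefficients of the
derivatives of `ξ` gives the Legendre formulas (`varEq_iff`, `varEq_iff_cLeg`). The divergence is
the exterior derivative of `(j¹P)^* i(j¹ξ) α`, so it is natural under changes of coordinates
(`Transition.sum_fderiv_flux_pullForm`), and both sides scale by the Jacobian. Besides, adapted
changes preserve the symmetry of `p_α^{ij}` (`Transition.isSymMom_comp`).

Jet calculus is carried out on actual sections: each coordinate jet is the jet of a polynomial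
(`exists_jet_eq`), and changes of charts act on jets by smooth maps (`exists_jet_transition`). -/

open scoped Manifold ContDiff Topology

noncomputable section

namespace SecondOrderField

/-! ### Functions that are smooth near a point -/

/-- `f` is smooth at all points of a neighbourhood of `x`. -/
def SmoothNear {V W : Type*} [NormedAddCommGroup V] [NormedSpace ℝ V] [NormedAddCommGroup W]
    [NormedSpace ℝ W] (f : V → W) (x : V) : Prop :=
  ∀ᶠ y in 𝓝 x, ContDiffAt ℝ ∞ f y

section SmoothNear

variable {V W X : Type*} [NormedAddCommGroup V] [NormedSpace ℝ V] [NormedAddCommGroup W]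
  [NormedSpace ℝ W] [NormedAddCommGroup X] [NormedSpace ℝ X]

theorem SmoothNear.contDiffAt {f : V → W} {x : V} (h : SmoothNear f x) : ContDiffAt ℝ ∞ f x :=
  Filter.Eventually.self_of_nhds h

/-- This openness is the reason for the predicate. `ContDiffAt ℝ ∞` at a point only gives
neighbourhoods that may shrink with the order of differentiability, while identities between
iterated derivatives must be differentiated again at all nearby points. -/
theorem SmoothNear.eventually {f : V → W} {x : V} (h : SmoothNear f x) :
    ∀ᶠ y in 𝓝 x, SmoothNear f y :=
  Filter.Eventually.eventually_nhds h

theorem SmoothNear.differentiableAt {f : V → W} {x : V} (h : SmoothNear f x) :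
    DifferentiableAt ℝ f x :=
  h.contDiffAt.differentiableAt (by simp)

theorem SmoothNear.continuousAt {f : V → W} {x : V} (h : SmoothNear f x) : ContinuousAt f x :=
  h.contDiffAt.continuousAt

theorem SmoothNear.congr {f g : V → W} {x : V} (h : SmoothNear f x) (hfg : g =ᶠ[𝓝 x] f) :
    SmoothNear g x := by
  filter_upwards [h, hfg.eventually_nhds] with y hy hy'
  exact hy.congr_of_eventuallyEq hy'

theorem smoothNear_of_contDiffOn {f : V → W} {s : Set V} {x : V} (h : ContDiffOn ℝ ∞ f s)
    (hs : IsOpen s) (hx : x ∈ s) : SmoothNear f x := by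
  filter_upwards [hs.mem_nhds hx] with y hy
  exact h.contDiffAt (hs.mem_nhds hy)

theorem _root_.ContDiff.smoothNear {f : V → W} (h : ContDiff ℝ ∞ f) (x : V) : SmoothNear f x :=
  Filter.Eventually.of_forall fun _ => h.contDiffAt

theorem SmoothNear.comp {g : W → X} {f : V → W} {x : V} (hg : SmoothNear g (f x))
    (hf : SmoothNear f x) : SmoothNear (fun y => g (f y)) x := by
  filter_upwards [hf, hf.continuousAt.eventually hg] with y hy hy'
  exact hy'.comp y hy

theorem SmoothNear.prodMk {g : V → X} {f : V → W} {x : V} (hf : SmoothNear f x)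
    (hg : SmoothNear g x) : SmoothNear (fun y => (f y, g y)) x := by
  filter_upwards [hf, hg] with y hy hy'
  exact hy.prodMk hy'

theorem SmoothNear.add {f g : V → W} {x : V} (hf : SmoothNear f x)
    (hg : SmoothNear g x) : SmoothNear (fun y => f y + g y) x := by
  filter_upwards [hf, hg] with y hy hy'
  exact hy.add hy'

theorem SmoothNear.smul {f : V → ℝ} {g : V → W} {x : V} (hf : SmoothNear f x)
    (hg : SmoothNear g x) : SmoothNear (fun y => f y • g y) x := by
  filter_upwards [hf, hg] with y hy hy'
  exact hy.smul hy'

theorem smoothNear_id {x : V} : SmoothNear (fun y : V => y) x := contDiff_id.smoothNear x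

theorem smoothNear_const {c : W} {x : V} : SmoothNear (fun _ : V => c) x :=
  contDiff_const.smoothNear x

theorem _root_.ContinuousLinearMap.smoothNear (f : V →L[ℝ] W) (x : V) : SmoothNear f x :=
  f.contDiff.smoothNear x

theorem SmoothNear.clm_apply {A : V → W →L[ℝ] X} {f : V → W} {x : V} (hA : SmoothNear A x)
    (hf : SmoothNear f x) : SmoothNear (fun y => A y (f y)) x := by
  filter_upwards [hA, hf] with y hy hy'
  exact hy.clm_apply hy'

theorem SmoothNear.fderiv {f : V → W} {x : V} (h : SmoothNear f x) :
    SmoothNear (fderiv ℝ f) x := by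
  filter_upwards [h] with y hy
  exact hy.fderiv_right (by simp)

theorem SmoothNear.fderiv_apply {f : V → W} {x : V} (h : SmoothNear f x) (v : V) :
    SmoothNear (fun y => _root_.fderiv ℝ f y v) x :=
  h.fderiv.clm_apply smoothNear_const

theorem SmoothNear.fderiv_comm {f : V → W} {x : V} (h : SmoothNear f x) (u v : V) :
    _root_.fderiv ℝ (fun y => _root_.fderiv ℝ f y u) x v =
      _root_.fderiv ℝ (fun y => _root_.fderiv ℝ f y v) x u := by
  have hd : DifferentiableAt ℝ (_root_.fderiv ℝ f) x := h.fderiv.differentiableAt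
  have key : ∀ w : V, _root_.fderiv ℝ (fun y => _root_.fderiv ℝ f y w) x =
      (_root_.fderiv ℝ (_root_.fderiv ℝ f) x).flip w := fun w => by
    ext z
    rw [fderiv_clm_apply hd (differentiableAt_const w)]
    simp
  rw [key, key]
  exact (h.contDiffAt.isSymmSndFDerivAt (by simpa using WithTop.coe_le_coe.2 (le_top : (2 : ℕ∞) ≤ ⊤))) v u

theorem fderiv_slice {Ψ : X × V → W} {z : X × V} (h : DifferentiableAt ℝ Ψ z) (v : V) :
    fderiv ℝ (fun y => Ψ (z.1, y)) z.2 v = fderiv ℝ Ψ z (0, v) := by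
  have := (HasFDerivAt.comp (g := Ψ) (f := fun y => (z.1, y)) z.2 h.hasFDerivAt (hasFDerivAt_prodMk_right z.1 z.2)).fderiv
  exact congrArg (fun A : V →L[ℝ] W => A v) this

theorem fderiv_slice_left {Ψ : X × V → W} {z : X × V} (h : DifferentiableAt ℝ Ψ z) (u : X) :
    fderiv ℝ (fun y => Ψ (y, z.2)) z.1 u = fderiv ℝ Ψ z (u, 0) := by
  have := (HasFDerivAt.comp (g := Ψ) (f := fun y => (y, z.2)) z.1 h.hasFDerivAt (hasFDerivAt_prodMk_left z.1 z.2)).fderiv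
  exact congrArg (fun A : X →L[ℝ] W => A u) this

end SmoothNear

/-! ### Iterated partial derivatives -/

section IterPartial

variable {m n : ℕ}

/-- The partial derivative `∂f/∂x^i`. -/
def pd (i : Fin m) (f : BaseV m → FibV n) : BaseV m → FibV n :=
  fun x => fderiv ℝ f x (EuclideanSpace.single i 1)

theorem SmoothNear.pd {f : BaseV m → FibV n} {x : BaseV m} (h : SmoothNear f x) (i : Fin m) :
    SmoothNear (pd i f) x :=
  h.fderiv_apply _

theorem pd_congr {f g : BaseV m → FibV n} {x : BaseV m} (h : f =ᶠ[𝓝 x] g) (i : Fin m) :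
    pd i f =ᶠ[𝓝 x] pd i g := by
  filter_upwards [h.fderiv (𝕜 := ℝ)] with y hy
  rw [pd, pd, hy]

theorem pd_comm {f : BaseV m → FibV n} {x : BaseV m} (h : SmoothNear f x) (i j : Fin m) :
    pd i (pd j f) =ᶠ[𝓝 x] pd j (pd i f) := by
  filter_upwards [h.eventually] with y hy
  exact hy.fderiv_comm _ _

theorem SmoothNear.pd_iterate {f : BaseV m → FibV n} {x : BaseV m} (h : SmoothNear f x)
    (i : Fin m) (k : ℕ) : SmoothNear ((SecondOrderField.pd i)^[k] f) x := by
  induction k with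
  | zero => exact h
  | succ k ih => rw [Function.iterate_succ_apply']; exact ih.pd i

theorem pd_iterate_congr {f g : BaseV m → FibV n} {x : BaseV m} (h : f =ᶠ[𝓝 x] g) (i : Fin m)
    (k : ℕ) : (pd i)^[k] f =ᶠ[𝓝 x] (pd i)^[k] g := by
  induction k with
  | zero => exact h
  | succ k ih => rw [Function.iterate_succ_apply', Function.iterate_succ_apply']; exact pd_congr ih i

theorem pd_iterate_comm {f : BaseV m → FibV n} {x : BaseV m} (h : SmoothNear f x) (i j : Fin m)
    (k : ℕ) : (pd i)^[k] (pd j f) =ᶠ[𝓝 x] pd j ((pd i)^[k] f) := by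
  induction k with
  | zero => rfl
  | succ k ih =>
    rw [Function.iterate_succ_apply', Function.iterate_succ_apply']
    exact (pd_congr ih i).trans (pd_comm (h.pd_iterate i k) i j)

/-- The iterated partial derivatives in the directions of a list. -/
def listPartial (l : List (Fin m)) (I : Fin m → ℕ) (f : BaseV m → FibV n) : BaseV m → FibV n :=
  l.foldr (fun i g => (pd i)^[I i] g) f

theorem iterPartial_eq_listPartial (I : Fin m → ℕ) (f : BaseV m → FibV n) :
    iterPartial I f = listPartial (List.finRange m) I f := rfl

theorem SmoothNear.listPartial {f : BaseV m → FibV n} {x : BaseV m} (h : SmoothNear f x)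
    (l : List (Fin m)) (I : Fin m → ℕ) : SmoothNear (listPartial l I f) x := by
  induction l with
  | nil => exact h
  | cons a l ih => exact ih.pd_iterate a _

theorem listPartial_congr {f g : BaseV m → FibV n} {x : BaseV m} (h : f =ᶠ[𝓝 x] g)
    (l : List (Fin m)) (I : Fin m → ℕ) : listPartial l I f =ᶠ[𝓝 x] listPartial l I g := by
  induction l with
  | nil => exact h
  | cons a l ih => exact pd_iterate_congr ih a _

theorem listPartial_congr_idx (l : List (Fin m)) {I J : Fin m → ℕ} (h : ∀ i ∈ l, I i = J i)
    (f : BaseV m → FibV n) : listPartial l I f = listPartial l J f := by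
  induction l with
  | nil => rfl
  | cons a l ih =>
    change (pd a)^[I a] (listPartial l I f) = (pd a)^[J a] (listPartial l J f)
    rw [h a (by simp), ih fun i hi => h i (by simp [hi])]

/-- Iterated partial derivatives are taken in the fixed order of the list, so the extra derivative
in direction `j` has to be commuted past the directions in front of `j`. Without repetitions in the
list, the extra unit of the exponent is used exactly once. -/
theorem listPartial_add_one {f : BaseV m → FibV n} {x : BaseV m} (h : SmoothNear f x)
    (l : List (Fin m)) (hl : l.Nodup) (I : Fin m → ℕ) (j : Fin m) (hj : j ∈ l) :
    listPartial l (I + one j) f =ᶠ[𝓝 x] pd j (listPartial l I f) := by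
  induction l with
  | nil => simp at hj
  | cons a l ih =>
    change (pd a)^[(I + one j) a] (listPartial l (I + one j) f) =ᶠ[𝓝 x]
      pd j ((pd a)^[I a] (listPartial l I f))
    rw [List.nodup_cons] at hl
    by_cases haj : a = j
    · subst haj
      rw [listPartial_congr_idx l (J := I) fun i hi => ?_]
      · rw [Pi.add_apply, one, Pi.single_eq_same, Function.iterate_succ_apply']
      · have : i ≠ a := fun h => hl.1 (h ▸ hi)
        simp [one, this]
    · have e : (I + one j) a = I a := by simp [one, haj]
      rw [e]
      exact (pd_iterate_congr (ih hl.2 (by simpa [Ne.symm haj] using hj)) a _).trans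
        (pd_iterate_comm (h.listPartial l I) a j _)

theorem iterPartial_zero (f : BaseV m → FibV n) : iterPartial 0 f = f := by
  rw [iterPartial_eq_listPartial]
  induction List.finRange m with
  | nil => rfl
  | cons a l ih => exact ih

theorem SmoothNear.iterPartial {f : BaseV m → FibV n} {x : BaseV m} (h : SmoothNear f x)
    (I : Fin m → ℕ) : SmoothNear (iterPartial I f) x :=
  h.listPartial _ I

theorem iterPartial_congr {f g : BaseV m → FibV n} {x : BaseV m} (h : f =ᶠ[𝓝 x] g)
    (I : Fin m → ℕ) : iterPartial I f =ᶠ[𝓝 x] iterPartial I g :=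
  listPartial_congr h _ I

theorem iterPartial_add_one {f : BaseV m → FibV n} {x : BaseV m} (h : SmoothNear f x)
    (I : Fin m → ℕ) (j : Fin m) : iterPartial (I + one j) f =ᶠ[𝓝 x] pd j (iterPartial I f) :=
  listPartial_add_one h _ (List.nodup_finRange m) I j (List.mem_finRange j)

/-- Induction on multi-indices. -/
theorem multiIdx_induction {motive : (Fin m → ℕ) → Prop} (zero : motive 0)
    (add_one : ∀ I j, motive I → motive (I + one j)) (I : Fin m → ℕ) : motive I := by
  induction hk : ∑ i, I i generalizing I with
  | zero =>
    have : I = 0 := funext fun i => by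
      simpa using (Finset.sum_eq_zero_iff.1 hk) i (Finset.mem_univ i)
    rw [this]; exact zero
  | succ k ih =>
    obtain ⟨j, hj⟩ : ∃ j, I j ≠ 0 := by
      by_contra! hc
      simp [hc] at hk
    have e : I = (I - one j) + one j := by
      funext i
      by_cases hi : i = j
      · subst hi; simp [one]; omega
      · simp [one, hi]
    have hs : ∑ i, I i = ∑ i, (I - one j) i + 1 := by
      conv_lhs => rw [e]
      simp [Finset.sum_add_distrib, one]
    rw [e]
    exact add_one _ _ (ih _ (by omega))

theorem sum_add_one (I : Fin m → ℕ) (j : Fin m) : ∑ i, (I + one j) i = ∑ i, I i + 1 := by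
  simp [Finset.sum_add_distrib, one]

theorem iterPartial_add {f g : BaseV m → FibV n} {x : BaseV m} (hf : SmoothNear f x)
    (hg : SmoothNear g x) (I : Fin m → ℕ) :
    iterPartial I (fun y => f y + g y) =ᶠ[𝓝 x] fun y => iterPartial I f y + iterPartial I g y := by
  induction I using multiIdx_induction with
  | zero => simp only [iterPartial_zero]; rfl
  | add_one I i ih =>
    filter_upwards [iterPartial_add_one (hf.add hg) I i, pd_congr ih i,
      iterPartial_add_one hf I i, iterPartial_add_one hg I i, (hf.iterPartial I).eventually,
      (hg.iterPartial I).eventually] with y h1 h2 h3 h4 h5 h6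
    rw [h1, h2, h3, h4, pd, fderiv_fun_add h5.differentiableAt h6.differentiableAt]
    rfl

theorem iterPartial_const_smul {f : BaseV m → FibV n} {x : BaseV m} (hf : SmoothNear f x)
    (t : ℝ) (I : Fin m → ℕ) :
    iterPartial I (fun y => t • f y) =ᶠ[𝓝 x] fun y => t • iterPartial I f y := by
  induction I using multiIdx_induction with
  | zero => simp only [iterPartial_zero]; rfl
  | add_one I i ih =>
    filter_upwards [iterPartial_add_one (smoothNear_const (c := t) |>.smul hf) I i, pd_congr ih i,
      iterPartial_add_one hf I i, (hf.iterPartial I).eventually] with y h1 h2 h3 h5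
    rw [h1, h2, h3, pd, fderiv_fun_const_smul h5.differentiableAt]
    rfl

/-- Iterated partial derivatives of a family of functions depending smoothly on a parameter. -/
theorem smoothNear_iterPartial_family {Q : Type*} [NormedAddCommGroup Q] [NormedSpace ℝ Q]
    {Φ : Q × BaseV m → FibV n} {q : Q} {x : BaseV m} (h : SmoothNear Φ (q, x)) (I : Fin m → ℕ) :
    SmoothNear (fun z : Q × BaseV m => iterPartial I (fun y => Φ (z.1, y)) z.2) (q, x) := by
  induction I using multiIdx_induction with
  | zero => simpa [iterPartial_zero] using h
  | add_one I i ih =>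
    refine (ih.fderiv_apply (0, EuclideanSpace.single i 1)).congr ?_
    filter_upwards [h.eventually, ih.eventually] with z hz hz'
    have hs : SmoothNear (fun y => Φ (z.1, y)) z.2 := SmoothNear.comp (g := Φ) hz
      (smoothNear_const.prodMk smoothNear_id)
    rw [(iterPartial_add_one hs I i).self_of_nhds, pd]
    exact fderiv_slice (Ψ := fun z : Q × BaseV m => iterPartial I (fun y => Φ (z.1, y)) z.2)
      hz'.differentiableAt _

/-- Second derivatives are symmetric, so the derivative in the parameter passes through each base
derivative. It makes the jet of a variation the derivative of a curve of jets. -/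
theorem fderiv_iterPartial_family {Q : Type*} [NormedAddCommGroup Q] [NormedSpace ℝ Q]
    {Φ : Q × BaseV m → FibV n} {q : Q} {x : BaseV m} (h : SmoothNear Φ (q, x)) (r : Q)
    (I : Fin m → ℕ) :
    (fun z : Q × BaseV m =>
      fderiv ℝ (fun z : Q × BaseV m => iterPartial I (fun y => Φ (z.1, y)) z.2) z (r, 0))
      =ᶠ[𝓝 (q, x)] fun z => iterPartial I (fun y => fderiv ℝ Φ (z.1, y) (r, 0)) z.2 := by
  induction I using multiIdx_induction with
  | zero => simp only [iterPartial_zero]; rfl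
  | add_one I i ih =>
    have step : ∀ Ψ : Q × BaseV m → FibV n, ∀ z, SmoothNear Ψ z →
        iterPartial (I + one i) (fun y => Ψ (z.1, y)) z.2 =
          fderiv ℝ (fun z : Q × BaseV m => iterPartial I (fun y => Ψ (z.1, y)) z.2) z
            (0, EuclideanSpace.single i 1) := fun Ψ z hΨ => by
      have hs : SmoothNear (fun y => Ψ (z.1, y)) z.2 := SmoothNear.comp (g := Ψ) hΨ
        (smoothNear_const.prodMk smoothNear_id)
      rw [(iterPartial_add_one hs I i).self_of_nhds, pd]
      exact fderiv_slice (Ψ := fun z : Q × BaseV m => iterPartial I (fun y => Ψ (z.1, y)) z.2)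
        (smoothNear_iterPartial_family hΨ I).differentiableAt _
    filter_upwards [h.eventually, ih.eventually_nhds] with z hz hz'
    have e1 : (fun z : Q × BaseV m => iterPartial (I + one i) (fun y => Φ (z.1, y)) z.2) =ᶠ[𝓝 z]
        fun z => fderiv ℝ (fun z : Q × BaseV m => iterPartial I (fun y => Φ (z.1, y)) z.2) z
            (0, EuclideanSpace.single i 1) := by
      filter_upwards [hz.eventually] with w hw
      exact step Φ w hw
    rw [e1.fderiv_eq, (smoothNear_iterPartial_family hz I).fderiv_comm]
    rw [Filter.EventuallyEq.fderiv_eq hz', step (fun z => fderiv ℝ Φ z (r, 0)) z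
      (hz.fderiv_apply _)]

end IterPartial


/-! ### Jets of functions between coordinate spaces -/

section CoordJets

variable {m n : ℕ}

/-- The `k`-jet at `x` of a function between the coordinate spaces. -/
def jet (k : ℕ) (P : BaseV m → FibV n) (x : BaseV m) : JetV m n k :=
  (x, fun I => iterPartial I.1 P x)

theorem zero_mem_multiIdx (k : ℕ) : (0 : Fin m → ℕ) ∈ multiIdx m k := by simp [mem_multiIdx]

theorem add_one_mem_multiIdx {k : ℕ} {I : Fin m → ℕ} (h : I ∈ multiIdx m k) (j : Fin m) :
    I + one j ∈ multiIdx m (k + 1) := by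
  rw [mem_multiIdx] at *
  rw [sum_add_one]
  omega

theorem mem_multiIdx_mono {k r : ℕ} (hr : r ≤ k) {I : Fin m → ℕ} (h : I ∈ multiIdx m r) :
    I ∈ multiIdx m k :=
  mem_multiIdx.2 ((mem_multiIdx.1 h).trans hr)

theorem one_mem_multiIdx {k : ℕ} (hk : 1 ≤ k) (i : Fin m) : one i ∈ multiIdx m k := by
  rw [mem_multiIdx]; simpa [one] using hk

theorem one_add_one_mem_multiIdx {k : ℕ} (hk : 2 ≤ k) (i j : Fin m) :
    one i + one j ∈ multiIdx m k :=
  mem_multiIdx_mono hk (add_one_mem_multiIdx (one_mem_multiIdx le_rfl i) j)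

theorem one_add_one_mem_multiIdxEq (i j : Fin m) : one i + one j ∈ multiIdxEq m 2 :=
  Finset.mem_filter.2 ⟨one_add_one_mem_multiIdx le_rfl i j, by simp [Finset.sum_add_distrib, one]⟩

theorem JetV.u_of_mem {k : ℕ} (v : JetV m n k) {I : Fin m → ℕ} (h : I ∈ multiIdx m k) :
    v.u I = v.2 ⟨I, h⟩ := dif_pos h

theorem JetV.ext_u {k : ℕ} {v w : JetV m n k} (h1 : v.1 = w.1)
    (h2 : ∀ I ∈ multiIdx m k, v.u I = w.u I) : v = w :=
  Prod.ext h1 (funext fun I => by simpa [JetV.u_of_mem _ I.2] using h2 I.1 I.2)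

theorem jet_u {k : ℕ} (P : BaseV m → FibV n) (x : BaseV m) {I : Fin m → ℕ}
    (h : I ∈ multiIdx m k) : (jet k P x).u I = iterPartial I P x := JetV.u_of_mem _ h

theorem jet_u_zero (k : ℕ) (P : BaseV m → FibV n) (x : BaseV m) : (jet k P x).u 0 = P x := by
  rw [jet_u P x (zero_mem_multiIdx k), iterPartial_zero]

theorem trunc_u {k r : ℕ} (v : JetV m n k) {I : Fin m → ℕ} (h : I ∈ multiIdx m r) :
    (v.trunc r).u I = v.u I := JetV.u_of_mem _ h

theorem trunc_jet {k r : ℕ} (hr : r ≤ k) (P : BaseV m → FibV n) (x : BaseV m) :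
    (jet k P x).trunc r = jet r P x :=
  JetV.ext_u rfl fun I hI => by
    rw [trunc_u _ hI, jet_u _ _ hI, jet_u _ _ (mem_multiIdx_mono hr hI)]

/-- `v ↦ v.u I` as a continuous linear map. -/
def uL (m n k : ℕ) (I : Fin m → ℕ) : JetV m n k →L[ℝ] FibV n :=
  if h : I ∈ multiIdx m k then
    (ContinuousLinearMap.proj (R := ℝ) (φ := fun _ : multiIdx m k => FibV n) ⟨I, h⟩).comp
      (ContinuousLinearMap.snd ℝ _ _)
  else 0

@[simp]
theorem uL_apply {k : ℕ} (I : Fin m → ℕ) (v : JetV m n k) : uL m n k I v = v.u I := by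
  unfold uL JetV.u
  split_ifs <;> rfl

/-- `JetV.trunc` as a continuous linear map. -/
def truncL (m n k r : ℕ) : JetV m n k →L[ℝ] JetV m n r :=
  (ContinuousLinearMap.fst ℝ _ _).prod (ContinuousLinearMap.pi fun I => uL m n k I.1)

@[simp]
theorem truncL_apply {k r : ℕ} (v : JetV m n k) : truncL m n k r v = v.trunc r :=
  JetV.ext_u rfl fun I hI => by
    rw [trunc_u _ hI, JetV.u_of_mem _ hI]; exact uL_apply _ _

/-- The coordinate function `x^l`. -/
def crd (l : Fin m) : BaseV m →L[ℝ] ℝ := EuclideanSpace.proj l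

@[simp]
theorem crd_apply (l : Fin m) (x : BaseV m) : crd l x = x l := rfl

/-- The total derivative vector `w^l (∂/∂x^l + ∑ u_{I + 1_l} ∂/∂u_I)`. -/
def tot {k : ℕ} (v : JetV m n (k + 1)) : BaseV m →L[ℝ] JetV m n k :=
  (ContinuousLinearMap.id ℝ _).prod (ContinuousLinearMap.pi fun I =>
    ∑ l, (crd l).smulRight (v.u (I.1 + one l)))

theorem tot_apply {k : ℕ} (v : JetV m n (k + 1)) (w : BaseV m) :
    tot v w = (w, fun I => ∑ l, w l • v.u (I.1 + one l)) := by
  refine Prod.ext (by simp [tot]) (funext fun I => ?_)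
  simp [tot]

@[simp]
theorem tot_fst {k : ℕ} (v : JetV m n (k + 1)) (w : BaseV m) : (tot v w).1 = w := by
  rw [tot_apply]

theorem tot_single {k : ℕ} (v : JetV m n (k + 1)) (j : Fin m) :
    tot v (EuclideanSpace.single j 1) =
      (EuclideanSpace.single j 1, fun I => v.u (I.1 + one j)) := by
  rw [tot_apply]
  refine Prod.ext rfl (funext fun I => ?_)
  simp

theorem contDiff_tot (k : ℕ) :
    ContDiff ℝ ∞ (fun z : JetV m n (k + 1) × BaseV m => tot z.1 z.2) := by
  simp only [tot_apply, ← uL_apply]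
  refine ContDiff.prodMk contDiff_snd (contDiff_pi' fun I => ContDiff.sum fun l _ => ?_)
  have h : ContDiff ℝ ∞ fun z : JetV m n (k + 1) × BaseV m => uL m n (k + 1) (I.1 + one l) z.1 :=
    (uL m n (k + 1) _).contDiff.comp contDiff_fst
  have h' : ContDiff ℝ ∞ fun z : JetV m n (k + 1) × BaseV m => z.2 l :=
    (crd l).contDiff.comp contDiff_snd
  exact h'.smul h

theorem baseV_eq_sum (w : BaseV m) : w = ∑ l, w l • EuclideanSpace.single l (1 : ℝ) := by
  ext i
  simp [Pi.single_apply]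

theorem SmoothNear.jet {P : BaseV m → FibV n} {x : BaseV m} (h : SmoothNear P x) (k : ℕ) :
    SmoothNear (jet k P) x := by
  refine smoothNear_id.prodMk ?_
  have := (Filter.eventually_all (ι := multiIdx m k)).2 fun I => h.iterPartial I.1
  filter_upwards [this] with y hy
  exact contDiffAt_pi.2 hy

/-- Differentiating `u_I = ∂_I P` in direction `l` gives `u_{I + 1_l}`: the vectors tangent to a
prolonged section are the total derivatives determined by the jet of one order more. -/
theorem hasFDerivAt_jet {P : BaseV m → FibV n} {x : BaseV m} (h : SmoothNear P x) (k : ℕ) :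
    HasFDerivAt (jet k P) (tot (jet (k + 1) P x)) x := by
  refine HasFDerivAt.prodMk (f₂ := fun y => fun I : multiIdx m k => iterPartial I.1 P y)
    (hasFDerivAt_id x) (hasFDerivAt_pi.2 fun I => ?_)
  refine (h.iterPartial I.1).differentiableAt.hasFDerivAt.congr_fderiv ?_
  ext1 w
  conv_lhs => rw [baseV_eq_sum w]
  simp only [map_sum, map_smul, sum_apply,
    ContinuousLinearMap.smulRight_apply, crd_apply]
  refine Finset.sum_congr rfl fun l _ => ?_
  rw [jet_u _ _ (add_one_mem_multiIdx I.2 l), (iterPartial_add_one h I.1 l).self_of_nhds]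
  rfl

theorem fderiv_jet {P : BaseV m → FibV n} {x : BaseV m} (h : SmoothNear P x) (k : ℕ) :
    fderiv ℝ (jet k P) x = tot (jet (k + 1) P x) := (hasFDerivAt_jet h k).fderiv

theorem jet_congr {P Q : BaseV m → FibV n} {x : BaseV m} (h : P =ᶠ[𝓝 x] Q) (k : ℕ) :
    jet k P x = jet k Q x :=
  Prod.ext rfl (funext fun I => (iterPartial_congr h I.1).self_of_nhds)

theorem jet_eventuallyEq {P Q : BaseV m → FibV n} {x : BaseV m} (h : P =ᶠ[𝓝 x] Q) (k : ℕ) :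
    jet k P =ᶠ[𝓝 x] jet k Q := by
  filter_upwards [h.eventually_nhds] with y hy
  exact jet_congr hy k

/-! ### Polynomials with a prescribed jet -/

/-- The normalized monomial `(y - x)^J / J!`. -/
def mono (x : BaseV m) (J : Fin m → ℕ) (y : BaseV m) : ℝ :=
  ∏ i, (y i - x i) ^ J i / (J i).factorial

theorem contDiff_mono (x : BaseV m) (J : Fin m → ℕ) : ContDiff ℝ ∞ (mono x J) := by
  unfold mono
  fun_prop

theorem mono_self (x : BaseV m) (J : Fin m → ℕ) : mono x J x = if J = 0 then 1 else 0 := by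
  unfold mono
  split_ifs with h
  · simp [h]
  · obtain ⟨i, hi⟩ := Function.ne_iff.1 h
    exact Finset.prod_eq_zero (Finset.mem_univ i) (by simp [zero_pow hi])

theorem fderiv_mono (x : BaseV m) (J : Fin m → ℕ) (i : Fin m) (y : BaseV m) :
    fderiv ℝ (mono x J) y (EuclideanSpace.single i 1) =
      if J i = 0 then 0 else mono x (J - one i) y := by
  have hfac : ∀ l, HasFDerivAt (fun y : BaseV m => (y l - x l) ^ J l / (J l).factorial)
      ((J l * (y l - x l) ^ (J l - 1) / (J l).factorial : ℝ) •
        (crd l)) y := fun l => by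
    have h1 : HasFDerivAt (fun y : BaseV m => y l - x l)
      (crd l) y :=
      (crd l).hasFDerivAt.sub_const _
    have h2 : HasDerivAt (fun t : ℝ => t ^ J l / (J l).factorial)
      (J l * (y l - x l) ^ (J l - 1) / (J l).factorial) (y l - x l) :=
      (hasDerivAt_pow _ _).div_const _
    exact h2.comp_hasFDerivAt y h1
  have h := (HasFDerivAt.finsetProd (u := Finset.univ) fun l _ => hfac l).fderiv
  have e : mono x J = fun y => ∏ l, (y l - x l) ^ J l / (J l).factorial := rfl
  rw [e, h, sum_apply, Finset.sum_eq_single i]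
  · simp only [smul_apply, crd_apply, PiLp.single_apply,
      if_true, smul_eq_mul, mul_one]
    split_ifs with h0
    · simp [h0]
    · unfold mono
      rw [← Finset.prod_erase_mul _ _ (Finset.mem_univ i)]
      congr 1
      · refine Finset.prod_congr rfl fun l hl => ?_
        have : l ≠ i := Finset.ne_of_mem_erase hl
        simp [one, this]
      · obtain ⟨k, hk⟩ := Nat.exists_eq_succ_of_ne_zero h0
        simp only [hk, Pi.sub_apply, one, Pi.single_eq_same, Nat.succ_sub_one, Nat.factorial_succ]
        push_cast
        field_simp
  · intro l _ hl
    simp [hl]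
  · simp

theorem pd_mono_smul (x : BaseV m) (J : Fin m → ℕ) (u : FibV n) (i : Fin m) :
    pd i (fun y => mono x J y • u) =
      if J i = 0 then 0 else fun y => mono x (J - one i) y • u := by
  funext y
  have h := ((contDiff_mono x J).differentiable (by simp) y).hasFDerivAt.smul_const u
  rw [pd, h.fderiv, ContinuousLinearMap.smulRight_apply, fderiv_mono]
  split_ifs <;> simp

theorem iterPartial_mono_smul (x : BaseV m) (J I : Fin m → ℕ) (u : FibV n) :
    iterPartial I (fun y => mono x J y • u) =
      if ∀ i, I i ≤ J i then fun y => mono x (J - I) y • u else 0 := by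
  have hs : ∀ (J : Fin m → ℕ) y, SmoothNear (fun y => mono x J y • u) y := fun J y =>
    ((contDiff_mono x J).smul contDiff_const).smoothNear y
  induction I using multiIdx_induction with
  | zero =>
    rw [iterPartial_zero, if_pos (by simp)]
    simp
  | add_one I i ih =>
    funext y
    rw [(iterPartial_add_one (hs J y) I i).self_of_nhds, ih]
    by_cases hIJ : ∀ i, I i ≤ J i
    · rw [if_pos hIJ, pd_mono_smul]
      by_cases h0 : (J - I) i = 0
      · rw [if_pos h0, if_neg]
        intro hc
        have := hc i
        simp [one] at this h0
        omega
      · have hle : ∀ l, (I + one i) l ≤ J l := fun l => by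
          have := hIJ l
          by_cases hl : l = i
          · subst hl
            simp [one] at h0 ⊢
            omega
          · simpa [one, hl] using this
        rw [if_neg h0, if_pos hle, tsub_add_eq_tsub_tsub]
    · have : ¬ ∀ l, (I + one i) l ≤ J l := fun hc => hIJ fun l => le_trans (by simp) (hc l)
      rw [if_neg hIJ, if_neg this]
      simp [pd]

theorem iterPartial_sum {ι : Type*} (s : Finset ι) {f : ι → BaseV m → FibV n} {x : BaseV m}
    (hf : ∀ i, ContDiff ℝ ∞ (f i)) (I : Fin m → ℕ) :
    iterPartial I (fun y => ∑ i ∈ s, f i y) x = ∑ i ∈ s, iterPartial I (f i) x := by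
  classical
  induction s using Finset.induction_on with
  | empty =>
    simp only [Finset.sum_empty]
    have := (iterPartial_const_smul (f := fun _ : BaseV m => (0 : FibV n)) (x := x)
      smoothNear_const 0 I).self_of_nhds
    simpa using this
  | insert a s ha ih =>
    simp only [Finset.sum_insert ha]
    rw [← ih]
    exact (iterPartial_add ((hf a).smoothNear x)
      ((ContDiff.sum fun i _ => hf i).smoothNear x) I).self_of_nhds

/-- The Taylor polynomial with the prescribed coefficients. Pointwise statements about jets can thus
be proved along a genuine smooth section. -/
theorem exists_jet_eq {k : ℕ} (v : JetV m n k) :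
    ∃ P : BaseV m → FibV n, ContDiff ℝ ∞ P ∧ jet k P v.1 = v := by
  refine ⟨fun y => ∑ J : multiIdx m k, mono v.1 J.1 y • v.2 J,
    ContDiff.sum fun J _ => (contDiff_mono v.1 J.1).smul contDiff_const, ?_⟩
  refine Prod.ext rfl (funext fun I => ?_)
  change iterPartial I.1 _ v.1 = v.2 I
  rw [iterPartial_sum (f := fun (J : multiIdx m k) y => mono v.1 J.1 y • v.2 J) _
    fun J => (contDiff_mono v.1 J.1).smul contDiff_const]
  simp only [iterPartial_mono_smul]
  rw [Finset.sum_eq_single I]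
  · simp [mono_self]
  · intro J _ hJ
    split_ifs with h
    · have : J.1 - I.1 ≠ 0 := fun h0 => hJ (Subtype.ext (le_antisymm (tsub_eq_zero_iff_le.1 h0) h))
      simp [mono_self, this]
    · rfl
  · simp

/-! ### Transition functions -/

/-- The function with graph the image of the graph of `P` under `(x, u) ↦ (f x, g (x, u))`. -/
def changeSec (f : OpenPartialHomeomorph (BaseV m) (BaseV m)) (g : BaseV m × FibV n → FibV n)
    (P : BaseV m → FibV n) : BaseV m → FibV n :=
  fun y => g (f.symm y, P (f.symm y))

/-- The chain rule expresses a derivative of the transformed section through the jet of `P` of the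
same order. The function `G` does not depend on `P`, so the change of coordinates acts on jets, and
smoothly. -/
theorem exists_transition {f : OpenPartialHomeomorph (BaseV m) (BaseV m)}
    (hf : ContDiffOn ℝ ∞ f f.source) (hf' : ContDiffOn ℝ ∞ f.symm f.target)
    {g : BaseV m × FibV n → FibV n} {O : Set (BaseV m × FibV n)} (hO : IsOpen O)
    (hOf : ∀ z ∈ O, z.1 ∈ f.source) (hg : ContDiffOn ℝ ∞ g O) (I : Fin m → ℕ) :
    ∀ k, I ∈ multiIdx m k → ∃ G : JetV m n k → FibV n,
      ContDiffOn ℝ ∞ G {v | (v.1, v.u 0) ∈ O} ∧ ∀ P x, SmoothNear P x → (x, P x) ∈ O →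
        iterPartial I (changeSec f g P) (f x) = G (jet k P x) := by
  have hopen : ∀ k, IsOpen {v : JetV m n k | (v.1, v.u 0) ∈ O} := fun k => by
    simp only [← uL_apply]
    exact hO.preimage (by fun_prop)
  induction I using multiIdx_induction with
  | zero =>
    intro k _
    refine ⟨fun v => g (v.1, v.u 0), ?_, fun P x _ hx => ?_⟩
    · simp only [← uL_apply]
      exact hg.comp (by fun_prop) fun v hv => by simpa using hv
    · simp only [iterPartial_zero, jet_u_zero, changeSec, f.left_inv (hOf _ hx)]
      rfl
  | add_one I j ih =>
    intro k hk
    rw [mem_multiIdx, sum_add_one] at hk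
    obtain ⟨k, rfl⟩ : ∃ l, k = l + 1 := ⟨k - 1, by omega⟩
    obtain ⟨G, hG, hGP⟩ := ih k (mem_multiIdx.2 (by omega))
    -- The derivative of `G ∘ jet k P ∘ f⁻¹` at `f x` in the direction of the `j`-th coordinate
    -- vector. The derivative of the `k`-jet of `P` is the total derivative `tot`, whence the order
    -- `k + 1`.
    refine ⟨fun v => fderiv ℝ G (v.trunc k)
      (tot v (fderiv ℝ f.symm (f v.1) (EuclideanSpace.single j 1))), ?_, fun P x hP hx => ?_⟩
    · have h1 : ContDiffOn ℝ ∞ (fderiv ℝ G) {v | (v.1, v.u 0) ∈ O} :=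
        hG.fderiv_of_isOpen (hopen k) (by simp)
      have h2 : ContDiffOn ℝ ∞ (fun v : JetV m n (k + 1) => fderiv ℝ G (v.trunc k))
          {v | (v.1, v.u 0) ∈ O} := by
        simp only [← truncL_apply]
        refine h1.comp (truncL m n (k + 1) k).contDiff.contDiffOn fun v hv => ?_
        change ((truncL m n (k + 1) k v).1, (truncL m n (k + 1) k v).u 0) ∈ O
        rw [truncL_apply, trunc_u v (zero_mem_multiIdx k)]
        exact hv
      have h3 : ContDiffOn ℝ ∞ (fderiv ℝ f.symm) f.target :=
        hf'.fderiv_of_isOpen f.open_target (by simp)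
      have h4 : ContDiffOn ℝ ∞ (fun v : JetV m n (k + 1) =>
          fderiv ℝ f.symm (f v.1) (EuclideanSpace.single j 1)) {v | (v.1, v.u 0) ∈ O} := by
        refine ContDiffOn.clm_apply (h3.comp (hf.comp contDiffOn_fst fun v hv => hOf _ hv)
          fun v hv => f.map_source (hOf _ hv)) contDiffOn_const
      have h5 : ContDiffOn ℝ ∞ (fun v : JetV m n (k + 1) =>
          tot v (fderiv ℝ f.symm (f v.1) (EuclideanSpace.single j 1))) {v | (v.1, v.u 0) ∈ O} :=
        ContDiff.comp_contDiffOn (g := fun z : JetV m n (k + 1) × BaseV m => tot z.1 z.2)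
          (f := fun v => (v, fderiv ℝ f.symm (f v.1) (EuclideanSpace.single j 1)))
          (contDiff_tot k) (ContDiffOn.prodMk contDiffOn_id h4)
      exact h2.clm_apply h5
    · have hxs : x ∈ f.source := hOf _ hx
      have hfx : f x ∈ f.target := f.map_source hxs
      have hs : SmoothNear f.symm (f x) := smoothNear_of_contDiffOn hf' f.open_target hfx
      have hs' : SmoothNear P (f.symm (f x)) := by rwa [f.left_inv hxs]
      have hx' : (f.symm (f x), P (f.symm (f x))) ∈ O := by rwa [f.left_inv hxs]
      have hcP : ContinuousAt (fun y => (f.symm y, P (f.symm y))) (f x) :=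
        hs.continuousAt.prodMk (hs'.comp hs).continuousAt
      have hch : SmoothNear (changeSec f g P) (f x) :=
        SmoothNear.comp (g := g) (smoothNear_of_contDiffOn hg hO hx') (hs.prodMk (hs'.comp hs))
      have hev : iterPartial I (changeSec f g P) =ᶠ[𝓝 (f x)]
          fun y => G (jet k P (f.symm y)) := by
        filter_upwards [hs.continuousAt.eventually hs'.eventually,
          hcP.eventually (hO.mem_nhds hx'), f.open_target.mem_nhds hfx] with y hy hy' hy''
        have := hGP P (f.symm y) hy hy'
        rwa [f.right_inv hy''] at this
      rw [(iterPartial_add_one hch I j).self_of_nhds, (pd_congr hev j).self_of_nhds, pd]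
      have hGx : DifferentiableAt ℝ G (jet k P (f.symm (f x))) :=
        (hG.contDiffAt ((hopen k).mem_nhds (by
          change (_, (jet k P _).u 0) ∈ O
          rwa [jet_u_zero]))).differentiableAt (by simp)
      have hd := (HasFDerivAt.comp (f x) hGx.hasFDerivAt
        ((hasFDerivAt_jet hs' k).comp (f x) hs.differentiableAt.hasFDerivAt)).fderiv
      change fderiv ℝ (G ∘ jet k P ∘ f.symm) (f x) _ = _
      rw [hd]
      simp only [f.left_inv hxs, ContinuousLinearMap.comp_apply, trunc_jet (Nat.le_succ k)]
      rfl

theorem exists_jet_transition {f : OpenPartialHomeomorph (BaseV m) (BaseV m)}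
    (hf : ContDiffOn ℝ ∞ f f.source) (hf' : ContDiffOn ℝ ∞ f.symm f.target)
    {g : BaseV m × FibV n → FibV n} {O : Set (BaseV m × FibV n)} (hO : IsOpen O)
    (hOf : ∀ z ∈ O, z.1 ∈ f.source) (hg : ContDiffOn ℝ ∞ g O) (k : ℕ) :
    ∃ F : JetV m n k → JetV m n k, (∀ v, (F v).1 = f v.1) ∧
      ContDiffOn ℝ ∞ F {v | (v.1, v.u 0) ∈ O} ∧ ∀ P x, SmoothNear P x → (x, P x) ∈ O →
        jet k (changeSec f g P) (f x) = F (jet k P x) := by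
  choose G hG hGP using fun I : multiIdx m k =>
    exists_transition hf hf' hO hOf hg I.1 k I.2
  refine ⟨fun v => (f v.1, fun I => G I v), fun _ => rfl, ?_, fun P x hP hx => ?_⟩
  · exact ContDiffOn.prodMk (hf.comp contDiffOn_fst fun v hv => hOf _ hv)
      (contDiffOn_pi (Φ := fun v I => G I v) |>.2 hG)
  · exact Prod.ext rfl (funext fun I => hGP I P x hP hx)

end CoordJets


/-! ### Symmetric multimomenta in coordinates -/

section Momenta

open Function

variable {m n : ℕ}

/-- The `i`-th argument of an alternating map, as a linear map. -/
def insertL {V : Type*} [NormedAddCommGroup V] [NormedSpace ℝ V] (α : V [⋀^Fin m]→L[ℝ] ℝ)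
    (w : Fin m → V) (i : Fin m) : V →L[ℝ] ℝ :=
  α.toContinuousMultilinearMap.toContinuousLinearMap w i

theorem insertL_apply {V : Type*} [NormedAddCommGroup V] [NormedSpace ℝ V]
    (α : V [⋀^Fin m]→L[ℝ] ℝ) (w : Fin m → V) (i : Fin m) (x : V) :
    insertL α w i x = α (update w i x) := rfl

/-- The coordinate vectors of the base. -/
def ev (i : Fin m) : BaseV m := EuclideanSpace.single i 1

theorem ev_apply (i j : Fin m) : ev i j = if j = i then 1 else 0 := by
  simp [ev]

theorem eq_sum_ev (w : BaseV m) : w = ∑ l, w l • ev l := baseV_eq_sum w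

/-- The standard volume form `d^m x`. -/
def vol (m : ℕ) : BaseV m [⋀^Fin m]→L[ℝ] ℝ :=
  { (EuclideanSpace.basisFun (Fin m) ℝ).toBasis.det with
    cont := by
      change Continuous fun v => (EuclideanSpace.basisFun (Fin m) ℝ).toBasis.det v
      simp only [Module.Basis.det_apply]
      refine Continuous.matrix_det (continuous_matrix fun i j => ?_)
      simp only [Module.Basis.toMatrix_apply, OrthonormalBasis.coe_toBasis_repr_apply,
        EuclideanSpace.basisFun_repr]
      exact (crd i).continuous.comp (continuous_apply j) }

theorem vol_apply (v : Fin m → BaseV m) :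
    vol m v = (EuclideanSpace.basisFun (Fin m) ℝ).toBasis.det v := rfl

theorem basis_eq_ev : ⇑(EuclideanSpace.basisFun (Fin m) ℝ).toBasis = ev := by
  funext i
  simp [ev]

theorem vol_ev : vol m ev = 1 := by
  rw [vol_apply, ← basis_eq_ev, Module.Basis.det_self]

theorem top_form_apply (β : BaseV m [⋀^Fin m]→L[ℝ] ℝ) (v : Fin m → BaseV m) :
    β v = β ev * vol m v := by
  have h := congrArg (fun f => f v)
    (AlternatingMap.eq_smul_basis_det (EuclideanSpace.basisFun (Fin m) ℝ).toBasis β.toAlternatingMap)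
  rw [basis_eq_ev] at h
  exact h

theorem vol_update_comp (K : BaseV m →L[ℝ] BaseV m) (i j : Fin m) :
    vol m (update (fun l => K (ev l)) i (K (ev j))) =
      if i = j then vol m (fun l => K (ev l)) else 0 := by
  split_ifs with h
  · subst h
    rw [update_eq_self_iff.2 rfl]
  · exact (vol m).map_eq_zero_of_eq _ (by simp [Ne.symm h]) h

theorem vol_update_ev (i : Fin m) (z : BaseV m) : vol m (update ev i z) = z i := by
  rw [← insertL_apply]
  conv_lhs => rw [eq_sum_ev z]
  have h := fun j => vol_update_comp (ContinuousLinearMap.id ℝ (BaseV m)) i j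
  simp only [ContinuousLinearMap.id_apply] at h
  simp only [map_sum, map_smul, insertL_apply]
  simp only [show (fun l : Fin m => (ev l : BaseV m)) = ev from rfl] at h
  simp [h, vol_ev]

/-- An `m`-form on the first jet space that is annihilated by two vertical vectors and has symmetric
momenta. -/
structure IsSymMom (α : JetV m n 1 [⋀^Fin m]→L[ℝ] ℝ) : Prop where
  two_vert : ∀ v : Fin m → JetV m n 1, (∃ i j, i ≠ j ∧ (v i).1 = 0 ∧ (v j).1 = 0) → α v = 0
  symm : ∀ i j a, α (update dX j (dU (one i) a)) = α (update dX i (dU (one j) a))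

/-- The value of a semibasic form only depends on the base components of the vectors if one of them
is vertical. -/
theorem apply_update_eq {α : JetV m n 1 [⋀^Fin m]→L[ℝ] ℝ}
    (h : ∀ v : Fin m → JetV m n 1, (∃ i j, i ≠ j ∧ (v i).1 = 0 ∧ (v j).1 = 0) → α v = 0)
    {v w : Fin m → JetV m n 1} (hvw : ∀ l, (v l).1 = (w l).1) {i : Fin m} (hi : v i = w i)
    (hi0 : (v i).1 = 0) : α v = α w := by
  -- The vectors are exchanged one at a time. Each exchange alters the value by that on a family
  -- with two vertical members: the difference of the exchanged vectors and the `i`-th vector.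
  suffices H : ∀ s : Finset (Fin m), α v = α (s.piecewise w v) by
    rw [H Finset.univ]; simp
  intro s
  induction s using Finset.induction_on with
  | empty => simp
  | insert a s ha ih =>
    rw [ih, Finset.piecewise_insert]
    by_cases hai : a = i
    · subst hai
      rw [← hi]
      congr 1
      rw [eq_comm, update_eq_self_iff, Finset.piecewise_eq_of_notMem _ _ _ ha]
    · have e : s.piecewise w v = update (s.piecewise w v) a (v a) := by
        rw [eq_comm, update_eq_self_iff, Finset.piecewise_eq_of_notMem _ _ _ ha]
      rw [e, update_idem, ← sub_eq_zero, ← insertL_apply, ← insertL_apply, ← map_sub, insertL_apply]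
      refine h _ ⟨a, i, hai, by simp [hvw a], ?_⟩
      rw [update_of_ne (Ne.symm hai)]
      by_cases his : i ∈ s
      · rw [Finset.piecewise_eq_of_mem _ _ _ his, ← hi, hi0]
      · rw [Finset.piecewise_eq_of_notMem _ _ _ his, hi0]

theorem dU_sum {k : ℕ} (V : JetV m n k) (hV : V.1 = 0) :
    V = ∑ I : multiIdx m k, ∑ a, V.2 I a • dU I.1 a := by
  refine Prod.ext ?_ (funext fun J => ?_)
  · simp [hV, Prod.fst_sum, dU]
  · ext b
    simp only [Prod.snd_sum, Finset.sum_apply, Prod.smul_snd, dU, Pi.smul_apply]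
    rw [Finset.sum_eq_single J]
    · simp [Pi.single_apply]
    · intro I _ hI
      have : J.1 ≠ I.1 := fun h => hI (Subtype.ext h.symm)
      simp [this]
    · simp

theorem mem_multiIdx_one {I : Fin m → ℕ} (hI : I ∈ multiIdx m 1) : I = 0 ∨ ∃ i, I = one i := by
  rw [mem_multiIdx] at hI
  by_cases h : I = 0
  · exact Or.inl h
  · obtain ⟨i, hi⟩ := Function.ne_iff.1 h
    refine Or.inr ⟨i, funext fun l => ?_⟩
    have hs := Finset.add_sum_erase Finset.univ I (Finset.mem_univ i)
    have hi' : I i ≠ 0 := hi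
    by_cases hl : l = i
    · subst hl
      simp [one]; omega
    · have := Finset.single_le_sum (f := I) (fun _ _ => Nat.zero_le _)
        (Finset.mem_erase.2 ⟨hl, Finset.mem_univ l⟩)
      simp [one, hl]; omega

/-- A form without momenta vanishes on families with a vertical vector. -/
theorem apply_eq_zero_of_vertical {α : JetV m n 1 [⋀^Fin m]→L[ℝ] ℝ}
    (h : ∀ v : Fin m → JetV m n 1, (∃ i j, i ≠ j ∧ (v i).1 = 0 ∧ (v j).1 = 0) → α v = 0)
    (h0 : ∀ i a, α (update dX i (dU 0 a)) = 0)
    (h1 : ∀ i j a, α (update dX j (dU (one i) a)) = 0)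
    {v : Fin m → JetV m n 1} {s : Fin m} (hs : (v s).1 = 0) : α v = 0 := by
  have hV : ∀ (V : JetV m n 1), V.1 = 0 → ∀ k, α (update dX k V) = 0 := fun V hV k => by
    rw [← insertL_apply, dU_sum V hV]
    simp only [map_sum, map_smul, insertL_apply]
    refine Finset.sum_eq_zero fun I _ => Finset.sum_eq_zero fun a _ => ?_
    obtain hI | ⟨i, hI⟩ := mem_multiIdx_one I.2
    · rw [hI, h0, smul_zero]
    · rw [hI, h1, smul_zero]
  obtain ⟨k, rfl⟩ : ∃ k, m = k + 1 := ⟨m - 1, by have := s.pos; omega⟩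
  -- With the vertical vector in front, the contraction only sees the base components of the other
  -- vectors. It is a `k`-form `β` on a base of dimension `k + 1`, to be tested on basis vectors.
  have hcons : ∀ (V : JetV (k + 1) n 1) (w : Fin k → JetV (k + 1) n 1), V.1 = 0 →
      α (Fin.cons V w) = 0 := fun V w hV0 => by
    let β : BaseV (k + 1) [⋀^Fin k]→L[ℝ] ℝ := (α.curryLeft V).compContinuousLinearMap
      (ContinuousLinearMap.inl ℝ _ _)
    have e1 : α (Fin.cons V w) = β fun i => (w i).1 := by
      refine apply_update_eq h (i := 0) (fun l => ?_) rfl hV0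
      refine Fin.cases ?_ (fun l => ?_) l <;> rfl
    have e2 : β.toAlternatingMap = 0 := by
      refine Module.Basis.ext_alternating (EuclideanSpace.basisFun (Fin (k + 1)) ℝ).toBasis
        fun σ hσ => ?_
      -- An injective choice of `k` among `k + 1` basis vectors omits one of them. Up to a
      -- permutation, the family is that of the coordinate vectors with `V` in the omitted place
      -- `b`.
      obtain ⟨b, hb⟩ : ∃ b, b ∉ Set.range σ := by
        by_contra! hc
        have := Fintype.card_le_of_surjective σ hc
        simp at this
      have hinj : Injective (Fin.cons b σ : Fin (k + 1) → Fin (k + 1)) :=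
        Fin.cons_injective_iff.2 ⟨hb, hσ⟩
      let τ : Equiv.Perm (Fin (k + 1)) :=
        Equiv.ofBijective _ (Finite.injective_iff_bijective.1 hinj)
      change α (Fin.cons V fun i => ((EuclideanSpace.basisFun (Fin (k + 1)) ℝ).toBasis (σ i), 0)) = 0
      have e3 : (Fin.cons V fun i =>
          ((EuclideanSpace.basisFun (Fin (k + 1)) ℝ).toBasis (σ i), 0)) = update dX b V ∘ τ := by
        funext l
        refine Fin.cases ?_ (fun l => ?_) l
        · simp [τ]
        · have : σ l ≠ b := fun hc => hb ⟨l, hc⟩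
          simp [τ, this, dX]
      rw [e3]
      have := α.toAlternatingMap.map_perm (update dX b V) τ
      simp only [ContinuousAlternatingMap.coe_toAlternatingMap] at this
      rw [this, hV V hV0 b, smul_zero]
    rw [e1]
    exact congrArg (fun f : BaseV (k + 1) [⋀^Fin k]→ₗ[ℝ] ℝ => f fun i => (w i).1) e2
  by_cases h0s : (0 : Fin (k + 1)) = s
  · subst h0s
    rw [← Fin.cons_self_tail v]
    exact hcons _ _ hs
  · have := α.toAlternatingMap.map_swap v h0s
    simp only [ContinuousAlternatingMap.coe_toAlternatingMap] at this
    rw [← neg_eq_zero, ← this, ← Fin.cons_self_tail (v ∘ Equiv.swap 0 s)]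
    exact hcons _ _ (by simpa using hs)

theorem eq_of_coords {α β : JetV m n 1 [⋀^Fin m]→L[ℝ] ℝ}
    (hα : ∀ v : Fin m → JetV m n 1, (∃ i j, i ≠ j ∧ (v i).1 = 0 ∧ (v j).1 = 0) → α v = 0)
    (hβ : ∀ v : Fin m → JetV m n 1, (∃ i j, i ≠ j ∧ (v i).1 = 0 ∧ (v j).1 = 0) → β v = 0)
    (h0 : ∀ i a, α (update dX i (dU 0 a)) = β (update dX i (dU 0 a)))
    (h1 : ∀ i j a, α (update dX j (dU (one i) a)) = β (update dX j (dU (one i) a)))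
    {v : Fin m → JetV m n 1} {s : Fin m} (hs : (v s).1 = 0) : α v = β v := by
  rw [← sub_eq_zero, ← ContinuousAlternatingMap.sub_apply]
  refine apply_eq_zero_of_vertical (fun v hv => ?_) (fun i a => ?_) (fun i j a => ?_) hs
  · rw [ContinuousAlternatingMap.sub_apply, hα v hv, hβ v hv, sub_zero]
  · rw [ContinuousAlternatingMap.sub_apply, h0, sub_self]
  · rw [ContinuousAlternatingMap.sub_apply, h1, sub_self]

theorem form_ext {α β : JetV m n 1 [⋀^Fin m]→L[ℝ] ℝ}
    (hα : ∀ v : Fin m → JetV m n 1, (∃ i j, i ≠ j ∧ (v i).1 = 0 ∧ (v j).1 = 0) → α v = 0)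
    (hβ : ∀ v : Fin m → JetV m n 1, (∃ i j, i ≠ j ∧ (v i).1 = 0 ∧ (v j).1 = 0) → β v = 0)
    (hp : α dX = β dX)
    (h0 : ∀ i a, α (update dX i (dU 0 a)) = β (update dX i (dU 0 a)))
    (h1 : ∀ i j a, α (update dX j (dU (one i) a)) = β (update dX j (dU (one i) a))) : α = β := by
  have hv := fun (v : Fin m → JetV m n 1) (s : Fin m) => eq_of_coords hα hβ h0 h1 (v := v) (s := s)
  have key : ∀ γ : JetV m n 1 [⋀^Fin m]→L[ℝ] ℝ,
      (∀ v : Fin m → JetV m n 1, ∀ s, (v s).1 = 0 → γ v = 0) → γ dX = 0 → γ = 0 := by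
    intro γ hγ hγ0
    ext w
    -- Replacing a vector by its horizontal part changes it by a vertical vector, which `γ`
    -- annihilates. What remains is a form of top degree on the base, determined by its value on the
    -- coordinate vectors.
    suffices H : ∀ s : Finset (Fin m), γ w = γ (s.piecewise (fun l => ((w l).1, 0)) w) by
      rw [H Finset.univ, Finset.piecewise_univ]
      change (γ.compContinuousLinearMap (ContinuousLinearMap.inl ℝ (BaseV m)
        (multiIdx m 1 → FibV n))) (fun l => (w l).1) = 0
      rw [top_form_apply]
      change γ dX * _ = 0
      rw [hγ0, zero_mul]
    intro s
    induction s using Finset.induction_on with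
    | empty => simp
    | insert a s ha ih =>
      rw [ih, Finset.piecewise_insert]
      have e : s.piecewise (fun l => ((w l).1, 0)) w =
          update (s.piecewise (fun l => ((w l).1, 0)) w) a (w a) := by
        rw [eq_comm, update_eq_self_iff, Finset.piecewise_eq_of_notMem _ _ _ ha]
      rw [e, update_idem, ← sub_eq_zero, ← insertL_apply, ← insertL_apply, ← map_sub, insertL_apply]
      exact hγ _ a (by simp)
  rw [← sub_eq_zero]
  refine key _ (fun v s hs => ?_) ?_
  · rw [ContinuousAlternatingMap.sub_apply, hv v s hs, sub_self]
  · rw [ContinuousAlternatingMap.sub_apply, hp, sub_self]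

/-! ### The form with given momenta -/

/-- The component `p_α^{ij}` in terms of the coordinates `p_α^I`. -/
def pijOf (ν : MomV m n) (i j : Fin m) (a : Fin n) : ℝ :=
  ν.2 ⟨one i + one j, one_add_one_mem_multiIdxEq i j⟩ a / nn i j

theorem nn_pos (i j : Fin m) : 0 < nn i j := by unfold nn; split_ifs <;> norm_num

theorem nn_comm (i j : Fin m) : nn i j = nn j i := by simp [nn, eq_comm]

theorem pijOf_comm (ν : MomV m n) (i j : Fin m) (a : Fin n) : pijOf ν i j a = pijOf ν j i a := by
  simp only [pijOf, nn_comm i j, add_comm (one i) (one j)]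

/-- The vector field density `(p_α^i V^α + p_α^{ji} V_j^α) ∂/∂x^i`. -/
def flux (ν : MomV m n) : JetV m n 1 →L[ℝ] BaseV m :=
  ∑ i, (∑ a, (ν.1 i a • ((EuclideanSpace.proj a : FibV n →L[ℝ] ℝ).comp (uL m n 1 0)) +
    ∑ j, pijOf ν j i a • ((EuclideanSpace.proj a : FibV n →L[ℝ] ℝ).comp (uL m n 1 (one j))))).smulRight
      (ev i)

theorem flux_apply (ν : MomV m n) (V : JetV m n 1) (i : Fin m) :
    flux ν V i = ∑ a, (ν.1 i a * V.u 0 a + ∑ j, pijOf ν j i a * V.u (one j) a) := by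
  change crd i (flux ν V) = _
  simp only [flux, sum_apply, ContinuousLinearMap.smulRight_apply, map_sum, map_smul, crd_apply,
    ev_apply, add_apply, smul_apply, ContinuousLinearMap.comp_apply, uL_apply, smul_eq_mul]
  simp

theorem flux_add (ν μ : MomV m n) : flux (ν + μ) = flux ν + flux μ := by
  refine ContinuousLinearMap.ext fun V => PiLp.ext fun i => ?_
  simp only [add_apply, PiLp.add_apply, flux_apply, ← Finset.sum_add_distrib, pijOf, Prod.fst_add,
    Prod.snd_add, Pi.add_apply, add_div, add_mul]
  refine Finset.sum_congr rfl fun a _ => ?_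
  rw [Finset.sum_add_distrib]
  abel

theorem flux_smul (t : ℝ) (ν : MomV m n) : flux (t • ν) = t • flux ν := by
  refine ContinuousLinearMap.ext fun V => PiLp.ext fun i => ?_
  simp only [smul_apply, PiLp.smul_apply, flux_apply, pijOf, Prod.smul_fst,
    Prod.smul_snd, Pi.smul_apply, smul_eq_mul, Finset.mul_sum, mul_add, mul_div_assoc, mul_assoc]

/-- The form `p d^m x + p_α^i du^α ∧ d^{m-1}x_i + p_α^{ij} du_i^α ∧ d^{m-1}x_j`. -/
def momForm (m n : ℕ) : ℝ × MomV m n →L[ℝ] JetV m n 1 [⋀^Fin m]→L[ℝ] ℝ :=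
  LinearMap.toContinuousLinearMap
    { toFun := fun q => q.1 • (vol m).compContinuousLinearMap (ContinuousLinearMap.fst ℝ _ _) +
        (vol m).fderivCompContinuousLinearMap (ContinuousLinearMap.fst ℝ _ _) (flux q.2)
      map_add' := fun q r => by
        rw [Prod.fst_add, Prod.snd_add, flux_add, map_add, add_smul]
        abel
      map_smul' := fun t q => by
        rw [Prod.smul_fst, Prod.smul_snd, flux_smul, map_smul, smul_add, smul_assoc]
        rfl }

/-- The second summand of `momForm` is the derivative of `A ↦ A^* d^m x` at the projection to the
base, in the direction of the flux. Hence the flux is inserted into each place in turn, and the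
result is alternating by construction. -/
theorem momForm_apply (q : ℝ × MomV m n) (w : Fin m → JetV m n 1) :
    momForm m n q w = q.1 * vol m (fun i => (w i).1) +
      ∑ s, vol m (update (fun i => (w i).1) s (flux q.2 (w s))) := by
  change q.1 * _ + (vol m).fderivCompContinuousLinearMap (ContinuousLinearMap.fst ℝ _ _)
    (flux q.2) w = _
  rw [ContinuousAlternatingMap.fderivCompContinuousLinearMap_apply]
  congr 1
  refine Finset.sum_congr rfl fun s _ => congrArg _ (funext fun j => ?_)
  by_cases h : j = s
  · subst h; simp
  · simp [h]

theorem momForm_update (q : ℝ × MomV m n) (w : Fin m → JetV m n 1) (i : Fin m) {V : JetV m n 1}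
    (hV : V.1 = 0) :
    momForm m n q (update w i V) = vol m (update (fun l => (w l).1) i (flux q.2 V)) := by
  have e : (fun l => (update w i V l).1) = update (fun l => (w l).1) i 0 := by
    funext l
    by_cases h : l = i
    · subst h; simp [hV]
    · simp [h]
  rw [momForm_apply, e, (vol m).map_update_zero, mul_zero, zero_add, Finset.sum_eq_single i]
  · simp
  · intro s _ hs
    exact (vol m).map_coord_zero i (by rw [update_of_ne (Ne.symm hs), update_self])
  · simp

theorem momForm_update_dX (q : ℝ × MomV m n) (i : Fin m) {V : JetV m n 1} (hV : V.1 = 0) :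
    momForm m n q (update dX i V) = flux q.2 V i := by
  rw [momForm_update q dX i hV]
  exact vol_update_ev i _

theorem momForm_dX (q : ℝ × MomV m n) : momForm m n q dX = q.1 := by
  rw [momForm_apply]
  have h : ∀ s, flux q.2 (dX s : JetV m n 1) = 0 := fun s => by
    ext i
    rw [flux_apply]
    have : ∀ I, (dX s : JetV m n 1).u I = 0 := fun I => by
      unfold JetV.u dX; split_ifs <;> rfl
    simp [this]
  simp only [h, (vol m).map_update_zero, Finset.sum_const_zero, add_zero]
  change q.1 * vol m ev = _
  rw [vol_ev, mul_one]

theorem dU_u {k : ℕ} (I J : Fin m → ℕ) (hJ : J ∈ multiIdx m k) (a : Fin n) :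
    (dU I a : JetV m n k).u J = if J = I then EuclideanSpace.single a 1 else 0 := by
  rw [JetV.u_of_mem _ hJ]; rfl

theorem one_ne_zero' (i : Fin m) : one i ≠ 0 := fun h => by
  have := congrFun h i
  simp [one] at this

theorem one_injective : Injective (one : Fin m → Fin m → ℕ) := fun i j h => by
  have := congrFun h i
  simp only [one, Pi.single_eq_same, Pi.single_apply] at this
  by_contra hc
  simp [hc] at this

theorem momForm_pi (q : ℝ × MomV m n) (i : Fin m) (a : Fin n) :
    momForm m n q (update dX i (dU 0 a)) = q.2.1 i a := by
  rw [momForm_update_dX q i rfl, flux_apply]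
  have h1 : ∀ j, (0 : Fin m → ℕ) ≠ one j := fun j => (one_ne_zero' j).symm
  simp [dU_u _ _ (zero_mem_multiIdx 1), dU_u _ _ (one_mem_multiIdx le_rfl _), one_ne_zero']

theorem momForm_pij (q : ℝ × MomV m n) (i j : Fin m) (a : Fin n) :
    momForm m n q (update dX j (dU (one i) a)) = pijOf q.2 i j a := by
  rw [momForm_update_dX q j rfl, flux_apply]
  have h1 : ∀ j, (0 : Fin m → ℕ) ≠ one j := fun j => (one_ne_zero' j).symm
  simp only [dU_u _ _ (zero_mem_multiIdx 1), dU_u _ _ (one_mem_multiIdx le_rfl _), h1, if_false,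
    one_injective.eq_iff, PiLp.zero_apply, mul_zero, zero_add]
  rw [Finset.sum_eq_single a, Finset.sum_eq_single i]
  · simp
  · intro b _ hb; simp [hb]
  · simp
  · intro b _ hb
    refine Finset.sum_eq_zero fun l _ => ?_
    split_ifs <;> simp [hb]
  · simp

theorem isSymMom_momForm (q : ℝ × MomV m n) : IsSymMom (momForm m n q) where
  two_vert v := by
    rintro ⟨i, j, hij, hi, hj⟩
    rw [← update_eq_self i v, momForm_update q _ i hi]
    exact (vol m).map_coord_zero j (by rw [update_of_ne hij.symm, hj])
  symm i j a := by rw [momForm_pij, momForm_pij, pijOf_comm]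

theorem one_add_one_eq_iff (i j k l : Fin m) :
    one k + one l = one i + one j ↔ (k = i ∧ l = j) ∨ (k = j ∧ l = i) := by
  constructor
  · intro h
    have hk := congrFun h k
    have hl := congrFun h l
    simp only [one, Pi.add_apply, Pi.single_apply] at hk hl
    grind
  · rintro (⟨rfl, rfl⟩ | ⟨rfl, rfl⟩)
    · rfl
    · exact add_comm _ _

/-- Exactly `n(ij)` ordered pairs have the sum `1_i + 1_j`. This is the relation `p_α^{1_i+1_j} =
n(ij) p_α^{ij}`. -/
theorem sum_pairs (q : Fin m → Fin m → ℝ) (hq : ∀ i j, q i j = q j i) (i j : Fin m) :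
    (∑ k, ∑ l, if one k + one l = one i + one j then q k l else 0) = nn i j * q i j := by
  simp only [one_add_one_eq_iff]
  by_cases h : i = j
  · subst h
    simp only [or_self, nn, if_true, one_mul]
    rw [Finset.sum_eq_single i, Finset.sum_eq_single i]
    · simp
    · intro l _ hl; simp [hl]
    · simp
    · intro k _ hk; simp [hk]
    · simp
  · rw [Finset.sum_eq_add i j h]
    · rw [Finset.sum_eq_single j, Finset.sum_eq_single i]
      · simp [nn, h, hq j i]; ring
      · intro l _ hl
        simp [hl, Ne.symm h]
      · simp
      · intro l _ hl
        simp [hl, h]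
      · simp
    · intro k _ hk
      simp [hk.1, hk.2]
    · simp
    · simp

theorem exists_one_add_one {I : Fin m → ℕ} (hI : I ∈ multiIdxEq m 2) :
    ∃ i j, I = one i + one j := by
  have hs : ∑ i, I i = 2 := (Finset.mem_filter.1 hI).2
  obtain ⟨i, hi⟩ : ∃ i, I i ≠ 0 := by
    by_contra! hc
    simp [hc] at hs
  have e : I = (I - one i) + one i := by
    funext l
    by_cases hl : l = i
    · subst hl; simp [one]; omega
    · simp [one, hl]
  have h1 : ∑ l, (I - one i) l = 1 := by
    rw [e, sum_add_one] at hs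
    omega
  obtain h0 | ⟨j, hj⟩ := mem_multiIdx_one (mem_multiIdx.2 h1.le)
  · rw [h0] at h1; simp at h1
  · exact ⟨j, i, by rw [← hj, ← e]⟩

/-- The coordinates `p_α^i`, `p_α^I` of a form. -/
def momOf (α : JetV m n 1 [⋀^Fin m]→L[ℝ] ℝ) : MomV m n :=
  (fun i a => α (update dX i (dU 0 a)),
    fun I a => ∑ i, ∑ j, if one i + one j = I.1 then α (update dX j (dU (one i) a)) else 0)

theorem momOf_momForm (q : ℝ × MomV m n) : momOf (momForm m n q) = q.2 := by
  refine Prod.ext (funext fun i => funext fun a => momForm_pi q i a)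
    (funext fun I => funext fun a => ?_)
  simp only [momOf, momForm_pij]
  obtain ⟨i, j, hij⟩ := exists_one_add_one I.2
  rw [hij, sum_pairs (fun i j => pijOf q.2 i j a) (fun i j => pijOf_comm _ _ _ _), pijOf,
    mul_div_cancel₀ _ (nn_pos i j).ne']
  have e : (⟨one i + one j, one_add_one_mem_multiIdxEq i j⟩ : multiIdxEq m 2) = I :=
    Subtype.ext hij.symm
  rw [e]

theorem pijOf_momOf {α : JetV m n 1 [⋀^Fin m]→L[ℝ] ℝ} (h : IsSymMom α) (i j : Fin m) (a : Fin n) :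
    pijOf (momOf α) i j a = α (update dX j (dU (one i) a)) := by
  rw [pijOf, momOf]
  simp only
  rw [sum_pairs (fun i j => α (update dX j (dU (one i) a))) (fun i j => h.symm i j a),
    mul_div_cancel_left₀ _ (nn_pos i j).ne']

theorem IsSymMom.eq_momForm {α : JetV m n 1 [⋀^Fin m]→L[ℝ] ℝ} (h : IsSymMom α) :
    α = momForm m n (α dX, momOf α) := by
  refine form_ext h.two_vert (isSymMom_momForm _).two_vert (momForm_dX (_, momOf α)).symm
    (fun i a => (momForm_pi (_, momOf α) i a).symm) fun i j a => ?_
  rw [momForm_pij, pijOf_momOf h]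

/-- The momenta determine the form up to a multiple of `d^m x`, which dies on a vertical vector. So
they are coordinates on the quotient bundle `J²π‡`. -/
theorem IsSymMom.apply_eq_of_momOf_eq {α β : JetV m n 1 [⋀^Fin m]→L[ℝ] ℝ} (hα : IsSymMom α)
    (hβ : IsSymMom β) (h : momOf α = momOf β) {v : Fin m → JetV m n 1} {s : Fin m}
    (hs : (v s).1 = 0) : α v = β v := by
  refine eq_of_coords hα.two_vert hβ.two_vert (fun i a => congrFun (congrFun (congrArg Prod.fst h) i) a)
    (fun i j a => ?_) hs
  rw [← pijOf_momOf hα, ← pijOf_momOf hβ, h]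

/-- Next to one vertical vector only the base components of the others count, so total derivatives
can stand in for the coordinate vectors. The flux is therefore visible on vectors tangent to
prolonged sections. -/
theorem momForm_update_tot (q : ℝ × MomV m n) (v : JetV m n 2) (i : Fin m) {V : JetV m n 1}
    (hV : V.1 = 0) : momForm m n q (update (fun l => tot v (ev l)) i V) = flux q.2 V i := by
  rw [momForm_update q _ i hV]
  simp only [tot_fst]
  exact vol_update_ev i _

end Momenta


/-! ### Changes of adapted coordinates -/

section Transition

open Function

variable {m n : ℕ}

/-- A change of adapted coordinates `(x, u) ↦ (f x, g (x, u))`. -/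
structure Transition (m n : ℕ) where
  f : OpenPartialHomeomorph (BaseV m) (BaseV m)
  g : BaseV m × FibV n → FibV n
  O : Set (BaseV m × FibV n)
  smooth_f : ContDiffOn ℝ ∞ f f.source
  smooth_symm : ContDiffOn ℝ ∞ f.symm f.target
  isOpen_O : IsOpen O
  fst_mem : ∀ z ∈ O, z.1 ∈ f.source
  smooth_g : ContDiffOn ℝ ∞ g O

namespace Transition

variable (T : Transition m n)

/-- The induced map of sections. -/
def sec (P : BaseV m → FibV n) : BaseV m → FibV n := changeSec T.f T.g P

/-- The induced map of jets. -/
def F (k : ℕ) : JetV m n k → JetV m n k :=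
  (exists_jet_transition T.smooth_f T.smooth_symm T.isOpen_O T.fst_mem T.smooth_g k).choose

theorem F_fst {k : ℕ} (v : JetV m n k) : (T.F k v).1 = T.f v.1 :=
  (exists_jet_transition T.smooth_f T.smooth_symm T.isOpen_O T.fst_mem T.smooth_g
    k).choose_spec.1 v

/-- The jets with value in the domain. -/
def dom (k : ℕ) : Set (JetV m n k) := {v | (v.1, v.u 0) ∈ T.O}

theorem isOpen_dom (k : ℕ) : IsOpen (T.dom k) := by
  simp only [dom, ← uL_apply]
  exact T.isOpen_O.preimage (by fun_prop)

theorem contDiffOn_F (k : ℕ) : ContDiffOn ℝ ∞ (T.F k) (T.dom k) :=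
  (exists_jet_transition T.smooth_f T.smooth_symm T.isOpen_O T.fst_mem T.smooth_g
    k).choose_spec.2.1

theorem jet_sec (k : ℕ) {P : BaseV m → FibV n} {x : BaseV m} (hP : SmoothNear P x)
    (hx : (x, P x) ∈ T.O) : jet k (T.sec P) (T.f x) = T.F k (jet k P x) :=
  (exists_jet_transition T.smooth_f T.smooth_symm T.isOpen_O T.fst_mem T.smooth_g
    k).choose_spec.2.2 P x hP hx

theorem jet_mem_dom {k : ℕ} {P : BaseV m → FibV n} {x : BaseV m} (hx : (x, P x) ∈ T.O) :
    jet k P x ∈ T.dom k := by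
  change (x, (jet k P x).u 0) ∈ T.O
  rwa [jet_u_zero]

theorem trunc_mem_dom {k r : ℕ} {v : JetV m n k} (hv : v ∈ T.dom k) : v.trunc r ∈ T.dom r := by
  change (v.1, (v.trunc r).u 0) ∈ T.O
  rwa [trunc_u _ (zero_mem_multiIdx r)]

theorem smoothNear_F {k : ℕ} {v : JetV m n k} (hv : v ∈ T.dom k) : SmoothNear (T.F k) v :=
  smoothNear_of_contDiffOn (T.contDiffOn_F k) (T.isOpen_dom k) hv

theorem smoothNear_f {x : BaseV m} (hx : x ∈ T.f.source) : SmoothNear T.f x :=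
  smoothNear_of_contDiffOn T.smooth_f T.f.open_source hx

theorem smoothNear_symm {x : BaseV m} (hx : x ∈ T.f.source) : SmoothNear T.f.symm (T.f x) :=
  smoothNear_of_contDiffOn T.smooth_symm T.f.open_target (T.f.map_source hx)

theorem eventually_mem {P : BaseV m → FibV n} {x : BaseV m} (hP : SmoothNear P x)
    (hx : (x, P x) ∈ T.O) : ∀ᶠ y in 𝓝 x, SmoothNear P y ∧ (y, P y) ∈ T.O :=
  hP.eventually.and ((continuousAt_id.prodMk hP.continuousAt).eventually (T.isOpen_O.mem_nhds hx))

theorem smoothNear_sec {P : BaseV m → FibV n} {x : BaseV m} (hP : SmoothNear P x)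
    (hx : (x, P x) ∈ T.O) : SmoothNear (T.sec P) (T.f x) := by
  have hxs : x ∈ T.f.source := T.fst_mem _ hx
  have h1 := T.smoothNear_symm hxs
  have hP' : SmoothNear P (T.f.symm (T.f x)) := by rwa [T.f.left_inv hxs]
  refine SmoothNear.comp (g := T.g) ?_ (h1.prodMk (hP'.comp h1))
  rw [T.f.left_inv hxs]
  exact smoothNear_of_contDiffOn T.smooth_g T.isOpen_O hx

theorem fderiv_F_fst {k : ℕ} {v : JetV m n k} (hv : v ∈ T.dom k) (w : JetV m n k) :
    (fderiv ℝ (T.F k) v w).1 = fderiv ℝ T.f v.1 w.1 := by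
  have h1 := (T.smoothNear_F hv).differentiableAt.hasFDerivAt.fst
  have h2 := (T.smoothNear_f (T.fst_mem _ hv)).differentiableAt.hasFDerivAt.comp v
    (hasFDerivAt_fst (𝕜 := ℝ) (p := v))
  have h3 : (fun w => (T.F k w).1) = T.f ∘ Prod.fst := funext fun w => T.F_fst w
  rw [h3] at h1
  exact congrArg (fun A : JetV m n k →L[ℝ] BaseV m => A w) (h1.unique h2)

theorem fderiv_symm_fderiv {x : BaseV m} (hx : x ∈ T.f.source) (w : BaseV m) :
    fderiv ℝ T.f x (fderiv ℝ T.f.symm (T.f x) w) = w := by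
  have hd : HasFDerivAt T.f (fderiv ℝ T.f x) (T.f.symm (T.f x)) := by
    rw [T.f.left_inv hx]
    exact (T.smoothNear_f hx).differentiableAt.hasFDerivAt
  have h1 := hd.comp (T.f x) (T.smoothNear_symm hx).differentiableAt.hasFDerivAt
  have h2 : HasFDerivAt (T.f ∘ T.f.symm) (ContinuousLinearMap.id ℝ (BaseV m)) (T.f x) := by
    refine (hasFDerivAt_id _).congr_of_eventuallyEq ?_
    filter_upwards [T.f.open_target.mem_nhds (T.f.map_source hx)] with y hy
    exact T.f.right_inv hy
  exact congrArg (fun A : BaseV m →L[ℝ] BaseV m => A w) (h1.unique h2)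

theorem fderiv_F_comp_tot (k : ℕ) {P : BaseV m → FibV n} {x : BaseV m} (hP : SmoothNear P x)
    (hx : (x, P x) ∈ T.O) :
    (fderiv ℝ (T.F k) (jet k P x)).comp (fderiv ℝ (jet k P) x) =
      (fderiv ℝ (jet k (T.sec P)) (T.f x)).comp (fderiv ℝ T.f x) := by
  have h1 := (T.smoothNear_F (T.jet_mem_dom (k := k) hx)).differentiableAt.hasFDerivAt.comp x
    (hP.jet k).differentiableAt.hasFDerivAt
  have h2 := ((T.smoothNear_sec hP hx).jet k).differentiableAt.hasFDerivAt.comp x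
    (T.smoothNear_f (T.fst_mem _ hx)).differentiableAt.hasFDerivAt
  refine h1.unique (h2.congr_of_eventuallyEq ?_)
  filter_upwards [T.eventually_mem hP hx] with y hy
  exact (T.jet_sec k hy.1 hy.2).symm

/-- The induced map of variations of a section. -/
def varSec (P ξ : BaseV m → FibV n) (y : BaseV m) : FibV n :=
  fderiv ℝ T.g (T.f.symm y, P (T.f.symm y)) (0, ξ (T.f.symm y))

theorem smoothNear_varSec {P ξ : BaseV m → FibV n} {x : BaseV m} (hP : SmoothNear P x)
    (hξ : SmoothNear ξ x) (hx : (x, P x) ∈ T.O) : SmoothNear (T.varSec P ξ) (T.f x) := by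
  have hxs : x ∈ T.f.source := T.fst_mem _ hx
  have h1 := T.smoothNear_symm hxs
  have hP' : SmoothNear P (T.f.symm (T.f x)) := by rwa [T.f.left_inv hxs]
  have hξ' : SmoothNear ξ (T.f.symm (T.f x)) := by rwa [T.f.left_inv hxs]
  refine SmoothNear.clm_apply (A := fun y => fderiv ℝ T.g (T.f.symm y, P (T.f.symm y))) ?_
    (smoothNear_const.prodMk (hξ'.comp h1))
  refine SmoothNear.comp (g := fderiv ℝ T.g) ?_ (h1.prodMk (hP'.comp h1))
  rw [T.f.left_inv hxs]
  exact (smoothNear_of_contDiffOn T.smooth_g T.isOpen_O hx).fderiv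

theorem varSec_apply_of_eq_zero {P ξ : BaseV m → FibV n} {x : BaseV m} (hxs : x ∈ T.f.source)
    (h : ξ x = 0) : T.varSec P ξ (T.f x) = 0 := by
  rw [varSec, T.f.left_inv hxs, h, Prod.mk_zero_zero, map_zero]

end Transition

/-- The vertical vector with the components of the jet of `ξ`. -/
def vj (k : ℕ) (ξ : BaseV m → FibV n) (y : BaseV m) : JetV m n k := (0, (jet k ξ y).2)

theorem vj_u {k : ℕ} (ξ : BaseV m → FibV n) (y : BaseV m) {I : Fin m → ℕ}
    (hI : I ∈ multiIdx m k) : (vj k ξ y).u I = iterPartial I ξ y := JetV.u_of_mem _ hI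

theorem SmoothNear.vj {ξ : BaseV m → FibV n} {x : BaseV m} (h : SmoothNear ξ x) (k : ℕ) :
    SmoothNear (vj k ξ) x :=
  smoothNear_const.prodMk (SmoothNear.comp (g := Prod.snd) (contDiff_snd.smoothNear _) (h.jet k))

theorem jet_add_smul {P ξ : BaseV m → FibV n} {x : BaseV m} (hP : SmoothNear P x)
    (hξ : SmoothNear ξ x) (k : ℕ) (t : ℝ) :
    jet k (fun y => P y + t • ξ y) x = jet k P x + t • vj k ξ x := by
  refine Prod.ext ?_ (funext fun I => ?_)
  · simp [jet, vj]
  · change iterPartial I.1 (fun y => P y + t • ξ y) x = _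
    rw [(iterPartial_add hP (smoothNear_const.smul hξ) I.1).self_of_nhds]
    change _ + iterPartial I.1 (fun y => t • ξ y) x = _
    rw [(iterPartial_const_smul hξ t I.1).self_of_nhds]
    rfl

/-- Both sides are the velocity at `t = 0` of the jet of the transform of `P + t ξ`. On the left the
chain rule is applied to `F`; on the right the `t`-derivative is interchanged with the base
derivatives. -/
theorem Transition.fderiv_F_vj (T : Transition m n) (k : ℕ) {P ξ : BaseV m → FibV n} {x : BaseV m}
    (hP : SmoothNear P x) (hξ : SmoothNear ξ x) (hx : (x, P x) ∈ T.O) :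
    fderiv ℝ (T.F k) (jet k P x) (vj k ξ x) = vj k (T.varSec P ξ) (T.f x) := by
  have hxs : x ∈ T.f.source := T.fst_mem _ hx
  have h1 := T.smoothNear_symm hxs
  -- `Φ (t, ·)` is the transform of the section `P + t ξ`; its `t`-derivative at `0` is the
  -- transformed variation `varSec`.
  let Φ : ℝ × BaseV m → FibV n := fun z =>
    T.g (T.f.symm z.2, P (T.f.symm z.2) + z.1 • ξ (T.f.symm z.2))
  have hΦ : SmoothNear Φ ((0 : ℝ), T.f x) := by
    have h2 : SmoothNear (fun z : ℝ × BaseV m => T.f.symm z.2) ((0 : ℝ), T.f x) :=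
      SmoothNear.comp (f := fun z : ℝ × BaseV m => z.2) h1 (contDiff_snd.smoothNear _)
    have hP' : SmoothNear P (T.f.symm (T.f x)) := by rwa [T.f.left_inv hxs]
    have hξ' : SmoothNear ξ (T.f.symm (T.f x)) := by rwa [T.f.left_inv hxs]
    have h3 : SmoothNear (fun z : ℝ × BaseV m => P (T.f.symm z.2) + z.1 • ξ (T.f.symm z.2))
        ((0 : ℝ), T.f x) :=
      (SmoothNear.comp (f := fun z : ℝ × BaseV m => T.f.symm z.2) hP' h2).add
        ((contDiff_fst.smoothNear _).smul
          (SmoothNear.comp (f := fun z : ℝ × BaseV m => T.f.symm z.2) hξ' h2))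
    refine SmoothNear.comp (g := T.g) ?_ (h2.prodMk h3)
    simp only [T.f.left_inv hxs, zero_smul, add_zero]
    exact smoothNear_of_contDiffOn T.smooth_g T.isOpen_O hx
  have hvar : (fun y => fderiv ℝ Φ ((0 : ℝ), y) (1, 0)) =ᶠ[𝓝 (T.f x)] T.varSec P ξ := by
    have hev : ∀ᶠ y in 𝓝 (T.f x), SmoothNear Φ ((0 : ℝ), y) :=
      (Continuous.prodMk_right (0 : ℝ)).continuousAt.eventually hΦ.eventually
    have hev2 : ∀ᶠ y in 𝓝 (T.f x), (T.f.symm y, P (T.f.symm y)) ∈ T.O := by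
      have hP' : SmoothNear P (T.f.symm (T.f x)) := by rwa [T.f.left_inv hxs]
      refine (h1.continuousAt.prodMk (hP'.comp h1).continuousAt).eventually (T.isOpen_O.mem_nhds ?_)
      change (T.f.symm (T.f x), P (T.f.symm (T.f x))) ∈ T.O
      rwa [T.f.left_inv hxs]
    filter_upwards [hev, hev2] with y hy hy2
    rw [← fderiv_slice_left (z := ((0 : ℝ), y)) hy.differentiableAt (1 : ℝ)]
    have hg : HasFDerivAt T.g (fderiv ℝ T.g (T.f.symm y, P (T.f.symm y)))
        (T.f.symm y, P (T.f.symm y) + (0 : ℝ) • ξ (T.f.symm y)) := by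
      rw [zero_smul, add_zero]
      exact (smoothNear_of_contDiffOn T.smooth_g T.isOpen_O hy2).differentiableAt.hasFDerivAt
    have hl : HasDerivAt (fun t : ℝ => (T.f.symm y, P (T.f.symm y) + t • ξ (T.f.symm y)))
        (0, (1 : ℝ) • ξ (T.f.symm y)) 0 :=
      (hasDerivAt_const _ _).prodMk (((hasDerivAt_id (0 : ℝ)).smul_const _).const_add _)
    have := hg.comp_hasDerivAt (0 : ℝ) hl
    rw [one_smul] at this
    exact this.deriv
  have hJ : HasDerivAt (fun t : ℝ => jet k P x + t • vj k ξ x) ((1 : ℝ) • vj k ξ x) 0 :=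
    ((hasDerivAt_id (0 : ℝ)).smul_const _).const_add _
  have hF : HasFDerivAt (T.F k) (fderiv ℝ (T.F k) (jet k P x))
      (jet k P x + (0 : ℝ) • vj k ξ x) := by
    rw [zero_smul, add_zero]
    exact (T.smoothNear_F (T.jet_mem_dom hx)).differentiableAt.hasFDerivAt
  have hA := hF.comp_hasDerivAt (0 : ℝ) hJ
  rw [one_smul] at hA
  have hB : HasDerivAt (fun t : ℝ => jet k (fun y => Φ (t, y)) (T.f x))
      (vj k (T.varSec P ξ) (T.f x)) 0 := by
    refine HasDerivAt.prodMk (hasDerivAt_const _ _) (hasDerivAt_pi.2 fun I => ?_)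
    have hd := (smoothNear_iterPartial_family hΦ I.1).differentiableAt
    have e : fderiv ℝ (fun z : ℝ × BaseV m => iterPartial I.1 (fun y => Φ (z.1, y)) z.2)
        ((0 : ℝ), T.f x) (1, 0) = iterPartial I.1 (T.varSec P ξ) (T.f x) :=
      ((fderiv_iterPartial_family hΦ 1 I.1).self_of_nhds).trans
        (iterPartial_congr hvar I.1).self_of_nhds
    rw [← fderiv_slice_left hd (1 : ℝ)] at e
    have hd' : DifferentiableAt ℝ (fun t : ℝ => iterPartial I.1 (fun y => Φ (t, y)) (T.f x)) 0 :=
      DifferentiableAt.comp (0 : ℝ)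
        (f := fun t : ℝ => (t, T.f x)) hd (by fun_prop)
    have := hd'.hasDerivAt
    rw [← fderiv_apply_one_eq_deriv] at this
    change HasDerivAt _ (iterPartial I.1 (T.varSec P ξ) (T.f x)) 0
    rw [← e]
    exact this
  refine hA.unique (hB.congr_of_eventuallyEq ?_)
  have hmem : ∀ᶠ t : ℝ in 𝓝 0, (x, P x + t • ξ x) ∈ T.O := by
    have hc : ContinuousAt (fun t : ℝ => (x, P x + t • ξ x)) 0 := by fun_prop
    exact hc.eventually (T.isOpen_O.mem_nhds (by simpa using hx))
  filter_upwards [hmem] with t ht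
  have hs : SmoothNear (fun y => P y + t • ξ y) x := hP.add (smoothNear_const.smul hξ)
  have := T.jet_sec k hs ht
  rw [jet_add_smul hP hξ] at this
  exact this.symm

/-- On the vectors `∂/∂u_i^α` the derivative of the change of jet coordinates involves only first
derivatives of the transition: it is the inverse base Jacobian on the index `i` tensored with the
fibre derivative on `α`. The pulled-back `p_α^{ij}` is hence a contraction of the old one with the
same matrix on both upper indices, and symmetry survives. -/
theorem Transition.isSymMom_comp (T : Transition m n) {v : JetV m n 1} (hv : v ∈ T.dom 1)
    {α : JetV m n 1 [⋀^Fin m]→L[ℝ] ℝ} (hα : IsSymMom α) :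
    IsSymMom (α.compContinuousLinearMap (fderiv ℝ (T.F 1) v)) where
  two_vert w := by
    rintro ⟨i, j, hij, hi, hj⟩
    refine hα.two_vert _ ⟨i, j, hij, ?_, ?_⟩
    · simp [T.fderiv_F_fst hv, hi]
    · simp [T.fderiv_F_fst hv, hj]
  symm := by
    obtain ⟨P, hPs, hP⟩ := exists_jet_eq v
    have hPx := hPs.smoothNear v.1
    have hx : (v.1, P v.1) ∈ T.O := by
      have := hv
      rw [← hP] at this
      change (v.1, (jet 1 P v.1).u 0) ∈ T.O at this
      rwa [jet_u_zero] at this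
    have hxs : v.1 ∈ T.f.source := T.fst_mem _ hx
    set κ := fderiv ℝ T.f.symm (T.f v.1) with hκ
    set S : FibV n →L[ℝ] FibV n :=
      (fderiv ℝ T.g (v.1, P v.1)).comp (ContinuousLinearMap.inr ℝ _ _) with hS
    have key : ∀ i a, ∃ V : JetV m n 1, V.1 = 0 ∧ V.u 0 = 0 ∧
        (∀ l, V.u (one l) = κ (ev l) i • S (EuclideanSpace.single a 1)) ∧
        fderiv ℝ (T.F 1) v (dU (one i) a) = V := by
      intro i a
      -- The vector `∂/∂u_i^a` is realized as the 1-jet of a variation that vanishes at the point.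
      -- The vanishing removes the derivative of the fibre derivative of `g` when the transformed
      -- variation is differentiated.
      obtain ⟨ξ, hξs, hξ⟩ := exists_jet_eq ((v.1, (dU (one i) a : JetV m n 1).2) : JetV m n 1)
      have hξx := hξs.smoothNear v.1
      have hu : ∀ I ∈ multiIdx m 1, iterPartial I ξ v.1 =
          if I = one i then EuclideanSpace.single a 1 else 0 := fun I hI => by
        rw [← jet_u ξ v.1 hI, show jet 1 ξ v.1 = (v.1, (dU (one i) a : JetV m n 1).2) from hξ]
        exact JetV.u_of_mem _ hI
      have hξ0 : ξ v.1 = 0 := by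
        have := hu 0 (zero_mem_multiIdx 1)
        rwa [iterPartial_zero, if_neg (one_ne_zero' i).symm] at this
      have hdξ : ∀ w, fderiv ℝ ξ v.1 w = w i • EuclideanSpace.single a 1 := fun w => by
        rw [eq_sum_ev w, map_sum]
        have : ∀ l, fderiv ℝ ξ v.1 (ev l) =
            if l = i then (EuclideanSpace.single a 1 : FibV n) else 0 := fun l => by
          have h1 := (iterPartial_add_one hξx 0 l).self_of_nhds
          rw [zero_add, hu _ (one_mem_multiIdx le_rfl l), iterPartial_zero] at h1
          simp only [one_injective.eq_iff] at h1
          exact h1.symm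
        simp only [map_smul, this]
        rw [← eq_sum_ev]
        simp
      refine ⟨vj 1 (T.varSec P ξ) (T.f v.1), rfl, ?_, fun l => ?_, ?_⟩
      · rw [vj_u _ _ (zero_mem_multiIdx 1), iterPartial_zero]
        exact T.varSec_apply_of_eq_zero hxs hξ0
      · rw [vj_u _ _ (one_mem_multiIdx le_rfl l)]
        have hs := T.smoothNear_varSec hPx hξx hx
        have h1 := (iterPartial_add_one hs 0 l).self_of_nhds
        rw [zero_add, iterPartial_zero] at h1
        rw [h1, pd]
        have hsy := T.smoothNear_symm hxs
        have hξ' : HasFDerivAt ξ (fderiv ℝ ξ v.1) (T.f.symm (T.f v.1)) := by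
          rw [T.f.left_inv hxs]; exact hξx.differentiableAt.hasFDerivAt
        have hc : HasFDerivAt (fun y => ((0 : BaseV m), ξ (T.f.symm y)))
            ((0 : BaseV m →L[ℝ] BaseV m).prod ((fderiv ℝ ξ v.1).comp κ)) (T.f v.1) :=
          (hasFDerivAt_const _ _).prodMk (hξ'.comp (T.f v.1) hsy.differentiableAt.hasFDerivAt)
        have hPx' : SmoothNear P (T.f.symm (T.f v.1)) := by rwa [T.f.left_inv hxs]
        have hA : DifferentiableAt ℝ (fun y => fderiv ℝ T.g (T.f.symm y, P (T.f.symm y)))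
            (T.f v.1) := by
          refine (SmoothNear.comp (g := fderiv ℝ T.g) ?_
            (hsy.prodMk (hPx'.comp hsy))).differentiableAt
          rw [T.f.left_inv hxs]
          exact (smoothNear_of_contDiffOn T.smooth_g T.isOpen_O hx).fderiv
        have hd := (hA.hasFDerivAt.clm_apply hc).fderiv
        change fderiv ℝ (fun y => fderiv ℝ T.g (T.f.symm y, P (T.f.symm y))
          (0, ξ (T.f.symm y))) (T.f v.1) (ev l) = _
        rw [hd]
        simp only [T.f.left_inv hxs, hξ0, ContinuousLinearMap.comp_apply,
          ContinuousLinearMap.prod_apply, zero_apply, Prod.mk_zero_zero, map_zero, add_zero, hdξ]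
        rw [← map_smul]
        rfl
      · rw [← T.fderiv_F_vj 1 hPx hξx hx, hP]
        congr 1
        exact Prod.ext rfl (congrArg Prod.snd hξ).symm
    set K := fderiv ℝ T.f v.1 with hK
    have hKκ : ∀ z, K (κ z) = z := T.fderiv_symm_fderiv hxs
    -- Cramer's rule for the linear map `K` with right inverse `κ`.
    have hvol : ∀ j z, vol m (update (fun l => K (ev l)) j z) =
        vol m (fun l => K (ev l)) * κ z j := fun j z => by
      conv_lhs => rw [← hKκ z, eq_sum_ev (κ z), map_sum, ← insertL_apply, map_sum]
      simp only [map_smul, insertL_apply, vol_update_comp]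
      simp [mul_comm]
    -- The transformation law of `p_α^{ij}`: the Jacobian determinant times a contraction with `κ`
    -- in both `i` and `j`. The symmetry follows by renaming the summation indices `b` and `l`.
    have hval : ∀ i j a, α.compContinuousLinearMap (fderiv ℝ (T.F 1) v)
        (update dX j (dU (one i) a)) = vol m (fun l => K (ev l)) *
          ∑ b, ∑ c, ∑ l, κ (ev b) j * (pijOf (momOf α) l b c *
            (κ (ev l) i * S (EuclideanSpace.single a 1) c)) := by
      intro i j a
      obtain ⟨V, hV, hV0, hV1, hVe⟩ := key i a
      have e1 : α.compContinuousLinearMap (fderiv ℝ (T.F 1) v) (update dX j (dU (one i) a)) =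
          α (update (fun l => fderiv ℝ (T.F 1) v (dX l)) j V) := by
        change α (fun l => fderiv ℝ (T.F 1) v (update dX j (dU (one i) a) l)) = _
        congr 1
        funext l
        by_cases hl : l = j
        · subst hl; simp [hVe]
        · simp [hl]
      rw [e1]
      conv_lhs => rw [hα.eq_momForm]
      rw [momForm_update _ _ _ hV]
      have e2 : (fun l => (fderiv ℝ (T.F 1) v (dX l)).1) = fun l => K (ev l) :=
        funext fun l => T.fderiv_F_fst hv _
      rw [e2, hvol]
      congr 1
      conv_lhs => rw [eq_sum_ev (flux _ V)]
      change crd j (κ _) = _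
      simp only [map_sum, map_smul, crd_apply, flux_apply, hV0, hV1, PiLp.zero_apply, mul_zero,
        zero_add, smul_eq_mul, PiLp.smul_apply, Finset.sum_mul]
      refine Finset.sum_congr rfl fun b _ => Finset.sum_congr rfl fun c _ =>
        Finset.sum_congr rfl fun l _ => ?_
      ring
    intro i j a
    rw [hval, hval]
    congr 1
    rw [Finset.sum_comm, Finset.sum_comm (s := Finset.univ (α := Fin m))]
    refine Finset.sum_congr rfl fun c _ => ?_
    rw [Finset.sum_comm]
    refine Finset.sum_congr rfl fun b _ => Finset.sum_congr rfl fun l _ => ?_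
    rw [pijOf_comm]
    ring

end Transition


/-! ### The Legendre map in coordinates -/

section Legendre

open Function

variable {m n : ℕ}

/-- The momenta `p_α^I` of the Legendre map of the function `l`. -/
def cLegI (l : JetV m n 2 → ℝ) (I : Fin m → ℕ) (a : Fin n) (v : JetV m n 2) : ℝ :=
  fderiv ℝ l v (dU I a)

/-- The momenta `p_α^i` of the Legendre map of the function `l`. -/
def cLegi (l : JetV m n 2 → ℝ) (i : Fin m) (a : Fin n) (v : JetV m n 3) : ℝ :=
  fderiv ℝ l (v.trunc 2) (dU (one i) a) -
    ∑ j, (1 / nn i j) * totalDeriv j (cLegI l (one i + one j) a) v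

/-- The Legendre map of the function `l`. -/
def cLeg (l : JetV m n 2 → ℝ) (v : JetV m n 3) : MomV m n :=
  (fun i a => cLegi l i a v, fun I a => cLegI l I.1 a (v.trunc 2))

theorem sum_multiIdx_two {A : Type*} [AddCommMonoid A] (h : (Fin m → ℕ) → A) :
    ∑ I ∈ multiIdx m 2, h I = h 0 + (∑ i, h (one i) + ∑ I ∈ multiIdxEq m 2, h I) := by
  classical
  have e : multiIdx m 2 =
      insert 0 ((Finset.univ.image (one : Fin m → Fin m → ℕ)) ∪ multiIdxEq m 2) := by
    ext I
    simp only [Finset.mem_insert, Finset.mem_union, Finset.mem_image, Finset.mem_univ, true_and]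
    constructor
    · intro hI
      by_cases h2 : ∑ i, I i = 2
      · exact Or.inr (Or.inr (Finset.mem_filter.2 ⟨hI, h2⟩))
      · have := mem_multiIdx.1 hI
        obtain h0 | ⟨i, hi⟩ := mem_multiIdx_one (mem_multiIdx.2 (by omega : ∑ i, I i ≤ 1))
        · exact Or.inl h0
        · exact Or.inr (Or.inl ⟨i, hi.symm⟩)
    · rintro (rfl | ⟨i, rfl⟩ | hI)
      · exact zero_mem_multiIdx 2
      · exact one_mem_multiIdx (by norm_num) i
      · exact (Finset.mem_filter.1 hI).1
  have h2 : ∀ I ∈ multiIdxEq m 2, ∑ i, I i = 2 := fun I hI => (Finset.mem_filter.1 hI).2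
  have h1 : ∀ i : Fin m, ∑ l, one i l = 1 := fun i => by simp [one]
  rw [e, Finset.sum_insert, Finset.sum_union, Finset.sum_image fun i _ j _ h => one_injective h]
  · rw [Finset.disjoint_left]
    rintro I hI hI'
    obtain ⟨i, -, rfl⟩ := Finset.mem_image.1 hI
    have := h2 _ hI'
    rw [h1] at this
    omega
  · rw [Finset.mem_union, not_or]
    refine ⟨fun hc => ?_, fun hc => ?_⟩
    · obtain ⟨i, -, hi⟩ := Finset.mem_image.1 hc
      exact one_ne_zero' i hi
    · have := h2 _ hc
      simp at this

theorem sum_pairs_div (h : (Fin m → ℕ) → ℝ) :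
    ∑ i, ∑ j, h (one i + one j) / nn i j = ∑ I ∈ multiIdxEq m 2, h I := by
  have h1 : ∀ I ∈ multiIdxEq m 2,
      h I = ∑ i, ∑ j, if one i + one j = I then h (one i + one j) / nn i j else 0 := fun I hI => by
    obtain ⟨i, j, rfl⟩ := exists_one_add_one hI
    rw [sum_pairs (fun i j => h (one i + one j) / nn i j)
      (fun i j => by rw [nn_comm, add_comm (one i)]), mul_div_cancel₀ _ (nn_pos i j).ne']
  symm
  rw [Finset.sum_congr rfl h1, Finset.sum_comm]
  refine Finset.sum_congr rfl fun i _ => ?_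
  rw [Finset.sum_comm]
  refine Finset.sum_congr rfl fun j _ => ?_
  rw [Finset.sum_ite_eq, if_pos (one_add_one_mem_multiIdxEq i j)]

/-- The first variation formula at `x`, for variations vanishing at `x`. -/
def VarEq (l : JetV m n 2 → ℝ) (P : BaseV m → FibV n) (ν : BaseV m → MomV m n) (x : BaseV m) :
    Prop :=
  ∀ ξ : BaseV m → FibV n, SmoothNear ξ x → ξ x = 0 →
    fderiv ℝ l (jet 2 P x) (vj 2 ξ x) =
      ∑ i, fderiv ℝ (fun y => flux (ν y) (vj 1 ξ y) i) x (ev i)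

theorem fderiv_vj_two (l : JetV m n 2 → ℝ) (v : JetV m n 2) {ξ : BaseV m → FibV n} {x : BaseV m}
    (h0 : ξ x = 0) : fderiv ℝ l v (vj 2 ξ x) =
      ∑ i, ∑ a, iterPartial (one i) ξ x a * fderiv ℝ l v (dU (one i) a) +
        ∑ I ∈ multiIdxEq m 2, ∑ a, iterPartial I ξ x a * cLegI l I a v := by
  rw [dU_sum (vj 2 ξ x) rfl]
  simp only [map_sum, map_smul, smul_eq_mul]
  change ∑ I : multiIdx m 2, (fun I : Fin m → ℕ => ∑ a, iterPartial I ξ x a *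
    fderiv ℝ l v (dU I a)) I.1 = _
  rw [Finset.sum_coe_sort (multiIdx m 2) (fun I : Fin m → ℕ => ∑ a, iterPartial I ξ x a *
    fderiv ℝ l v (dU I a)), sum_multiIdx_two]
  simp [iterPartial_zero, h0, cLegI]

theorem differentiableAt_pijOf {ν : BaseV m → MomV m n} {x : BaseV m}
    (hν : DifferentiableAt ℝ ν x) (i j : Fin m) (a : Fin n) :
    DifferentiableAt ℝ (fun y => pijOf (ν y) i j a) x := by
  have h : DifferentiableAt ℝ
      (fun y => (ν y).2 ⟨one i + one j, one_add_one_mem_multiIdxEq i j⟩ a) x :=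
    differentiableAt_pi.1 (differentiableAt_pi.1 hν.snd _) a
  simp only [pijOf, div_eq_mul_inv]
  exact h.mul_const _

/-- The product rule, where each term with an undifferentiated `ξ` drops out at `x`. The sum of
`p_α^{ij} ∂_i ∂_j ξ` over ordered pairs becomes the sum of `p_α^I ∂_I ξ`, the factors `n(ij)`
cancelling the multiplicities. -/
theorem sum_fderiv_flux {ν : BaseV m → MomV m n} {x : BaseV m} (hν : DifferentiableAt ℝ ν x)
    {ξ : BaseV m → FibV n} (hξ : SmoothNear ξ x) (h0 : ξ x = 0) :
    ∑ i, fderiv ℝ (fun y => flux (ν y) (vj 1 ξ y) i) x (ev i) =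
      ∑ i, ∑ a, iterPartial (one i) ξ x a *
          ((ν x).1 i a + ∑ j, fderiv ℝ (fun y => pijOf (ν y) i j a) x (ev j)) +
        ∑ I : multiIdxEq m 2, ∑ a, iterPartial I.1 ξ x a * (ν x).2 I a := by
  have hcomp : ∀ (I : Fin m → ℕ) (a : Fin n), HasFDerivAt (fun y => iterPartial I ξ y a)
      ((EuclideanSpace.proj a : FibV n →L[ℝ] ℝ).comp (fderiv ℝ (iterPartial I ξ) x)) x :=
    fun I a => (EuclideanSpace.proj a : FibV n →L[ℝ] ℝ).hasFDerivAt.comp x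
      (hξ.iterPartial I).differentiableAt.hasFDerivAt
  have hev : ∀ (I : Fin m → ℕ) (i : Fin m), fderiv ℝ (iterPartial I ξ) x (ev i) =
      iterPartial (I + one i) ξ x := fun I i => ((iterPartial_add_one hξ I i).self_of_nhds).symm
  have hev0 : ∀ i : Fin m, fderiv ℝ ξ x (ev i) = iterPartial (one i) ξ x := fun i => by
    simpa only [iterPartial_zero, zero_add] using hev 0 i
  have hflux : ∀ i, fderiv ℝ (fun y => flux (ν y) (vj 1 ξ y) i) x (ev i) =
      ∑ a, ((ν x).1 i a * iterPartial (one i) ξ x a +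
        ∑ j, (pijOf (ν x) j i a * iterPartial (one j + one i) ξ x a +
          iterPartial (one j) ξ x a * fderiv ℝ (fun y => pijOf (ν y) j i a) x (ev i))) := by
    intro i
    have e : (fun y => flux (ν y) (vj 1 ξ y) i) = fun y => ∑ a, ((ν y).1 i a * iterPartial 0 ξ y a +
        ∑ j, pijOf (ν y) j i a * iterPartial (one j) ξ y a) := funext fun y => by
      simp only [flux_apply, vj_u ξ y (zero_mem_multiIdx 1), vj_u ξ y (one_mem_multiIdx le_rfl _)]
    have hd1 : ∀ a, DifferentiableAt ℝ (fun y => (ν y).1 i a) x := fun a =>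
      differentiableAt_pi.1 (differentiableAt_pi.1 hν.fst i) a
    have hd := HasFDerivAt.fun_sum (u := (Finset.univ : Finset (Fin n))) fun a _ =>
      ((hd1 a).hasFDerivAt.fun_mul (hcomp 0 a)).fun_add
        (HasFDerivAt.fun_sum (u := (Finset.univ : Finset (Fin m))) fun j _ =>
          (differentiableAt_pijOf hν j i a).hasFDerivAt.fun_mul (hcomp (one j) a))
    rw [e, hd.fderiv]
    simp only [sum_apply, add_apply, smul_apply, ContinuousLinearMap.comp_apply, hev,
      hev0, iterPartial_zero, h0, PiLp.zero_apply, zero_smul, add_zero, smul_eq_mul]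
    rfl
  simp only [hflux, Finset.sum_add_distrib, mul_add]
  rw [add_assoc]
  congr 1
  · refine Finset.sum_congr rfl fun i _ => Finset.sum_congr rfl fun a _ => mul_comm _ _
  rw [add_comm]
  congr 1
  · simp only [Finset.mul_sum]
    have : ∀ i, (∑ a, ∑ j, iterPartial (one j) ξ x a *
        fderiv ℝ (fun y => pijOf (ν y) j i a) x (ev i)) = ∑ j, ∑ a, iterPartial (one j) ξ x a *
        fderiv ℝ (fun y => pijOf (ν y) j i a) x (ev i) := fun i => Finset.sum_comm
    simp only [this]
    rw [Finset.sum_comm]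
    exact Finset.sum_congr rfl fun j _ => Finset.sum_comm
  -- Extended by zero to all multi-indices, so that `sum_pairs_div` can be applied without
  -- membership proofs in the summands.
  · let h : (Fin m → ℕ) → ℝ := fun I => if hI : I ∈ multiIdxEq m 2 then
      ∑ a, iterPartial I ξ x a * (ν x).2 ⟨I, hI⟩ a else 0
    have e1 : ∀ I : multiIdxEq m 2, ∑ a, iterPartial I.1 ξ x a * (ν x).2 I a = h I.1 := fun I => by
      simp only [h, dif_pos I.2]
    simp only [e1]
    rw [Finset.sum_coe_sort (multiIdxEq m 2) h, ← sum_pairs_div]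
    refine Finset.sum_congr rfl fun i _ => ?_
    rw [Finset.sum_comm]
    refine Finset.sum_congr rfl fun j _ => ?_
    simp only [h, dif_pos (one_add_one_mem_multiIdxEq i j), Finset.sum_div]
    refine Finset.sum_congr rfl fun a _ => ?_
    rw [pijOf_comm, pijOf, add_comm (one j)]
    ring

/-- The first and second derivatives of a variation vanishing at `x` can be prescribed freely.
Therefore the coefficients of each `∂_i ξ^a` and `∂_I ξ^a` on the two sides must agree. -/
theorem varEq_iff {l : JetV m n 2 → ℝ} {P : BaseV m → FibV n} {ν : BaseV m → MomV m n}
    {x : BaseV m} (hν : DifferentiableAt ℝ ν x) :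
    VarEq l P ν x ↔
      (∀ i a, (ν x).1 i a = fderiv ℝ l (jet 2 P x) (dU (one i) a) -
        ∑ j, fderiv ℝ (fun y => pijOf (ν y) i j a) x (ev j)) ∧
      ∀ (I : multiIdxEq m 2) a, (ν x).2 I a = cLegI l I.1 a (jet 2 P x) := by
  constructor
  · intro h
    -- Polynomial variations whose 2-jet at `x` has a single nonzero coordinate. The case `J = 0` is
    -- excluded because the variation must vanish at `x`.
    have hjet : ∀ (J : Fin m → ℕ), J ≠ 0 → ∀ a, ∃ ξ : BaseV m → FibV n, SmoothNear ξ x ∧ ξ x = 0 ∧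
        ∀ I ∈ multiIdx m 2, ∀ b, iterPartial I ξ x b = if I = J ∧ b = a then 1 else 0 := by
      intro J hJ a
      obtain ⟨ξ, hξs, hξ⟩ := exists_jet_eq ((x, (dU J a : JetV m n 2).2) : JetV m n 2)
      have hu : ∀ I ∈ multiIdx m 2, iterPartial I ξ x =
          if I = J then EuclideanSpace.single a 1 else 0 := fun I hI => by
        rw [← jet_u ξ x hI, show jet 2 ξ x = (x, (dU J a : JetV m n 2).2) from hξ]
        exact JetV.u_of_mem _ hI
      refine ⟨ξ, hξs.smoothNear x, ?_, fun I hI b => ?_⟩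
      · have := hu 0 (zero_mem_multiIdx 2)
        rwa [iterPartial_zero, if_neg hJ.symm] at this
      · rw [hu I hI]
        by_cases hIJ : I = J
        · by_cases hb : b = a <;> simp [hIJ, hb]
        · simp [hIJ]
    have hne : ∀ (i : Fin m) (I : Fin m → ℕ), I ∈ multiIdxEq m 2 → I ≠ one i := by
      rintro i I hI rfl
      have := (Finset.mem_filter.1 hI).2
      simp [one] at this
    have hone : ∀ i : Fin m, one i ∈ multiIdx m 2 := fun i => one_mem_multiIdx (by norm_num) i
    have hmem : ∀ I ∈ multiIdxEq m 2, I ∈ multiIdx m 2 := fun I hI => (Finset.mem_filter.1 hI).1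
    refine ⟨fun i a => ?_, fun J a => ?_⟩
    · obtain ⟨ξ, hξ, h0, hu⟩ := hjet (one i) (one_ne_zero' i) a
      have h1 := h ξ hξ h0
      rw [fderiv_vj_two l _ h0, sum_fderiv_flux hν hξ h0] at h1
      have z1 : ∀ q : (Fin m → ℕ) → Fin n → ℝ,
          ∑ I ∈ multiIdxEq m 2, ∑ a, iterPartial I ξ x a * q I a = 0 := fun q =>
        Finset.sum_eq_zero fun I hI => Finset.sum_eq_zero fun b _ => by
          rw [hu I (hmem I hI), if_neg fun hc => hne i I hI hc.1, zero_mul]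
      have z2 : ∑ I : multiIdxEq m 2, ∑ a, iterPartial I.1 ξ x a * (ν x).2 I a = 0 :=
        Finset.sum_eq_zero fun I _ => Finset.sum_eq_zero fun b _ => by
          rw [hu I.1 (hmem I I.2), if_neg fun hc => hne i I I.2 hc.1, zero_mul]
      have z3 : ∀ q : Fin m → Fin n → ℝ,
          ∑ j, ∑ b, iterPartial (one j) ξ x b * q j b = q i a := fun q => by
        rw [Finset.sum_eq_single i, Finset.sum_eq_single a]
        · simp [hu _ (hone i)]
        · intro b _ hb; simp [hu _ (hone i), hb]
        · simp
        · intro j _ hj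
          refine Finset.sum_eq_zero fun b _ => ?_
          rw [hu _ (hone j), if_neg fun hc => hj (one_injective hc.1), zero_mul]
        · simp
      rw [z1 (fun I a => cLegI l I a (jet 2 P x)), z2, z3 fun i a => fderiv ℝ l (jet 2 P x) (dU (one i) a),
        z3 fun i a => (ν x).1 i a + ∑ j, fderiv ℝ (fun y => pijOf (ν y) i j a) x (ev j)] at h1
      linarith
    · have hJ0 : J.1 ≠ 0 := fun hc => by
        have := (Finset.mem_filter.1 J.2).2
        simp [hc] at this
      obtain ⟨ξ, hξ, h0, hu⟩ := hjet J.1 hJ0 a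
      have h1 := h ξ hξ h0
      rw [fderiv_vj_two l _ h0, sum_fderiv_flux hν hξ h0] at h1
      have z1 : ∀ q : Fin m → Fin n → ℝ,
          ∑ i, ∑ a, iterPartial (one i) ξ x a * q i a = 0 := fun q =>
        Finset.sum_eq_zero fun i _ => Finset.sum_eq_zero fun b _ => by
          rw [hu _ (hone i), if_neg fun hc => hne i J.1 J.2 hc.1.symm, zero_mul]
      have z3 : ∀ q : multiIdxEq m 2 → Fin n → ℝ,
          ∑ I, ∑ b, iterPartial I.1 ξ x b * q I b = q J a := fun q => by
        rw [Finset.sum_eq_single J, Finset.sum_eq_single a]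
        · simp [hu _ (hmem _ J.2)]
        · intro b _ hb; simp [hu _ (hmem _ J.2), hb]
        · simp
        · intro I _ hI
          refine Finset.sum_eq_zero fun b _ => ?_
          rw [hu _ (hmem _ I.2), if_neg fun hc => hI (Subtype.ext hc.1), zero_mul]
        · simp
      rw [z1 fun i a => fderiv ℝ l (jet 2 P x) (dU (one i) a),
        z1 fun i a => (ν x).1 i a + ∑ j, fderiv ℝ (fun y => pijOf (ν y) i j a) x (ev j), z3 (ν x).2,
        ← Finset.sum_coe_sort (multiIdxEq m 2)
          (fun I => ∑ a, iterPartial I ξ x a * cLegI l I a (jet 2 P x)),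
        z3 fun I a => cLegI l I.1 a (jet 2 P x)] at h1
      linarith
  · rintro ⟨h1, h2⟩ ξ hξ h0
    rw [fderiv_vj_two l _ h0, sum_fderiv_flux hν hξ h0]
    simp only [h1, h2, sub_add_cancel]
    rw [← Finset.sum_coe_sort (multiIdxEq m 2)
          (fun I => ∑ a, iterPartial I ξ x a * cLegI l I a (jet 2 P x))]

end Legendre


/-! ### Invariance of the Legendre map -/

section Invariance

open Function

variable {m n : ℕ}

theorem differentiableAt_momOf {α : BaseV m → JetV m n 1 [⋀^Fin m]→L[ℝ] ℝ} {x : BaseV m}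
    (hα : DifferentiableAt ℝ α x) : DifferentiableAt ℝ (fun y => momOf (α y)) x := by
  refine DifferentiableAt.prodMk (f₁ := fun y => (momOf (α y)).1) ?_ ?_
  · exact differentiableAt_pi.2 fun i => differentiableAt_pi.2 fun a =>
      hα.continuousAlternatingMap_apply_const _
  · refine differentiableAt_pi.2 fun I => differentiableAt_pi.2 fun a => ?_
    change DifferentiableAt ℝ (fun y => ∑ i, ∑ j, if one i + one j = I.1 then
      α y (update dX j (dU (one i) a)) else 0) x
    refine DifferentiableAt.fun_sum fun i _ => DifferentiableAt.fun_sum fun j _ => ?_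
    split_ifs
    · exact hα.continuousAlternatingMap_apply_const _
    · exact differentiableAt_const _

/-- The form `(j¹P)^* i(j¹ξ) α` on the base. -/
def contr {k : ℕ} (α : BaseV (k + 1) → JetV (k + 1) n 1 [⋀^Fin (k + 1)]→L[ℝ] ℝ)
    (P ξ : BaseV (k + 1) → FibV n) (y : BaseV (k + 1)) : BaseV (k + 1) [⋀^Fin k]→L[ℝ] ℝ :=
  ((α y).curryLeft (vj 1 ξ y)).compContinuousLinearMap (fderiv ℝ (jet 1 P) y)

theorem differentiableAt_contr {k : ℕ}
    {α : BaseV (k + 1) → JetV (k + 1) n 1 [⋀^Fin (k + 1)]→L[ℝ] ℝ}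
    {P ξ : BaseV (k + 1) → FibV n} {x : BaseV (k + 1)} (hα : DifferentiableAt ℝ α x)
    (hP : SmoothNear P x) (hξ : SmoothNear ξ x) : DifferentiableAt ℝ (contr α P ξ) x := by
  have h0 : Differentiable ℝ (fun β : JetV (k + 1) n 1 [⋀^Fin (k + 1)]→L[ℝ] ℝ => β.curryLeft) :=
    (ContinuousAlternatingMap.curryLeftLI (𝕜 := ℝ) (E := JetV (k + 1) n 1) (F := ℝ)
      (n := k)).toContinuousLinearMap.differentiable
  have h1 : DifferentiableAt ℝ (fun y => (α y).curryLeft) x :=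
    DifferentiableAt.comp (g := fun β : JetV (k + 1) n 1 [⋀^Fin (k + 1)]→L[ℝ] ℝ => β.curryLeft)
      x (h0 (α x)) hα
  exact (h1.clm_apply (hξ.vj 1).differentiableAt).continuousAlternatingMapCompContinuousLinearMap
    (hP.jet 1).fderiv.differentiableAt

theorem IsSymMom.flux_momOf {α : JetV m n 1 [⋀^Fin m]→L[ℝ] ℝ} (hα : IsSymMom α) (v : JetV m n 2)
    (i : Fin m) {V : JetV m n 1} (hV : V.1 = 0) :
    flux (momOf α) V i = α (update (fun l => tot v (ev l)) i V) := by
  conv_rhs => rw [hα.eq_momForm, momForm_update_tot _ v i hV]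

/-- The coordinate-free form of the divergence. The `i`-th flux component is, up to the sign of
moving `j¹ξ` from the `i`-th place to the front, the value of `contr` on the coordinate vectors
without the `i`-th; the alternating signs of the exterior derivative undo this sign. -/
theorem sum_fderiv_flux_eq_extDeriv {k : ℕ}
    {α : BaseV (k + 1) → JetV (k + 1) n 1 [⋀^Fin (k + 1)]→L[ℝ] ℝ}
    {P ξ : BaseV (k + 1) → FibV n} {x : BaseV (k + 1)} (hα : DifferentiableAt ℝ α x)
    (hsym : ∀ᶠ y in 𝓝 x, IsSymMom (α y)) (hP : SmoothNear P x) (hξ : SmoothNear ξ x) :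
    ∑ i, fderiv ℝ (fun y => flux (momOf (α y)) (vj 1 ξ y) i) x (ev i) =
      extDeriv (contr α P ξ) x ev := by
  rw [extDeriv_apply (differentiableAt_contr hα hP hξ)]
  refine Finset.sum_congr rfl fun i _ => ?_
  have e : (fun y => flux (momOf (α y)) (vj 1 ξ y) i) =ᶠ[𝓝 x]
      fun y => (-1 : ℝ) ^ (i : ℕ) * contr α P ξ y (i.removeNth ev) := by
    filter_upwards [hsym, hP.eventually] with y hy hy'
    rw [hy.flux_momOf (jet 2 P y) i rfl]
    have h1 := (α y).toAlternatingMap.map_insertNth i (vj 1 ξ y)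
      (i.removeNth fun l => tot (jet 2 P y) (ev l))
    rw [Fin.insertNth_removeNth] at h1
    simp only [ContinuousAlternatingMap.coe_toAlternatingMap] at h1
    rw [h1, contr, fderiv_jet hy' 1, zsmul_eq_mul]
    push_cast
    rfl
  have hd : DifferentiableAt ℝ (fun y => contr α P ξ y (i.removeNth ev)) x :=
    (differentiableAt_contr hα hP hξ).continuousAlternatingMap_apply_const _
  rw [e.fderiv_eq, fderiv_const_mul hd, zsmul_eq_mul]
  push_cast
  rfl

/-! ### Naturality of the first variation formula -/

namespace Transition

variable (T : Transition m n)

/-- The Jacobian determinant. -/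
def jac (x : BaseV m) : ℝ := vol m fun i => fderiv ℝ T.f x (ev i)

/-- The pull-back of a family of forms along a section. -/
def pullForm (P : BaseV m → FibV n) (α : BaseV m → JetV m n 1 [⋀^Fin m]→L[ℝ] ℝ) (y : BaseV m) :
    JetV m n 1 [⋀^Fin m]→L[ℝ] ℝ :=
  (α (T.f y)).compContinuousLinearMap (fderiv ℝ (T.F 1) (jet 1 P y))

theorem differentiableAt_pullForm {P : BaseV m → FibV n} {x : BaseV m} (hP : SmoothNear P x)
    (hx : (x, P x) ∈ T.O) {α : BaseV m → JetV m n 1 [⋀^Fin m]→L[ℝ] ℝ}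
    (hα : DifferentiableAt ℝ α (T.f x)) : DifferentiableAt ℝ (T.pullForm P α) x := by
  have hf := (T.smoothNear_f (T.fst_mem _ hx)).differentiableAt
  have hF : SmoothNear (fderiv ℝ (T.F 1)) (jet 1 P x) :=
    (T.smoothNear_F (T.jet_mem_dom hx)).fderiv
  exact (hα.comp x hf).continuousAlternatingMapCompContinuousLinearMap
    (hF.comp (hP.jet 1)).differentiableAt

theorem eventually_isSymMom_pullForm {P : BaseV m → FibV n} {x : BaseV m} (hP : SmoothNear P x)
    (hx : (x, P x) ∈ T.O) {α : BaseV m → JetV m n 1 [⋀^Fin m]→L[ℝ] ℝ}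
    (hα : ∀ᶠ y in 𝓝 (T.f x), IsSymMom (α y)) : ∀ᶠ y in 𝓝 x, IsSymMom (T.pullForm P α y) := by
  have hf := (T.smoothNear_f (T.fst_mem _ hx)).continuousAt
  filter_upwards [hf.eventually hα, T.eventually_mem hP hx] with y hy hy'
  exact T.isSymMom_comp (T.jet_mem_dom hy'.2) hy

/-- The exterior derivative commutes with the pull-back by the base map `f`. As the derivative is a
form of top degree, the pull-back multiplies its coefficient by the Jacobian determinant. -/
theorem sum_fderiv_flux_pullForm {P ξ : BaseV m → FibV n} {x : BaseV m} (hP : SmoothNear P x)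
    (hξ : SmoothNear ξ x) (hx : (x, P x) ∈ T.O) {α : BaseV m → JetV m n 1 [⋀^Fin m]→L[ℝ] ℝ}
    (hα : DifferentiableAt ℝ α (T.f x)) (hsym : ∀ᶠ y in 𝓝 (T.f x), IsSymMom (α y)) :
    ∑ i, fderiv ℝ (fun y => flux (momOf (T.pullForm P α y)) (vj 1 ξ y) i) x (ev i) =
      (∑ i, fderiv ℝ (fun y => flux (momOf (α y)) (vj 1 (T.varSec P ξ) y) i) (T.f x) (ev i)) *
        T.jac x := by
  -- The contraction has degree `m - 1`; over a base of dimension `0` both sums are empty.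
  cases m with
  | zero => simp
  | succ k =>
    rw [sum_fderiv_flux_eq_extDeriv (T.differentiableAt_pullForm hP hx hα)
      (T.eventually_isSymMom_pullForm hP hx hsym) hP hξ,
      sum_fderiv_flux_eq_extDeriv hα hsym (T.smoothNear_sec hP hx) (T.smoothNear_varSec hP hξ hx)]
    have e : contr (T.pullForm P α) P ξ =ᶠ[𝓝 x] fun y =>
        (contr α (T.sec P) (T.varSec P ξ) (T.f y)).compContinuousLinearMap (fderiv ℝ T.f y) := by
      filter_upwards [T.eventually_mem hP hx, hξ.eventually] with y hy hy'
      rw [contr, pullForm, ContinuousAlternatingMap.curryLeft_compContinuousLinearMap,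
        T.fderiv_F_vj 1 hy.1 hy' hy.2]
      have := T.fderiv_F_comp_tot 1 hy.1 hy.2
      ext w
      change ((α (T.f y)).curryLeft _) (fun i => ((fderiv ℝ (T.F 1) (jet 1 P y)).comp
        (fderiv ℝ (jet 1 P) y)) (w i)) = _
      rw [this]
      rfl
    rw [e.extDeriv_eq, extDeriv_pullback (r := ∞)
      (differentiableAt_contr hα (T.smoothNear_sec hP hx) (T.smoothNear_varSec hP hξ hx))
      (T.smoothNear_f (T.fst_mem _ hx)).contDiffAt
      (by simpa using WithTop.coe_le_coe.2 (le_top : (2 : ℕ∞) ≤ ⊤))]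
    rw [ContinuousAlternatingMap.compContinuousLinearMap_apply, top_form_apply]
    rfl

/-- The Lagrangian function and the divergence both acquire the factor `jac`, and the transform of a
variation vanishing at `x` vanishes at `f x`. Hence the formula in one chart yields the formula in
the other. -/
theorem varEq_pullForm {P : BaseV m → FibV n} {x : BaseV m} (hP : SmoothNear P x)
    (hx : (x, P x) ∈ T.O) {l l' : JetV m n 2 → ℝ}
    (hl' : DifferentiableAt ℝ l' (jet 2 (T.sec P) (T.f x)))
    (hl : l =ᶠ[𝓝 (jet 2 P x)] fun v => l' (T.F 2 v) * T.jac v.1)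
    {α : BaseV m → JetV m n 1 [⋀^Fin m]→L[ℝ] ℝ}
    (hα : DifferentiableAt ℝ α (T.f x)) (hsym : ∀ᶠ y in 𝓝 (T.f x), IsSymMom (α y))
    (h : VarEq l' (T.sec P) (fun y => momOf (α y)) (T.f x)) :
    VarEq l P (fun y => momOf (T.pullForm P α y)) x := by
  intro ξ hξ h0
  have hxs : x ∈ T.f.source := T.fst_mem _ hx
  rw [T.sum_fderiv_flux_pullForm hP hξ hx hα hsym, ← h (T.varSec P ξ) (T.smoothNear_varSec hP hξ hx)
    (T.varSec_apply_of_eq_zero hxs h0), hl.fderiv_eq]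
  rw [T.jet_sec 2 hP hx] at hl' ⊢
  have h1 := hl'.hasFDerivAt.comp _
    (T.smoothNear_F (T.jet_mem_dom (k := 2) hx)).differentiableAt.hasFDerivAt
  have hjac : DifferentiableAt ℝ T.jac x := by
    have h2 : DifferentiableAt ℝ (fun y => ((vol m).compContinuousLinearMap (fderiv ℝ T.f y))) x :=
      (differentiableAt_const _).continuousAlternatingMapCompContinuousLinearMap
        (T.smoothNear_f hxs).fderiv.differentiableAt
    exact h2.continuousAlternatingMap_apply_const ev
  have h2 : HasFDerivAt (fun v : JetV m n 2 => T.jac v.1)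
      ((fderiv ℝ T.jac x).comp (ContinuousLinearMap.fst ℝ _ _)) (jet 2 P x) :=
    HasFDerivAt.comp (g := T.jac) (jet 2 P x) hjac.hasFDerivAt hasFDerivAt_fst
  have h3 := (h1.fun_mul h2).fderiv
  have e : fderiv ℝ (fun v => l' (T.F 2 v) * T.jac v.1) (jet 2 P x) = _ := h3
  rw [e]
  simp only [add_apply, smul_apply, ContinuousLinearMap.comp_apply, T.fderiv_F_vj 2 hP hξ hx,
    smul_eq_mul]
  -- The Jacobian depends on the base point only, and `vj 2 ξ x` has no base component, so the
  -- derivative of the Jacobian does not contribute.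
  have e0 : ContinuousLinearMap.fst ℝ (BaseV m) (multiIdx m 2 → FibV n) (vj 2 ξ x) = 0 := rfl
  rw [e0, map_zero, mul_zero, zero_add, mul_comm]
  rfl

end Transition

theorem contDiffAt_cLegI {l : JetV m n 2 → ℝ} {v : JetV m n 2} (hl : SmoothNear l v)
    (I : Fin m → ℕ) (a : Fin n) : SmoothNear (cLegI l I a) v := hl.fderiv_apply _

theorem totalDeriv_eq {k : ℕ} (j : Fin m) (G : JetV m n k → ℝ) (v : JetV m n (k + 1)) :
    totalDeriv j G v = fderiv ℝ G (v.trunc k) (tot v (ev j)) := by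
  rw [totalDeriv, ev, tot_single]

theorem SmoothNear.totalDeriv {k : ℕ} {G : JetV m n k → ℝ} {v : JetV m n (k + 1)}
    (h : SmoothNear G (v.trunc k)) (j : Fin m) : SmoothNear (totalDeriv j G) v := by
  have e : SecondOrderField.totalDeriv j G = fun v => _root_.fderiv ℝ G (v.trunc k) (tot v (ev j)) :=
    funext fun v => totalDeriv_eq j G v
  rw [e]
  refine SmoothNear.clm_apply (A := fun v : JetV m n (k + 1) => _root_.fderiv ℝ G (v.trunc k)) ?_ ?_
  · simp only [← truncL_apply] at h ⊢
    exact SmoothNear.comp (g := _root_.fderiv ℝ G) h.fderiv ((truncL m n (k + 1) k).smoothNear v)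
  · exact SmoothNear.comp (g := fun z : JetV m n (k + 1) × BaseV m => tot z.1 z.2)
      (f := fun v => (v, ev j)) ((contDiff_tot k).smoothNear _)
      (smoothNear_id.prodMk smoothNear_const)

theorem smoothNear_pi {ι V : Type*} [Fintype ι] [NormedAddCommGroup V] [NormedSpace ℝ V]
    {W : ι → Type*} [∀ i, NormedAddCommGroup (W i)] [∀ i, NormedSpace ℝ (W i)]
    {f : V → ∀ i, W i} {x : V} (h : ∀ i, SmoothNear (fun y => f y i) x) : SmoothNear f x := by
  filter_upwards [Filter.eventually_all.2 h] with y hy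
  exact contDiffAt_pi.2 hy

theorem SmoothNear.trunc {W : Type*} [NormedAddCommGroup W] [NormedSpace ℝ W] {k r : ℕ}
    {G : JetV m n r → W} {v : JetV m n k} (h : SmoothNear G (v.trunc r)) :
    SmoothNear (fun v : JetV m n k => G (v.trunc r)) v := by
  simp only [← truncL_apply] at h ⊢
  exact h.comp ((truncL m n k r).smoothNear v)

theorem SmoothNear.cLeg {l : JetV m n 2 → ℝ} {v : JetV m n 3} (hl : SmoothNear l (v.trunc 2)) :
    SmoothNear (cLeg l) v := by
  refine SmoothNear.prodMk (smoothNear_pi fun i => smoothNear_pi fun a => ?_)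
    (smoothNear_pi fun I => smoothNear_pi fun a => ?_)
  · have h1 : SmoothNear (fun v : JetV m n 3 => _root_.fderiv ℝ l (v.trunc 2) (dU (one i) a)) v :=
      SmoothNear.trunc (G := fun v => _root_.fderiv ℝ l v (dU (one i) a)) (hl.fderiv_apply _)
    have h2 : ∀ j, SmoothNear (SecondOrderField.totalDeriv j (cLegI l (one i + one j) a)) v :=
      fun j => SmoothNear.totalDeriv (contDiffAt_cLegI hl _ _) j
    filter_upwards [h1, Filter.eventually_all.2 h2] with w hw hw'
    exact hw.sub (ContDiffAt.sum fun j _ => contDiffAt_const.mul (hw' j))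
  · exact SmoothNear.trunc (contDiffAt_cLegI hl _ _)

/-- The formula for `p_α^i` contains base derivatives of `p_α^{ij}`. They become total derivatives
of `∂l/∂u_I` once the second-order momenta are known along the section near `x`, and not only at
`x`; this is the role of `hI`. -/
theorem varEq_iff_cLeg {l : JetV m n 2 → ℝ} {P : BaseV m → FibV n} {ν : BaseV m → MomV m n}
    {x : BaseV m} (hP : SmoothNear P x) (hl : SmoothNear l (jet 2 P x))
    (hν : DifferentiableAt ℝ ν x)
    (hI : ∀ᶠ y in 𝓝 x, ∀ (I : multiIdxEq m 2) a, (ν y).2 I a = cLegI l I.1 a (jet 2 P y)) :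
    VarEq l P ν x ↔ ν x = cLeg l (jet 3 P x) := by
  have hpij : ∀ i j a, fderiv ℝ (fun y => pijOf (ν y) i j a) x (ev j) =
      1 / nn i j * totalDeriv j (cLegI l (one i + one j) a) (jet 3 P x) := fun i j a => by
    have e : (fun y => pijOf (ν y) i j a) =ᶠ[𝓝 x]
        fun y => 1 / nn i j * cLegI l (one i + one j) a (jet 2 P y) := by
      filter_upwards [hI] with y hy
      rw [pijOf, hy]
      ring
    have hd := HasFDerivAt.comp x
      (contDiffAt_cLegI hl (one i + one j) a).differentiableAt.hasFDerivAt (hasFDerivAt_jet hP 2)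
    have := (hd.const_mul (1 / nn i j)).fderiv
    rw [e.fderiv_eq]
    change fderiv ℝ (fun y => 1 / nn i j * (cLegI l (one i + one j) a ∘ jet 2 P) y) x _ = _
    rw [this, totalDeriv_eq, trunc_jet (by norm_num)]
    rfl
  rw [varEq_iff hν]
  simp only [hpij]
  constructor
  · rintro ⟨h1, h2⟩
    refine Prod.ext (funext fun i => funext fun a => ?_) (funext fun I => funext fun a => ?_)
    · simp only [cLeg, cLegi, trunc_jet (show 2 ≤ 3 by norm_num)]
      exact h1 i a
    · simp only [cLeg, trunc_jet (show 2 ≤ 3 by norm_num)]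
      exact h2 I a
  · intro h
    refine ⟨fun i a => ?_, fun I a => ?_⟩
    · rw [h]
      simp only [cLeg, cLegi, trunc_jet (show 2 ≤ 3 by norm_num)]
    · rw [h]
      simp only [cLeg, trunc_jet (show 2 ≤ 3 by norm_num)]

/-- The Legendre map is compatible with changes of adapted coordinates. -/
theorem Transition.momOf_comp_cLeg (T : Transition m n) {l l' : JetV m n 2 → ℝ} {v : JetV m n 3}
    (hv : v ∈ T.dom 3) (hl : SmoothNear l (v.trunc 2)) (hl' : SmoothNear l' (T.F 2 (v.trunc 2)))
    (hll : l =ᶠ[𝓝 (v.trunc 2)] fun v => l' (T.F 2 v) * T.jac v.1) (p : ℝ) :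
    momOf ((momForm m n (p, cLeg l' (T.F 3 v))).compContinuousLinearMap
      (fderiv ℝ (T.F 1) (v.trunc 1))) = cLeg l v := by
  obtain ⟨P, hPs, hP⟩ := exists_jet_eq v
  set x := v.1 with hxdef
  have hPx := hPs.smoothNear x
  have hx : (x, P x) ∈ T.O := by
    have := hv
    rw [← hP] at this
    change (x, (jet 3 P x).u 0) ∈ T.O at this
    rwa [jet_u_zero] at this
  have hxs : x ∈ T.f.source := T.fst_mem _ hx
  rw [← hP, trunc_jet (by norm_num)] at hl hl' hll ⊢
  rw [← T.jet_sec 2 hPx hx] at hl'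
  rw [← T.jet_sec 3 hPx hx]
  set P' := T.sec P with hP'
  have hP's : SmoothNear P' (T.f x) := T.smoothNear_sec hPx hx
  -- The Legendre momenta of `l'` along the transformed section, as a family of forms. The
  -- coordinate `p` is kept constant, since it has no influence on momenta or fluxes.
  let α : BaseV m → JetV m n 1 [⋀^Fin m]→L[ℝ] ℝ := fun y => momForm m n (p, cLeg l' (jet 3 P' y))
  have hαs : ∀ y, IsSymMom (α y) := fun y => isSymMom_momForm _
  have hαm : ∀ y, momOf (α y) = cLeg l' (jet 3 P' y) := fun y => momOf_momForm _
  have hev' : ∀ᶠ y in 𝓝 (T.f x), SmoothNear P' y ∧ SmoothNear l' (jet 2 P' y) :=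
    hP's.eventually.and ((hP's.jet 2).continuousAt.eventually hl'.eventually)
  have hαd : ∀ᶠ y in 𝓝 (T.f x), DifferentiableAt ℝ α y ∧
      VarEq l' P' (fun y => momOf (α y)) y := by
    filter_upwards [hev'] with y hy
    have hs : SmoothNear (fun y => cLeg l' (jet 3 P' y)) y := by
      refine SmoothNear.comp (g := cLeg l') (SmoothNear.cLeg ?_) (hy.1.jet 3)
      rw [trunc_jet (by norm_num)]
      exact hy.2
    refine ⟨(momForm m n).differentiableAt.comp y
      ((differentiableAt_const p).prodMk hs.differentiableAt), ?_⟩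
    simp only [hαm]
    refine (varEq_iff_cLeg hy.1 hy.2 hs.differentiableAt (Filter.Eventually.of_forall fun z I a => ?_)).2 rfl
    simp only [cLeg, trunc_jet (show 2 ≤ 3 by norm_num)]
  have hf := (T.smoothNear_f hxs).continuousAt
  -- The variation formula is transported at all points near `x`: this gives the second-order
  -- momenta near `x`, as needed for the first-order ones at `x`.
  have hev : ∀ᶠ y in 𝓝 x, VarEq l P (fun y => momOf (T.pullForm P α y)) y ∧
      DifferentiableAt ℝ (fun y => momOf (T.pullForm P α y)) y := by
    filter_upwards [T.eventually_mem hPx hx, hf.eventually hαd, hf.eventually hev',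
      (hPx.jet 2).continuousAt.eventually hll.eventually_nhds] with y h1 h2 h3 h4
    exact ⟨T.varEq_pullForm h1.1 h1.2 h3.2.differentiableAt h4 h2.1
      (Filter.Eventually.of_forall hαs) h2.2,
      differentiableAt_momOf (T.differentiableAt_pullForm h1.1 h1.2 h2.1)⟩
  have hI : ∀ᶠ y in 𝓝 x, ∀ (I : multiIdxEq m 2) a,
      (momOf (T.pullForm P α y)).2 I a = cLegI l I.1 a (jet 2 P y) := by
    filter_upwards [hev] with y hy
    exact ((varEq_iff hy.2).1 hy.1).2
  exact (varEq_iff_cLeg hPx hl hev.self_of_nhds.2 hI).1 hev.self_of_nhds.1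

end Invariance


/-! ### Jets in adapted charts -/

section JetCharts

open Function

variable {m n : ℕ} {M : Type*} [TopologicalSpace M] [ChartedSpace (BaseV m) M]
  {E : Type*} [TopologicalSpace E] [ChartedSpace (BaseV m × FibV n) E] {π : E → M}

namespace IsLocSec

variable {φ : M → E} {x : M}

theorem eventually_isLocSec (h : IsLocSec m n π φ x) : ∀ᶠ y in 𝓝 x, IsLocSec m n π φ y :=
  eventually_eventually_nhds.2 h

theorem contMDiffAt (h : IsLocSec m n π φ x) :
    ContMDiffAt (𝓡 m) 𝓘(ℝ, BaseV m × FibV n) ∞ φ x := h.self_of_nhds.1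

theorem eventually_mem (h : IsLocSec m n π φ x) {s : Set E} (hs : IsOpen s) (hx : φ x ∈ s) :
    ∀ᶠ y in 𝓝 x, φ y ∈ s :=
  h.contMDiffAt.continuousAt.eventually (hs.mem_nhds hx)

theorem mem_source (h : IsLocSec m n π φ x) {c : AdaptedChart m n π} (hx : φ x ∈ c.e.source) :
    x ∈ c.b.source := by
  have := c.maps _ hx
  rwa [h.self_of_nhds.2] at this

end IsLocSec

namespace AdaptedChart

variable (c c' : AdaptedChart m n π)

theorem contMDiffAt_e {p : E} (hp : p ∈ c.e.source) :
    ContMDiffAt 𝓘(ℝ, BaseV m × FibV n) 𝓘(ℝ, BaseV m × FibV n) ∞ c.e p :=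
  contMDiffAt_of_mem_maximalAtlas c.e_mem hp

theorem contMDiffAt_e_symm {z : BaseV m × FibV n} (hz : z ∈ c.e.target) :
    ContMDiffAt 𝓘(ℝ, BaseV m × FibV n) 𝓘(ℝ, BaseV m × FibV n) ∞ c.e.symm z :=
  contMDiffAt_symm_of_mem_maximalAtlas c.e_mem hz

theorem contMDiffAt_b {x : M} (hx : x ∈ c.b.source) : ContMDiffAt (𝓡 m) (𝓡 m) ∞ c.b x :=
  contMDiffAt_of_mem_maximalAtlas c.b_mem hx

theorem contMDiffAt_b_symm {x : BaseV m} (hx : x ∈ c.b.target) :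
    ContMDiffAt (𝓡 m) (𝓡 m) ∞ c.b.symm x :=
  contMDiffAt_symm_of_mem_maximalAtlas c.b_mem hx

theorem e_eq {p : E} (hp : p ∈ c.e.source) : c.e p = (c.b (π p), (c.e p).2) :=
  Prod.ext (c.fst_eq p hp) rfl

theorem fst_mem_target {z : BaseV m × FibV n} (hz : z ∈ c.e.target) : z.1 ∈ c.b.target := by
  have h := c.e.map_target hz
  rw [← c.e.right_inv hz, c.fst_eq _ h]
  exact c.b.map_source (c.maps _ h)

theorem symm_fst {z : BaseV m × FibV n} (hz : z ∈ c.e.target) :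
    c.b.symm z.1 = π (c.e.symm z) := by
  have h := c.e.map_target hz
  conv_lhs => rw [← c.e.right_inv hz, c.fst_eq _ h]
  exact c.b.left_inv (c.maps _ h)

theorem eventually_symm {x : M} (hx : x ∈ c.b.source) {p : M → Prop} (h : ∀ᶠ y in 𝓝 x, p y) :
    ∀ᶠ z in 𝓝 (c.b x), z ∈ c.b.target ∧ p (c.b.symm z) := by
  refine Filter.Eventually.and (c.b.open_target.mem_nhds (c.b.map_source hx)) ?_
  have := c.b.continuousAt_symm (c.b.map_source hx)
  rw [ContinuousAt, c.b.left_inv hx] at this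
  exact this.eventually h

/-- The change of coordinates between adapted charts. -/
def transition : Transition m n where
  f := c.b.symm ≫ₕ c'.b
  g := fun z => (c'.e (c.e.symm z)).2
  O := (c.e.symm ≫ₕ c'.e).source
  smooth_f := by
    refine contMDiffOn_iff_contDiffOn.1 fun x hx => ContMDiffAt.contMDiffWithinAt ?_
    rw [OpenPartialHomeomorph.trans_source] at hx
    exact (c'.contMDiffAt_b hx.2).comp x (c.contMDiffAt_b_symm hx.1)
  smooth_symm := by
    refine contMDiffOn_iff_contDiffOn.1 fun x hx => ContMDiffAt.contMDiffWithinAt ?_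
    rw [OpenPartialHomeomorph.trans_target] at hx
    exact (c.contMDiffAt_b hx.2).comp x (c'.contMDiffAt_b_symm hx.1)
  isOpen_O := (c.e.symm ≫ₕ c'.e).open_source
  fst_mem := fun z hz => by
    rw [OpenPartialHomeomorph.trans_source] at hz ⊢
    refine ⟨c.fst_mem_target hz.1, ?_⟩
    change c.b.symm z.1 ∈ c'.b.source
    rw [c.symm_fst hz.1]
    exact c'.maps _ hz.2
  smooth_g := by
    refine contMDiffOn_iff_contDiffOn.1 fun z hz => ContMDiffAt.contMDiffWithinAt ?_
    rw [OpenPartialHomeomorph.trans_source] at hz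
    have h1 := (c'.contMDiffAt_e hz.2).comp z (c.contMDiffAt_e_symm hz.1)
    exact (contMDiffAt_iff_contDiffAt.1 h1).snd.contMDiffAt

theorem mem_transition_O {z : BaseV m × FibV n} :
    z ∈ (c.transition c').O ↔ z ∈ c.e.target ∧ c.e.symm z ∈ c'.e.source := by
  change z ∈ (c.e.symm ≫ₕ c'.e).source ↔ _
  rw [OpenPartialHomeomorph.trans_source]
  rfl

theorem comps_apply {φ : M → E} {y : M} (h : IsLocSec m n π φ y) (hy : φ y ∈ c.e.source) :
    (c.b y, comps c φ (c.b y)) = c.e (φ y) := by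
  rw [comps, c.b.left_inv (h.mem_source hy), c.e_eq hy, h.self_of_nhds.2]

theorem smoothNear_comps {φ : M → E} {x : M} (h : IsLocSec m n π φ x) (hx : φ x ∈ c.e.source) :
    SmoothNear (comps c φ) (c.b x) := by
  have h1 := c.eventually_symm (h.mem_source hx)
    (h.eventually_isLocSec.and (h.eventually_mem c.e.open_source hx))
  filter_upwards [h1] with z hz
  have h2 := (c.contMDiffAt_e hz.2.2).comp (c.b.symm z) hz.2.1.contMDiffAt
  have h3 := ContMDiffAt.comp z h2 (c.contMDiffAt_b_symm hz.1)
  exact (contMDiffAt_iff_contDiffAt.1 h3).snd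

theorem mem_O_of_isLocSec {φ : M → E} {x : M} (h : IsLocSec m n π φ x) (hx : φ x ∈ c.e.source)
    (hx' : φ x ∈ c'.e.source) : (c.b x, comps c φ (c.b x)) ∈ (c.transition c').O := by
  rw [c.comps_apply h hx, mem_transition_O, c.e.left_inv hx]
  exact ⟨c.e.map_source hx, hx'⟩

theorem transition_f_apply {x : M} (hx : x ∈ c.b.source) : (c.transition c').f (c.b x) = c'.b x := by
  change c'.b (c.b.symm (c.b x)) = _
  rw [c.b.left_inv hx]

theorem comps_transition {φ : M → E} {x : M} (h : IsLocSec m n π φ x) (hx : φ x ∈ c.e.source)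
    (hx' : φ x ∈ c'.e.source) :
    comps c' φ =ᶠ[𝓝 (c'.b x)] (c.transition c').sec (comps c φ) := by
  have h1 := c'.eventually_symm (h.mem_source hx')
    (h.eventually_isLocSec.and ((h.eventually_mem c.e.open_source hx).and
      (h.eventually_mem c'.e.open_source hx')))
  filter_upwards [h1] with z ⟨hz, hs, hc, hc'⟩
  change _ = (c'.e (c.e.symm (c.b (c'.b.symm z), comps c φ (c.b (c'.b.symm z))))).2
  rw [c.comps_apply hs hc, c.e.left_inv hc]
  rfl

theorem exists_locSec {P : BaseV m → FibV n} (hP : ContDiff ℝ ∞ P) {x : BaseV m}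
    (hx : (x, P x) ∈ c.e.target) : ∃ s : LocSec m n π, s.toFun s.pt = c.e.symm (x, P x) ∧
      c.b s.pt = x ∧ s.toFun s.pt ∈ c.e.source ∧ comps c s.toFun =ᶠ[𝓝 x] P := by
  have hxt := c.fst_mem_target hx
  set φ : M → E := fun y => c.e.symm (c.b y, P (c.b y)) with hφ
  have hbx : c.b (c.b.symm x) = x := c.b.right_inv hxt
  have hxs : c.b.symm x ∈ c.b.source := c.b.map_target hxt
  have hPc : ContMDiff (𝓡 m) 𝓘(ℝ, BaseV m × FibV n) ∞ fun z => (z, P z) :=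
    (contDiff_id.prodMk hP).contMDiff
  have hmem : ∀ᶠ z in 𝓝 x, (z, P z) ∈ c.e.target :=
    (continuous_id.prodMk hP.continuous).continuousAt.eventually (c.e.open_target.mem_nhds hx)
  have hev : ∀ᶠ y in 𝓝 (c.b.symm x), y ∈ c.b.source ∧ (c.b y, P (c.b y)) ∈ c.e.target := by
    refine Filter.Eventually.and (c.b.open_source.mem_nhds hxs) ?_
    have := c.b.continuousAt hxs
    rw [ContinuousAt, hbx] at this
    exact this.eventually hmem
  have hs : IsLocSec m n π φ (c.b.symm x) := by
    filter_upwards [hev] with y hy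
    refine ⟨?_, ?_⟩
    · exact ContMDiffAt.comp (g := c.e.symm) y (c.contMDiffAt_e_symm hy.2)
        (hPc.contMDiffAt.comp y (c.contMDiffAt_b hy.1))
    · rw [hφ, ← c.symm_fst hy.2]
      exact c.b.left_inv hy.1
  refine ⟨⟨c.b.symm x, φ, hs⟩, ?_, hbx, ?_, ?_⟩
  · simp only [hφ, hbx]
  · simp only [hφ, hbx]
    exact c.e.map_target hx
  · filter_upwards [hmem, c.b.open_target.mem_nhds hxt] with z hz hz'
    simp only [comps, hφ, c.b.right_inv hz', c.e.right_inv hz]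

end AdaptedChart

/-! ### Natural coordinates of jets -/

namespace Jet

variable {k : ℕ} {c c' c'' : AdaptedChart m n π}

theorem exists_mk_eq (j : Jet m n π k) : ∃ s : LocSec m n π, mk k s = j := Quotient.exists_rep j

theorem coord_mk {s : LocSec m n π} (hs : s.toFun s.pt ∈ c.e.source) :
    coord c (mk k s) = jet k (comps c s.toFun) (c.b s.pt) :=
  Prod.ext rfl (funext fun _ => if_pos hs)

theorem coord_eval {j : Jet m n π k} (hj : j.eval ∈ c.e.source) :
    ((coord c j).1, (coord c j).u 0) = c.e j.eval := by
  obtain ⟨s, rfl⟩ := exists_mk_eq j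
  rw [coord_mk hj, jet_u_zero]
  exact c.comps_apply s.isLocSec hj

theorem coord_trunc {r : ℕ} (hr : r ≤ k) {j : Jet m n π k} (hj : j.eval ∈ c.e.source) :
    coord c (j.proj r hr) = (coord c j).trunc r := by
  obtain ⟨s, rfl⟩ := exists_mk_eq j
  rw [coord_mk hj, trunc_jet hr]
  exact coord_mk hj

theorem eval_proj {r : ℕ} (hr : r ≤ k) (j : Jet m n π k) : (j.proj r hr).eval = j.eval := by
  obtain ⟨s, rfl⟩ := exists_mk_eq j
  rfl

theorem coord_mem_dom {j : Jet m n π k} (hj : j.eval ∈ c.e.source) (hj' : j.eval ∈ c'.e.source) :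
    coord c j ∈ (c.transition c').dom k := by
  change ((coord c j).1, (coord c j).u 0) ∈ (c.transition c').O
  rw [coord_eval hj, AdaptedChart.mem_transition_O, c.e.left_inv hj]
  exact ⟨c.e.map_source hj, hj'⟩

theorem coord_transition {j : Jet m n π k} (hj : j.eval ∈ c.e.source)
    (hj' : j.eval ∈ c'.e.source) : coord c' j = (c.transition c').F k (coord c j) := by
  obtain ⟨s, rfl⟩ := exists_mk_eq j
  have hs := s.isLocSec
  rw [coord_mk hj, coord_mk hj', jet_congr (c.comps_transition c' hs hj hj'),
    ← Transition.jet_sec _ _ (c.smoothNear_comps hs hj) (c.mem_O_of_isLocSec c' hs hj hj'),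
    c.transition_f_apply _ (hs.mem_source hj)]

/-- Coordinates in one chart determine those in every other chart through the induced map `F`, so
agreement in a single chart already gives the agreement in all charts that defines equality of jets.
-/
theorem ext_coord {j j' : Jet m n π k} (hj : j.eval ∈ c.e.source) (hj' : j'.eval ∈ c.e.source)
    (h : coord c j = coord c j') : j = j' := by
  have he : j.eval = j'.eval := c.e.injOn hj hj' (by rw [← coord_eval hj, ← coord_eval hj', h])
  have hc : ∀ d : AdaptedChart m n π, j.eval ∈ d.e.source → coord d j = coord d j' := fun d hd => by
    rw [coord_transition hj hd, coord_transition hj' (he ▸ hd), h]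
  obtain ⟨s, rfl⟩ := exists_mk_eq j
  obtain ⟨t, rfl⟩ := exists_mk_eq j'
  have he' : s.toFun s.pt = t.toFun t.pt := he
  refine Quotient.sound ⟨?_, he, fun d hd I hI => ?_⟩
  · rw [← s.isLocSec.self_of_nhds.2, ← t.isLocSec.self_of_nhds.2, he']
  · have := congrArg (fun v => v.u I) (hc d hd)
    rw [coord_mk hd, coord_mk (he' ▸ hd)] at this
    simpa only [jet_u _ _ hI] using this

theorem exists_coord_eq {v : JetV m n k} (hv : (v.1, v.u 0) ∈ c.e.target) :
    ∃ j : Jet m n π k, j.eval = c.e.symm (v.1, v.u 0) ∧ j.eval ∈ c.e.source ∧ coord c j = v := by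
  obtain ⟨P, hP, hPv⟩ := exists_jet_eq v
  have h0 : P v.1 = v.u 0 := by rw [← jet_u_zero k P v.1, hPv]
  rw [← h0] at hv ⊢
  obtain ⟨s, h1, h2, h3, h4⟩ := c.exists_locSec hP hv
  refine ⟨mk k s, h1, h3, ?_⟩
  rw [coord_mk h3, h2, jet_congr h4, hPv]

end Jet

/-- The set of jet coordinates over an adapted chart. -/
def jetTarget (k : ℕ) (c : AdaptedChart m n π) : Set (JetV m n k) := {v | (v.1, v.u 0) ∈ c.e.target}

theorem isOpen_jetTarget (k : ℕ) (c : AdaptedChart m n π) : IsOpen (jetTarget k c) := by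
  simp only [jetTarget, ← uL_apply]
  exact c.e.open_target.preimage (by fun_prop)

theorem mem_jetTarget {k : ℕ} {c : AdaptedChart m n π} {j : Jet m n π k}
    (hj : j.eval ∈ c.e.source) : Jet.coord c j ∈ jetTarget k c := by
  change ((Jet.coord c j).1, (Jet.coord c j).u 0) ∈ c.e.target
  rw [Jet.coord_eval hj]
  exact c.e.map_source hj

theorem trunc_mem_jetTarget {k r : ℕ} {c : AdaptedChart m n π} {v : JetV m n k}
    (hv : v ∈ jetTarget k c) : v.trunc r ∈ jetTarget r c := by
  change (v.1, (v.trunc r).u 0) ∈ c.e.target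
  rwa [trunc_u _ (zero_mem_multiIdx r)]

theorem jetCharts_target (k : ℕ) (c : AdaptedChart m n π) :
    (jetCharts m n π k).target c = jetTarget k c := by
  ext v
  constructor
  · rintro ⟨j, hj, rfl⟩
    exact mem_jetTarget hj
  · intro hv
    obtain ⟨j, -, h2, h3⟩ := Jet.exists_coord_eq hv
    exact ⟨j, h2, h3⟩

theorem Charts.inChart_coord {P V V' : Type*} [NormedAddCommGroup V] [NormedSpace ℝ V]
    [NormedAddCommGroup V'] [NormedSpace ℝ V'] {A : Charts m n π P V} {c : AdaptedChart m n π}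
    (hA : Set.InjOn (A.coord c) (A.dom c)) (g : P → V') {p : P} (hp : p ∈ A.dom c) :
    A.inChart c g (A.coord c p) = g p := by
  have h : ∃ q ∈ A.dom c, A.coord c q = A.coord c p := ⟨p, hp, rfl⟩
  rw [Charts.inChart, dif_pos h]
  exact congrArg g (hA h.choose_spec.1 hp h.choose_spec.2)

theorem injOn_jetCharts (k : ℕ) (c : AdaptedChart m n π) :
    Set.InjOn ((jetCharts m n π k).coord c) ((jetCharts m n π k).dom c) :=
  fun _ hj _ hj' h => Jet.ext_coord hj hj' h

theorem jetCharts_inChart {V' : Type*} [NormedAddCommGroup V'] [NormedSpace ℝ V'] {k : ℕ}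
    {c : AdaptedChart m n π} (g : Jet m n π k → V') {j : Jet m n π k} (hj : j.eval ∈ c.e.source) :
    (jetCharts m n π k).inChart c g (Jet.coord c j) = g j :=
  Charts.inChart_coord (injOn_jetCharts k c) g hj

/-- A point in the domain of a change of jet coordinates comes from a jet. -/
theorem exists_of_mem_dom {k : ℕ} {c c' : AdaptedChart m n π} {v : JetV m n k}
    (hv : v ∈ (c.transition c').dom k) :
    ∃ j : Jet m n π k, j.eval ∈ c.e.source ∧ j.eval ∈ c'.e.source ∧ Jet.coord c j = v := by
  have hv' := (c.mem_transition_O c').1 hv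
  obtain ⟨j, h1, h2, h3⟩ := Jet.exists_coord_eq hv'.1
  exact ⟨j, h2, h1 ▸ hv'.2, h3⟩

/-- `trans` is built from a choice of preimages and an extension by zero. On an open set of
coordinates it is the smooth map `F`, so its derivatives are those of `F`. -/
theorem trans_eventuallyEq {k : ℕ} {c c' : AdaptedChart m n π} {v : JetV m n k}
    (hv : v ∈ (c.transition c').dom k) :
    (jetCharts m n π k).trans c c' =ᶠ[𝓝 v] (c.transition c').F k := by
  filter_upwards [((c.transition c').isOpen_dom k).mem_nhds hv] with w hw
  obtain ⟨j, h1, h2, rfl⟩ := exists_of_mem_dom hw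
  exact (jetCharts_inChart _ h1).trans (Jet.coord_transition h1 h2)

theorem fderiv_trans {k : ℕ} {c c' : AdaptedChart m n π} {j : Jet m n π k}
    (hj : j.eval ∈ c.e.source) (hj' : j.eval ∈ c'.e.source) :
    fderiv ℝ ((jetCharts m n π k).trans c c') (Jet.coord c j) =
      fderiv ℝ ((c.transition c').F k) (Jet.coord c j) :=
  (trans_eventuallyEq (Jet.coord_mem_dom hj hj')).fderiv_eq

/-- The cocycle rule for the changes of jet coordinates. -/
theorem fderiv_F_comp {k : ℕ} {c c' c'' : AdaptedChart m n π} {j : Jet m n π k}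
    (hj : j.eval ∈ c.e.source) (hj' : j.eval ∈ c'.e.source) (hj'' : j.eval ∈ c''.e.source) :
    fderiv ℝ ((c.transition c'').F k) (Jet.coord c j) =
      (fderiv ℝ ((c'.transition c'').F k) (Jet.coord c' j)).comp
        (fderiv ℝ ((c.transition c').F k) (Jet.coord c j)) := by
  have h1 := Jet.coord_mem_dom hj hj'
  have h2 := Jet.coord_mem_dom hj hj''
  have e : (c.transition c'').F k =ᶠ[𝓝 (Jet.coord c j)]
      (c'.transition c'').F k ∘ (c.transition c').F k := by
    filter_upwards [((c.transition c').isOpen_dom k).mem_nhds h1,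
      ((c.transition c'').isOpen_dom k).mem_nhds h2] with w hw hw'
    obtain ⟨i, hi, hi', rfl⟩ := exists_of_mem_dom hw
    obtain ⟨i₂, h2, h2'', h3⟩ := exists_of_mem_dom hw'
    obtain rfl := Jet.ext_coord h2 hi h3
    rw [comp_apply, ← Jet.coord_transition hi hi', ← Jet.coord_transition hi' h2'',
      ← Jet.coord_transition hi h2'']
  have h3 := Jet.coord_mem_dom hj' hj''
  rw [e.fderiv_eq, Jet.coord_transition hj hj']
  rw [Jet.coord_transition hj hj'] at h3
  exact fderiv_comp _ ((c'.transition c'').smoothNear_F h3).differentiableAt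
    ((c.transition c').smoothNear_F h1).differentiableAt

theorem fderiv_F_self {k : ℕ} {c : AdaptedChart m n π} {j : Jet m n π k}
    (hj : j.eval ∈ c.e.source) :
    fderiv ℝ ((c.transition c).F k) (Jet.coord c j) = ContinuousLinearMap.id ℝ _ := by
  have e : (c.transition c).F k =ᶠ[𝓝 (Jet.coord c j)] id := by
    filter_upwards [((c.transition c).isOpen_dom k).mem_nhds (Jet.coord_mem_dom hj hj)] with w hw
    obtain ⟨i, hi, -, rfl⟩ := exists_of_mem_dom hw
    exact (Jet.coord_transition hi hi).symm
  rw [e.fderiv_eq, fderiv_id]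

/-- The local expression of a prolonged section. -/
theorem coord_prol {k : ℕ} {c : AdaptedChart m n π} {s : LocSec m n π}
    (hs : s.toFun s.pt ∈ c.e.source) :
    Jet.coord c ∘ s.prol k ∘ c.b.symm =ᶠ[𝓝 (c.b s.pt)] jet k (comps c s.toFun) := by
  have h := s.isLocSec
  filter_upwards [c.eventually_symm (h.mem_source hs)
    (h.eventually_isLocSec.and (h.eventually_mem c.e.open_source hs))] with z ⟨hz, h1, h2⟩
  simp only [comp_apply, LocSec.prol, dif_pos h1]
  rw [Jet.coord_mk h2, c.b.right_inv hz]

end JetCharts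

/-! ### Momenta and the Hamiltonian section -/

section Momenta

open Function

variable {m n : ℕ} {M : Type*} [TopologicalSpace M] [ChartedSpace (BaseV m) M]
  {E : Type*} [TopologicalSpace E] [ChartedSpace (BaseV m × FibV n) E] {π : E → M}

namespace Mom

variable {c c' : AdaptedChart m n π}

theorem isSymMom (τ : Mom m n π) (c : AdaptedChart m n π) : IsSymMom (τ.val c) :=
  ⟨τ.two_vert c, τ.symm c⟩

theorem val_eq (τ : Mom m n π) (hc : τ.base.eval ∈ c.e.source) (hc' : τ.base.eval ∈ c'.e.source) :
    τ.val c = (τ.val c').compContinuousLinearMap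
      (fderiv ℝ ((c.transition c').F 1) (Jet.coord c τ.base)) := by
  rw [← fderiv_trans hc hc']
  exact τ.compat c c' hc hc'

open Classical in
/-- The point of `J²π†` with a given expression in an adapted chart. -/
def ofForm (c₀ : AdaptedChart m n π) (j : Jet m n π 1) (hj : j.eval ∈ c₀.e.source)
    (α : JetV m n 1 [⋀^Fin m]→L[ℝ] ℝ) (hα : IsSymMom α) : Mom m n π where
  base := j
  val c := if j.eval ∈ c.e.source then
    α.compContinuousLinearMap (fderiv ℝ ((c.transition c₀).F 1) (Jet.coord c j)) else 0
  val_zero _ h := if_neg h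
  compat c c' hc hc' := by
    have hc₁ : j.eval ∈ c.e.source := hc
    have hc₂ : j.eval ∈ c'.e.source := hc'
    rw [if_pos hc₁, if_pos hc₂, fderiv_F_comp hc₁ hc₂ hj]
    erw [fderiv_trans hc₁ hc₂]
    rfl
  two_vert c v hv := by
    split_ifs with h
    · exact ((c.transition c₀).isSymMom_comp (Jet.coord_mem_dom h hj) hα).two_vert v hv
    · rfl
  symm c i j' a := by
    split_ifs with h
    · exact ((c.transition c₀).isSymMom_comp (Jet.coord_mem_dom h hj) hα).symm i j' a
    · rfl

theorem ofForm_val {c₀ : AdaptedChart m n π} {j : Jet m n π 1} (hj : j.eval ∈ c₀.e.source)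
    {α : JetV m n 1 [⋀^Fin m]→L[ℝ] ℝ} (hα : IsSymMom α) (hc : j.eval ∈ c.e.source) :
    (ofForm c₀ j hj α hα).val c =
      α.compContinuousLinearMap (fderiv ℝ ((c.transition c₀).F 1) (Jet.coord c j)) := if_pos hc

theorem ofForm_val_self {c₀ : AdaptedChart m n π} {j : Jet m n π 1} (hj : j.eval ∈ c₀.e.source)
    {α : JetV m n 1 [⋀^Fin m]→L[ℝ] ℝ} (hα : IsSymMom α) : (ofForm c₀ j hj α hα).val c₀ = α := by
  rw [ofForm_val hj hα hj, fderiv_F_self hj]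
  rfl

theorem ext_val {τ τ' : Mom m n π} (hb : τ.base = τ'.base) (hc : τ.base.eval ∈ c.e.source)
    (h : τ.val c = τ'.val c) : τ = τ' := by
  refine Mom.ext hb (funext fun d => ?_)
  by_cases hd : τ.base.eval ∈ d.e.source
  · rw [τ.val_eq hd hc, τ'.val_eq (hb ▸ hd) (hb ▸ hc), h, hb]
  · rw [τ.val_zero d hd, τ'.val_zero d (hb ▸ hd)]

theorem rmk_eq {τ τ' : Mom m n π} (hb : τ.base = τ'.base) (hc : τ.base.eval ∈ c.e.source)
    (h : momOf (τ.val c) = momOf (τ'.val c)) : RMom.mk τ = RMom.mk τ' := by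
  refine Quotient.sound ⟨hb, fun d v hv => ?_⟩
  obtain ⟨i, hi⟩ := hv
  by_cases hd : τ.base.eval ∈ d.e.source
  · rw [τ.val_eq hd hc, τ'.val_eq (hb ▸ hd) (hb ▸ hc), hb]
    refine (τ.isSymMom c).apply_eq_of_momOf_eq (τ'.isSymMom c) h (s := i) ?_
    refine ((d.transition c).fderiv_F_fst (Jet.coord_mem_dom (hb ▸ hd) (hb ▸ hc)) (v i)).trans ?_
    rw [hi, map_zero]
  · rw [τ.val_zero d hd, τ'.val_zero d (hb ▸ hd)]

theorem coord_eq (τ : Mom m n π) (c : AdaptedChart m n π) :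
    (momCharts m n π).coord c τ = (Jet.coord c τ.base, τ.p c, momOf (τ.val c)) := rfl

theorem val_eq_momForm (τ : Mom m n π) (c : AdaptedChart m n π) :
    τ.val c = momForm m n (τ.p c, momOf (τ.val c)) := (τ.isSymMom c).eq_momForm

end Mom

theorem injOn_momCharts (c : AdaptedChart m n π) :
    Set.InjOn ((momCharts m n π).coord c) ((momCharts m n π).dom c) := by
  intro τ hτ τ' hτ' h
  rw [Mom.coord_eq, Mom.coord_eq, Prod.mk.injEq] at h
  exact Mom.ext_val (Jet.ext_coord hτ hτ' h.1) hτ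
    (by rw [τ.val_eq_momForm, τ'.val_eq_momForm, h.2])

theorem exists_mom {c : AdaptedChart m n π} {j : Jet m n π 1} (hj : j.eval ∈ c.e.source)
    (q : ℝ × MomV m n) : ∃ τ : Mom m n π, τ.base = j ∧ τ.val c = momForm m n q ∧
      (momCharts m n π).coord c τ = (Jet.coord c j, q) := by
  have h := Mom.ofForm_val_self hj (isSymMom_momForm q)
  refine ⟨Mom.ofForm c j hj _ (isSymMom_momForm q), rfl, h, ?_⟩
  rw [Mom.coord_eq, Mom.p, h, momForm_dX, momOf_momForm]
  rfl

theorem W.base_eval (w : W m n π) : w.1.2.base.eval = w.1.1.eval := by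
  rw [← w.2, Jet.eval_proj]

theorem W.coord_base {w : W m n π} {c : AdaptedChart m n π} (h : w.1.1.eval ∈ c.e.source) :
    Jet.coord c w.1.2.base = (Jet.coord c w.1.1).trunc 1 := by
  rw [← w.2, Jet.coord_trunc _ h]

theorem W.coord_eq (w : W m n π) (c : AdaptedChart m n π) :
    (wCharts m n π).coord c w = (Jet.coord c w.1.1, w.1.2.p c, momOf (w.1.2.val c)) := rfl

theorem injOn_wCharts (c : AdaptedChart m n π) :
    Set.InjOn ((wCharts m n π).coord c) ((wCharts m n π).dom c) := by
  intro w hw w' hw' h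
  rw [W.coord_eq, W.coord_eq, Prod.mk.injEq] at h
  have h1 := Jet.ext_coord hw hw' h.1
  refine Subtype.ext (Prod.ext h1 (Mom.ext_val (c := c) ?_ ?_ ?_))
  · rw [← w.2, ← w'.2, h1]
  · rw [w.base_eval]; exact hw
  · exact (w.1.2.val_eq_momForm c).trans
      ((congrArg (momForm m n) h.2).trans (w'.1.2.val_eq_momForm c).symm)

theorem exists_w {c : AdaptedChart m n π} {j : Jet m n π 3} (hj : j.eval ∈ c.e.source)
    (q : ℝ × MomV m n) : ∃ w : W m n π, w.1.1 = j ∧ w.1.2.val c = momForm m n q ∧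
      (wCharts m n π).coord c w = (Jet.coord c j, q) := by
  have hj' : (j.proj 1 (by norm_num)).eval ∈ c.e.source := by rwa [Jet.eval_proj]
  obtain ⟨τ, h1, h2, h3⟩ := exists_mom hj' q
  refine ⟨⟨(j, τ), h1.symm⟩, rfl, h2, ?_⟩
  exact congrArg (Prod.mk (Jet.coord c j)) (Prod.mk.inj h3).2

theorem Wr.coord_muW (w : W m n π) (c : AdaptedChart m n π) :
    (wrCharts m n π).coord c (muW w) = (Jet.coord c w.1.1, momOf (w.1.2.val c)) := rfl

theorem injOn_wrCharts (c : AdaptedChart m n π) :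
    Set.InjOn ((wrCharts m n π).coord c) ((wrCharts m n π).dom c) := by
  intro w hw w' hw' h
  obtain ⟨z, rfl⟩ := muW_surjective w
  obtain ⟨z', rfl⟩ := muW_surjective w'
  rw [Wr.coord_muW, Wr.coord_muW, Prod.mk.injEq] at h
  have h1 := Jet.ext_coord hw hw' h.1
  refine Subtype.ext (Prod.ext h1 (Mom.rmk_eq (c := c) ?_ ?_ h.2))
  · exact z.2.symm.trans ((congrArg (Jet.proj 1 (by norm_num)) h1).trans z'.2)
  · rw [z.base_eval]; exact hw

theorem exists_wr {c : AdaptedChart m n π} {j : Jet m n π 3} (hj : j.eval ∈ c.e.source)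
    (ν : MomV m n) : ∃ w : Wr m n π, w.1.1 = j ∧
      (wrCharts m n π).coord c w = (Jet.coord c j, ν) := by
  obtain ⟨z, h1, h2, -⟩ := exists_w hj (0, ν)
  refine ⟨muW z, h1, ?_⟩
  rw [Wr.coord_muW, h1, h2, momOf_momForm]

/-- The contribution of the momenta to the coupling form. -/
def coupling (ν : MomV m n) (v : JetV m n 2) : ℝ := ∑ s, flux ν (tot v (ev s)) s

theorem momForm_tot (q : ℝ × MomV m n) (v : JetV m n 2) :
    momForm m n q (fun l => tot v (ev l)) = q.1 + coupling q.2 v := by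
  rw [momForm_apply]
  simp only [tot_fst]
  rw [vol_ev, mul_one]
  congr 1
  exact Finset.sum_congr rfl fun s _ => vol_update_ev s _

theorem coupling_eq (ν : MomV m n) (v : JetV m n 2) :
    coupling ν v = momForm m n (0, ν) (fun l => tot v (ev l)) := by
  rw [momForm_tot, zero_add]

theorem formRep_transition (η : (x : M) → (TangentSpace (𝓡 m) x) [⋀^Fin m]→L[ℝ] ℝ)
    (c c' : AdaptedChart m n π) {x : M} (hx : x ∈ c.b.source) (hx' : x ∈ c'.b.source) :
    formRep η c.b (c.b x) = (formRep η c'.b (c'.b x)).compContinuousLinearMap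
      (fderiv ℝ (c.transition c').f (c.b x)) := by
  -- All tangent spaces of `M` are copies of the model space. Reading `η` as a map to a fixed space
  -- of forms permits rewriting of the base point.
  let η' : M → BaseV m [⋀^Fin m]→L[ℝ] ℝ := η
  have hf : (c.b x) ∈ (c.transition c').f.source := by
    change c.b x ∈ (c.b.symm ≫ₕ c'.b).source
    rw [OpenPartialHomeomorph.trans_source]
    exact ⟨c.b.map_source hx, by simpa [c.b.left_inv hx] using hx'⟩
  have e : c.b.symm =ᶠ[𝓝 (c.b x)] c'.b.symm ∘ (c.transition c').f := by
    filter_upwards [c.eventually_symm hx (c'.b.open_source.mem_nhds hx')] with z hz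
    exact (c'.b.left_inv hz.2).symm
  have hd : mfderiv 𝓘(ℝ, BaseV m) (𝓡 m) c.b.symm (c.b x) =
      (mfderiv 𝓘(ℝ, BaseV m) (𝓡 m) c'.b.symm (c'.b x) : BaseV m →L[ℝ] BaseV m).comp
        (fderiv ℝ (c.transition c').f (c.b x)) := by
    have hs := (c'.contMDiffAt_b_symm (c'.b.map_source hx')).mdifferentiableAt (by simp)
    rw [← c.transition_f_apply c' hx] at hs ⊢
    exact ((hs.hasMFDerivAt.comp (c.b x) ((c.transition c').smoothNear_f
      hf).differentiableAt.hasFDerivAt.hasMFDerivAt).congr_of_eventuallyEq e).mfderiv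
  change (η' (c.b.symm (c.b x))).compContinuousLinearMap
      (mfderiv 𝓘(ℝ, BaseV m) (𝓡 m) c.b.symm (c.b x) : BaseV m →L[ℝ] BaseV m) =
    ((η' (c'.b.symm (c'.b x))).compContinuousLinearMap
      (mfderiv 𝓘(ℝ, BaseV m) (𝓡 m) c'.b.symm (c'.b x) : BaseV m →L[ℝ] BaseV m)).compContinuousLinearMap _
  rw [c.b.left_inv hx, c'.b.left_inv hx']
  exact congrArg (fun A : BaseV m →L[ℝ] BaseV m => (η' x).compContinuousLinearMap A) hd

theorem pairing_eq {c : AdaptedChart m n π} {s : LocSec m n π} (hs : s.toFun s.pt ∈ c.e.source)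
    (τ : Mom m n π) : pairing c s τ = (τ.val c).compContinuousLinearMap
      (fderiv ℝ (jet 1 (comps c s.toFun)) (c.b s.pt)) := by
  rw [pairing]
  exact congrArg (fun A => (τ.val c).compContinuousLinearMap A) (coord_prol hs).fderiv_eq

theorem pairing_transition {c c' : AdaptedChart m n π} {s : LocSec m n π}
    (hs : s.toFun s.pt ∈ c.e.source) (hs' : s.toFun s.pt ∈ c'.e.source) {τ : Mom m n π}
    (hτ : τ.base = Jet.mk 1 s) : pairing c s τ = (pairing c' s τ).compContinuousLinearMap
      (fderiv ℝ (c.transition c').f (c.b s.pt)) := by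
  have h := s.isLocSec
  have hb : τ.base.eval ∈ c.e.source := by rw [hτ]; exact hs
  have hb' : τ.base.eval ∈ c'.e.source := by rw [hτ]; exact hs'
  rw [pairing_eq hs, pairing_eq hs', τ.val_eq hb hb', hτ, Jet.coord_mk hs]
  have h1 := (c.transition c').fderiv_F_comp_tot 1 (c.smoothNear_comps h hs)
    (c.mem_O_of_isLocSec c' h hs hs')
  rw [c.transition_f_apply c' (h.mem_source hs),
    ← (jet_eventuallyEq (c.comps_transition c' h hs hs') 1).fderiv_eq] at h1
  exact congrArg (fun A : BaseV m →L[ℝ] JetV m n 1 => (τ.val c').compContinuousLinearMap A) h1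

/-- Along a holonomic section the form is a multiple of `d^m x` whose coefficient is affine in `p`
with slope `1`. The equation defining `𝓦_o` can therefore be solved uniquely for `p`. -/
theorem pairing_apply_ev {c : AdaptedChart m n π} {s : LocSec m n π}
    (hs : s.toFun s.pt ∈ c.e.source) (τ : Mom m n π) :
    pairing c s τ ev = τ.p c + coupling (momOf (τ.val c)) (Jet.coord c (Jet.mk 2 s)) := by
  rw [pairing_eq hs, fderiv_jet (c.smoothNear_comps s.isLocSec hs), Jet.coord_mk hs,
    ← momForm_tot (τ.p c, momOf (τ.val c)), ← Mom.val_eq_momForm]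
  rfl

theorem top_form_ext {β γ : BaseV m [⋀^Fin m]→L[ℝ] ℝ} (h : β ev = γ ev) : β = γ := by
  ext v
  rw [top_form_apply β, top_form_apply γ, h]

/-! ### The Lagrangian density and the Hamiltonian section in charts -/

section Lagrangian

variable (L : Jet m n π 2 → ℝ) (η : (x : M) → (TangentSpace (𝓡 m) x) [⋀^Fin m]→L[ℝ] ℝ)

theorem lagRep_coord {c : AdaptedChart m n π} {j : Jet m n π 2} (hj : j.eval ∈ c.e.source) :
    lagRep L η c (Jet.coord c j) = L j * formRep η c.b (Jet.coord c j).1 ev := by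
  rw [lagRep, jetCharts_inChart L hj]
  rfl

/-- `L` is a function, so only the coefficient of the volume form changes, by the Jacobian. -/
theorem lagRep_transition {c c' : AdaptedChart m n π} {v : JetV m n 2}
    (hv : v ∈ (c.transition c').dom 2) :
    lagRep L η c v = lagRep L η c' ((c.transition c').F 2 v) * (c.transition c').jac v.1 := by
  obtain ⟨j, hj, hj', rfl⟩ := exists_of_mem_dom hv
  obtain ⟨s, rfl⟩ := Jet.exists_mk_eq j
  rw [← Jet.coord_transition hj hj', lagRep_coord L η hj, lagRep_coord L η hj', mul_assoc]
  congr 1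
  change formRep η c.b (c.b s.pt) ev = formRep η c'.b (c'.b s.pt) ev * _
  rw [formRep_transition η c c' (s.isLocSec.mem_source hj) (s.isLocSec.mem_source hj'),
    ContinuousAlternatingMap.compContinuousLinearMap_apply, top_form_apply]
  rfl

theorem exists_mem_Wo (w : Wr m n π) : ∃ z ∈ Wo L η, muW z = w := by
  obtain ⟨⟨⟨j, τ⟩, hτ⟩, rfl⟩ := muW_surjective w
  by_cases h : ∃ c : AdaptedChart m n π, j.eval ∈ c.e.source
  · obtain ⟨c, hc⟩ := h
    obtain ⟨s₀, rfl⟩ := Jet.exists_mk_eq j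
    have hb : τ.base.eval ∈ c.e.source := by
      change Jet.mk 1 s₀ = τ.base at hτ
      rw [← hτ]; exact hc
    -- The momenta are those of the given class, and `p` is solved from the coupling equation in the
    -- chart `c`. The equation in any other chart `d` follows because both sides transform as
    -- `m`-forms on the base.
    obtain ⟨τ', h1, h2, h3⟩ := exists_mom hb (lagRep L η c (Jet.coord c (Jet.mk 2 s₀)) -
      coupling (momOf (τ.val c)) (Jet.coord c (Jet.mk 2 s₀)), momOf (τ.val c))
    refine ⟨⟨(Jet.mk 3 s₀, τ'), hτ.trans h1.symm⟩, fun s hs d hd => ?_, ?_⟩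
    · have hs2 : Jet.mk 2 s = Jet.mk 2 s₀ := congrArg (Jet.proj 2 (by norm_num)) hs
      have hs1 : τ'.base = Jet.mk 1 s := by
        rw [h1, ← show Jet.mk 1 s₀ = τ.base from hτ]
        exact (congrArg (Jet.proj 1 (by norm_num)) hs).symm
      have he : s.toFun s.pt = (Jet.mk 3 s₀).eval := congrArg Jet.eval hs
      have hsd : s.toFun s.pt ∈ d.e.source := by rw [he]; exact hd
      have hsc : s.toFun s.pt ∈ c.e.source := by rw [he]; exact hc
      change pairing d s τ' = L (Jet.mk 2 s₀) • _
      have key : pairing c s τ' = L (Jet.mk 2 s₀) • formRep η c.b (c.b s.pt) := by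
        refine top_form_ext ?_
        rw [pairing_apply_ev hsc, hs2, Mom.p, h2, momForm_dX, momOf_momForm, sub_add_cancel,
          ← hs2, lagRep_coord L η hsc]
        rfl
      rw [pairing_transition hsd hsc hs1, key, formRep_transition η d c
        (s.isLocSec.mem_source hsd) (s.isLocSec.mem_source hsc)]
      rfl
    · refine Subtype.ext (Prod.ext rfl (Mom.rmk_eq (c := c) h1 (by rw [h1]; exact hb) ?_))
      rw [h2, momOf_momForm]
  -- Over a jet that lies in no adapted chart the condition defining `𝓦_o` is vacuous.
  · exact ⟨⟨(j, τ), hτ⟩, fun s _ c hc => absurd ⟨c, hc⟩ h, rfl⟩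

theorem ham_mem (w : Wr m n π) : ham L η w ∈ Wo L η := by
  rw [ham, dif_pos (exists_mem_Wo L η w)]
  exact (exists_mem_Wo L η w).choose_spec.1

theorem muW_ham (w : Wr m n π) : muW (ham L η w) = w := by
  rw [ham, dif_pos (exists_mem_Wo L η w)]
  exact (exists_mem_Wo L η w).choose_spec.2

/-- The local expression of the Hamiltonian section. -/
def hamMap (l : JetV m n 2 → ℝ) (y : JetV m n 3 × MomV m n) : JetV m n 3 × ℝ × MomV m n :=
  (y.1, l (y.1.trunc 2) - coupling y.2 (y.1.trunc 2), y.2)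

theorem ham_fst (w : Wr m n π) : (ham L η w).1.1 = w.1.1 :=
  congrArg (fun w : Wr m n π => w.1.1) (muW_ham L η w)

/-- `ham` selects some point of `𝓦_o` over `w`. The coupling equation fixes its coordinate `p`, so
the choice is irrelevant in a chart. -/
theorem coord_ham {w : Wr m n π} {c : AdaptedChart m n π} (hw : w.1.1.eval ∈ c.e.source) :
    (wCharts m n π).coord c (ham L η w) =
      hamMap (lagRep L η c) ((wrCharts m n π).coord c w) := by
  have h := ham_mem L η w
  have h1 := muW_ham L η w
  have hj := ham_fst L η w
  set z := ham L η w with hz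
  rw [← h1, Wr.coord_muW, W.coord_eq]
  rw [← hj] at hw
  obtain ⟨s, hs⟩ := Jet.exists_mk_eq z.1.1
  have hsc : s.toFun s.pt ∈ c.e.source := by rwa [← hs] at hw
  have h2 := congrArg (fun β => β ev) (h s hs c hw)
  have h3 : Jet.mk 2 s = z.1.1.proj 2 (by norm_num) := by rw [← hs]; rfl
  simp only [pairing_apply_ev hsc] at h2
  have h4 : (Jet.coord c z.1.1).trunc 2 = Jet.coord c (Jet.mk 2 s) := by
    rw [h3, Jet.coord_trunc _ hw]
  rw [hamMap, h4, lagRep_coord L η hsc]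
  refine Prod.ext rfl (Prod.ext (eq_sub_of_add_eq (h2.trans ?_)) rfl)
  exact congrArg (fun j => L j * formRep η c.b (c.b s.pt) ev) h3.symm

end Lagrangian

end Momenta

/-! ### Local expressions of the forms and the Legendre map -/

section LocalForms

open Function

variable {m n : ℕ} {M : Type*} [TopologicalSpace M] [ChartedSpace (BaseV m) M]
  {E : Type*} [TopologicalSpace E] [ChartedSpace (BaseV m × FibV n) E] {π : E → M}

/-- The local expression of the Liouville form. -/
def stdTheta (z : JetV m n 1 × ℝ × MomV m n) : (JetV m n 1 × ℝ × MomV m n) [⋀^Fin m]→L[ℝ] ℝ :=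
  (momForm m n z.2).compContinuousLinearMap (ContinuousLinearMap.fst ℝ _ _)

theorem differentiable_stdTheta : Differentiable ℝ (stdTheta (m := m) (n := n)) := fun z =>
  DifferentiableAt.continuousAlternatingMapCompContinuousLinearMap
    (f := fun z : JetV m n 1 × ℝ × MomV m n => momForm m n z.2)
    ((momForm m n).differentiableAt.comp z differentiableAt_snd) (differentiableAt_const _)

theorem isOpen_fst_mem_jetTarget (k : ℕ) (c : AdaptedChart m n π) (V : Type*) [TopologicalSpace V] :
    IsOpen {z : JetV m n k × V | z.1 ∈ jetTarget k c} :=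
  (isOpen_jetTarget k c).preimage continuous_fst

/-- The coordinates are injective and every point with first component in `jetTarget` is attained,
so the extension by zero in `inChart` plays no role near `z`, and the tautological form is `momForm`
of the fibre coordinates. -/
theorem liouville_eventuallyEq {c : AdaptedChart m n π} {z : JetV m n 1 × ℝ × MomV m n}
    (hz : z.1 ∈ jetTarget 1 c) : liouville m n π c =ᶠ[𝓝 z] stdTheta := by
  have hev := (isOpen_fst_mem_jetTarget 1 c (ℝ × MomV m n)).mem_nhds hz
  have key : ∀ w : JetV m n 1 × ℝ × MomV m n, w.1 ∈ jetTarget 1 c →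
      (momCharts m n π).inChart c (fun τ => τ.val c) w = momForm m n w.2 ∧
      (momCharts m n π).inChart c (fun τ => (jetCharts m n π 1).coord c τ.base) w = w.1 := by
    intro w hw
    obtain ⟨j, -, hj, hjw⟩ := Jet.exists_coord_eq hw
    obtain ⟨τ, h1, h2, h3⟩ := exists_mom hj w.2
    rw [hjw] at h3
    have hτ : τ ∈ (momCharts m n π).dom c := by
      change τ.base.eval ∈ c.e.source
      rwa [h1]
    have h4 := fun V' [NormedAddCommGroup V'] [NormedSpace ℝ V'] (g : Mom m n π → V') =>
      Charts.inChart_coord (injOn_momCharts c) g hτ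
    rw [h3] at h4
    refine ⟨(h4 _ _).trans h2, (h4 _ _).trans ?_⟩
    rw [h1]
    exact hjw
  filter_upwards [eventually_eventually_nhds.2 hev] with w hw
  have h1 : (momCharts m n π).inChart c (fun τ => (jetCharts m n π 1).coord c τ.base) =ᶠ[𝓝 w]
      Prod.fst := by
    filter_upwards [hw] with y hy
    exact (key y hy).2
  rw [liouville, (key w hw.self_of_nhds).1, h1.fderiv_eq, fderiv_fst]
  rfl

theorem liouvilleOmega_eq {c : AdaptedChart m n π} {z : JetV m n 1 × ℝ × MomV m n}
    (hz : z.1 ∈ jetTarget 1 c) : liouvilleOmega m n π c z = -extDeriv stdTheta z := by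
  rw [liouvilleOmega, Charts.negExtDeriv, (liouville_eventuallyEq hz).extDeriv_eq]

/-- The contraction of `dΘ` with a vector tangent to the fibres of `J²π† → J¹π`. -/
theorem extDeriv_stdTheta_vertical (z : JetV m n 1 × ℝ × MomV m n) (q : ℝ × MomV m n)
    (w : Fin m → JetV m n 1 × ℝ × MomV m n) :
    extDeriv stdTheta z (Matrix.vecCons (0, q) w) = momForm m n q (fun i => (w i).1) := by
  -- Only the term that differentiates along `(0, q)` survives. The other terms keep `(0, q)` as an
  -- argument of `stdTheta`, which is horizontal over `J¹π` and vanishes identically on it.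
  rw [extDeriv_apply (differentiable_stdTheta z), Fin.sum_univ_succ, Finset.sum_eq_zero]
  · simp only [Fin.val_zero, pow_zero, one_smul, add_zero]
    have h1 : (fun y : JetV m n 1 × ℝ × MomV m n =>
        stdTheta y ((0 : Fin (m + 1)).removeNth (Matrix.vecCons ((0 : JetV m n 1), q) w))) =
        fun y => momForm m n y.2 fun i => (w i).1 := rfl
    have h2 : HasFDerivAt (fun y : JetV m n 1 × ℝ × MomV m n => momForm m n y.2)
        ((momForm m n).comp (ContinuousLinearMap.snd ℝ _ _)) z :=
      (momForm m n).hasFDerivAt.comp z hasFDerivAt_snd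
    rw [h1]
    have h3 := (ContinuousAlternatingMap.apply ℝ (JetV m n 1) ℝ
      (fun i => (w i).1)).hasFDerivAt.comp z h2
    exact congrArg (fun A : (JetV m n 1 × ℝ × MomV m n) →L[ℝ] ℝ => A (0, q)) h3.fderiv
  · intro i _
    have h1 : (fun y : JetV m n 1 × ℝ × MomV m n =>
        stdTheta y (i.succ.removeNth (Matrix.vecCons ((0 : JetV m n 1), q) w))) = fun _ => 0 := by
      funext y
      have : 0 < m := i.pos
      obtain ⟨k, rfl⟩ : ∃ k, m = k + 1 := ⟨m - 1, by omega⟩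
      refine (momForm (k + 1) n y.2).map_coord_zero (i := 0) ?_
      change (Matrix.vecCons ((0 : JetV (k + 1) n 1), q) w (i.succ.succAbove 0)).1 = 0
      rw [Fin.succ_succAbove_zero]
      rfl
    rw [h1]
    simp

theorem Charts.pullback_eq {P Q V V' : Type*} [NormedAddCommGroup V] [NormedSpace ℝ V]
    [NormedAddCommGroup V'] [NormedSpace ℝ V'] {A : Charts m n π P V} {B : Charts m n π Q V'}
    {k : ℕ} {f : P → Q} (θ : B.Form k) {c : AdaptedChart m n π} {v : V} {K : V → V'}
    (h : A.inChart c (B.coord c ∘ f) =ᶠ[𝓝 v] K) :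
    A.pullback f θ c v = (θ c (K v)).compContinuousLinearMap (fderiv ℝ K v) := by
  rw [Charts.pullback, h.eq_of_nhds, h.fderiv_eq]

/-- The local expression of `ρ₂`. -/
def rho2L (m n : ℕ) : JetV m n 3 × ℝ × MomV m n →L[ℝ] JetV m n 1 × ℝ × MomV m n :=
  ((truncL m n 3 1).comp (ContinuousLinearMap.fst ℝ _ _)).prod (ContinuousLinearMap.snd ℝ _ _)

theorem rho2L_apply (z : JetV m n 3 × ℝ × MomV m n) : rho2L m n z = (z.1.trunc 1, z.2) := by
  rw [← truncL_apply]
  rfl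

theorem pullback_rho2 {c : AdaptedChart m n π} {z : JetV m n 3 × ℝ × MomV m n}
    (hz : z.1 ∈ jetTarget 3 c) :
    (wCharts m n π).pullback rho2 (liouvilleOmega m n π) c z =
      (-extDeriv stdTheta (rho2L m n z)).compContinuousLinearMap (rho2L m n) := by
  have h : (wCharts m n π).inChart c ((momCharts m n π).coord c ∘ rho2) =ᶠ[𝓝 z] rho2L m n := by
    filter_upwards [(isOpen_fst_mem_jetTarget 3 c (ℝ × MomV m n)).mem_nhds hz] with y hy
    obtain ⟨j, -, hj, hjy⟩ := Jet.exists_coord_eq hy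
    obtain ⟨w, h1, h2, h3⟩ := exists_w hj y.2
    rw [hjy] at h3
    have hw : w ∈ (wCharts m n π).dom c := by
      change w.1.1.eval ∈ c.e.source
      rwa [h1]
    have h4 := Charts.inChart_coord (injOn_wCharts c) ((momCharts m n π).coord c ∘ rho2) hw
    rw [h3] at h4
    refine h4.trans ?_
    have h5 := W.coord_base (w := w) hw
    rw [h1, hjy] at h5
    rw [rho2L_apply]
    exact Prod.ext h5 (Prod.mk.inj h3).2
  rw [Charts.pullback_eq _ h, (rho2L m n).fderiv, liouvilleOmega_eq]
  rw [rho2L_apply]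
  exact trunc_mem_jetTarget hz

/-- The map of momenta is the flux of a continuous linear map. -/
def fluxL (m n : ℕ) : MomV m n →L[ℝ] JetV m n 1 →L[ℝ] BaseV m :=
  LinearMap.toContinuousLinearMap
    { toFun := flux
      map_add' := flux_add
      map_smul' := flux_smul }

theorem smoothNear_coupling (z : MomV m n × JetV m n 2) :
    SmoothNear (fun z : MomV m n × JetV m n 2 => coupling z.1 z.2) z := by
  have h : ∀ s, SmoothNear (fun z : MomV m n × JetV m n 2 =>
      crd s (fluxL m n z.1 (tot z.2 (ev s)))) z := fun s => by
    refine SmoothNear.comp (g := crd s) ((crd s).smoothNear _) ?_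
    refine SmoothNear.clm_apply (A := fun z : MomV m n × JetV m n 2 => fluxL m n z.1)
      (((fluxL m n).comp (ContinuousLinearMap.fst ℝ _ _)).smoothNear z) ?_
    exact SmoothNear.comp (g := fun z : JetV m n 2 × BaseV m => tot z.1 z.2)
      (f := fun z : MomV m n × JetV m n 2 => (z.2, ev s)) ((contDiff_tot 1).smoothNear _)
      ((contDiff_snd.smoothNear _).prodMk smoothNear_const)
  filter_upwards [Filter.eventually_all.2 h] with y hy
  exact ContDiffAt.sum fun s _ => hy s

/-! ### Smoothness, the graph `𝓦_𝓛` and the Poincaré–Cartan form -/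

section Lagrangian

variable {L : Jet m n π 2 → ℝ} {η : (x : M) → (TangentSpace (𝓡 m) x) [⋀^Fin m]→L[ℝ] ℝ}
  {c : AdaptedChart m n π}

theorem smoothNear_lagRep (hη : IsVolumeForm η) (hL : (jetCharts m n π 2).SmoothFun L)
    {v : JetV m n 2} (hv : v ∈ jetTarget 2 c) : SmoothNear (lagRep L η c) v := by
  have h1 : SmoothNear ((jetCharts m n π 2).inChart c L) v := by
    refine smoothNear_of_contDiffOn (hL c) ?_ ?_
    · rw [jetCharts_target]; exact isOpen_jetTarget 2 c
    · rwa [jetCharts_target]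
  have h2 : SmoothNear (formRep η c.b) v.1 :=
    smoothNear_of_contDiffOn (hη.smooth c.b c.b_mem) c.b.open_target (c.fst_mem_target hv)
  have h3 : SmoothNear (fun v : JetV m n 2 => formRep η c.b v.1 ev) v :=
    SmoothNear.comp (g := ContinuousAlternatingMap.apply ℝ (BaseV m) ℝ ev)
      (ContinuousLinearMap.smoothNear _ _)
      (SmoothNear.comp (g := formRep η c.b) h2 (contDiff_fst.smoothNear _))
  exact h1.smul h3

theorem smoothNear_hamMap {l : JetV m n 2 → ℝ} {y : JetV m n 3 × MomV m n}
    (hl : SmoothNear l (y.1.trunc 2)) : SmoothNear (hamMap l) y := by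
  have h1 : SmoothNear (fun y : JetV m n 3 × MomV m n => l (y.1.trunc 2)) y :=
    SmoothNear.comp (g := fun v : JetV m n 3 => l (v.trunc 2)) (SmoothNear.trunc hl)
      (contDiff_fst.smoothNear _)
  have h2 : SmoothNear (fun y : JetV m n 3 × MomV m n => coupling y.2 (truncL m n 3 2 y.1)) y :=
    SmoothNear.comp (g := fun z : MomV m n × JetV m n 2 => coupling z.1 z.2)
      (f := fun y : JetV m n 3 × MomV m n => (y.2, truncL m n 3 2 y.1)) (smoothNear_coupling _)
      ((contDiff_snd.smoothNear _).prodMk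
        (((truncL m n 3 2).comp (ContinuousLinearMap.fst ℝ _ _)).smoothNear y))
  simp only [truncL_apply] at h2
  have h3 : SmoothNear (fun y : JetV m n 3 × MomV m n =>
      l (y.1.trunc 2) - coupling y.2 (y.1.trunc 2)) y := by
    filter_upwards [h1, h2] with w hw hw'
    exact hw.sub hw'
  exact (contDiff_fst.smoothNear _).prodMk (h3.prodMk (contDiff_snd.smoothNear _))

theorem omegaR_eq {y : JetV m n 3 × MomV m n} (hy : y.1 ∈ jetTarget 3 c) :
    omegaR L η c y = (-extDeriv stdTheta (rho2L m n (hamMap (lagRep L η c)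
      y))).compContinuousLinearMap ((rho2L m n).comp (fderiv ℝ (hamMap (lagRep L η c)) y)) := by
  have h : (wrCharts m n π).inChart c ((wCharts m n π).coord c ∘ ham L η) =ᶠ[𝓝 y]
      hamMap (lagRep L η c) := by
    filter_upwards [(isOpen_fst_mem_jetTarget 3 c (MomV m n)).mem_nhds hy] with z hz
    obtain ⟨j, -, hj, hjz⟩ := Jet.exists_coord_eq hz
    obtain ⟨w, h1, h3⟩ := exists_wr hj z.2
    rw [hjz] at h3
    have hw : w.1.1.eval ∈ c.e.source := by rwa [h1]
    have h4 := Charts.inChart_coord (injOn_wrCharts c) ((wCharts m n π).coord c ∘ ham L η)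
      (p := w) hw
    rw [h3] at h4
    rw [h4, comp_apply, coord_ham L η hw, h3]
  rw [omegaR, Charts.pullback_eq _ h, pullback_rho2 hy]
  rfl

/-- The local expression of the section of `𝓦_r` over `J³π` defined by the Legendre map. -/
def legMap (l : JetV m n 2 → ℝ) (v : JetV m n 3) : JetV m n 3 × MomV m n := (v, cLeg l v)

theorem smoothNear_legMap {l : JetV m n 2 → ℝ} {v : JetV m n 3} (hl : SmoothNear l (v.trunc 2)) :
    SmoothNear (legMap l) v := smoothNear_id.prodMk hl.cLeg

theorem mem_WL_iff {w : Wr m n π} : w ∈ WL L η ↔ ∀ c : AdaptedChart m n π, w.1.1.eval ∈ c.e.source →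
    (wrCharts m n π).coord c w = legMap (lagRep L η c) (Jet.coord c w.1.1) := by
  refine forall_congr' fun c => imp_congr Iff.rfl ⟨fun h => ?_, fun h => ?_⟩
  · exact Prod.ext rfl (Prod.ext (funext fun i => funext fun a => h.1 i a)
      (funext fun I => funext fun a => h.2 I.1 I.2 a))
  · have h2 := (Prod.mk.inj h).2
    refine ⟨fun i a => ?_, fun I hI a => ?_⟩
    · exact congrArg (fun ν : MomV m n => ν.1 i a) h2
    · exact congrArg (fun ν : MomV m n => ν.2 ⟨I, hI⟩ a) h2

theorem rho1L_injective : Injective (rho1L L η) := by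
  intro w w' h
  refine Subtype.ext ?_
  by_cases hc : ∃ c : AdaptedChart m n π, w.1.1.1.eval ∈ c.e.source
  · obtain ⟨c, hc⟩ := hc
    have h' : w.1.1.1 = w'.1.1.1 := h
    have hc' : w'.1.1.1.eval ∈ c.e.source := by rwa [← h']
    refine injOn_wrCharts c hc hc' ?_
    rw [mem_WL_iff.1 w.2 c hc, mem_WL_iff.1 w'.2 c hc', h']
  -- Over a jet in no adapted chart all multimomenta have zero expressions, so the fibre of `𝓦_r` is
  -- a single point.
  · obtain ⟨z, hz⟩ := muW_surjective w.1
    obtain ⟨z', hz'⟩ := muW_surjective w'.1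
    have h' : z.1.1 = z'.1.1 := by
      have : rho1r (muW z) = rho1r (muW z') := by rw [hz, hz']; exact h
      exact this
    have hb : z.1.2.base = z'.1.2.base := by rw [← z.2, ← z'.2, h']
    have hd : ∀ d : AdaptedChart m n π, z.1.2.base.eval ∉ d.e.source := fun d hd => by
      rw [z.base_eval] at hd
      exact hc ⟨d, by rw [← hz]; exact hd⟩
    rw [← hz, ← hz']
    refine Subtype.ext (Prod.ext h' (Quotient.sound ⟨hb, fun d v _ => ?_⟩))
    rw [z.1.2.val_zero d (hd d), z'.1.2.val_zero d (hb ▸ hd d)]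

/-- The momenta given by the Legendre formulas in one chart extend to a point of `J²π†`. That they
satisfy the formulas in the other charts is the invariance `Transition.momOf_comp_cLeg`. -/
theorem rho1L_surjective (hη : IsVolumeForm η) (hL : (jetCharts m n π 2).SmoothFun L) :
    Surjective (rho1L L η) := by
  intro j
  by_cases h : ∃ c : AdaptedChart m n π, j.eval ∈ c.e.source
  · obtain ⟨c, hc⟩ := h
    have hb : (j.proj 1 (by norm_num)).eval ∈ c.e.source := by rwa [Jet.eval_proj]
    -- The value `p = 0` is arbitrary: it is forgotten in `𝓦_r`.
    let z : W m n π := ⟨(j, Mom.ofForm c _ hb _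
      (isSymMom_momForm (0, cLeg (lagRep L η c) (Jet.coord c j)))), rfl⟩
    refine ⟨⟨muW z, mem_WL_iff.2 fun d hd => ?_⟩, rfl⟩
    have hd' : j.eval ∈ d.e.source := hd
    have hdb : (j.proj 1 (by norm_num)).eval ∈ d.e.source := by rwa [Jet.eval_proj]
    refine Prod.ext rfl ?_
    change momOf ((Mom.ofForm c _ hb _ (isSymMom_momForm
      (0, cLeg (lagRep L η c) (Jet.coord c j)))).val d) = cLeg (lagRep L η d) (Jet.coord d j)
    have hv := Jet.coord_mem_dom hd' hc
    have h2 := (d.transition c).trunc_mem_dom (r := 2) hv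
    rw [Mom.ofForm_val hb _ hdb, Jet.coord_trunc _ hd', Jet.coord_transition hd' hc]
    refine (d.transition c).momOf_comp_cLeg hv
      (smoothNear_lagRep hη hL (trunc_mem_jetTarget (mem_jetTarget hd'))) ?_ ?_ 0
    · refine smoothNear_lagRep hη hL ?_
      obtain ⟨i, hi, hi', hiv⟩ := exists_of_mem_dom h2
      rw [← hiv, ← Jet.coord_transition hi hi']
      exact mem_jetTarget hi'
    · filter_upwards [((d.transition c).isOpen_dom 2).mem_nhds h2] with v hv
      exact lagRep_transition L η hv
  · refine ⟨⟨muW ⟨(j, Mom.zero (j.proj 1 (by norm_num))), rfl⟩, mem_WL_iff.2 fun d hd => absurd ⟨d, hd⟩ h⟩, rfl⟩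

/-- The extended Legendre map in coordinates. -/
theorem omegaL_eq (hη : IsVolumeForm η) (hL : (jetCharts m n π 2).SmoothFun L)
    {v : JetV m n 3} (hv : v ∈ jetTarget 3 c) :
    omegaL L η c v = (omegaR L η c (legMap (lagRep L η c) v)).compContinuousLinearMap
      (fderiv ℝ (legMap (lagRep L η c)) v) := by
  have h : (jetCharts m n π 3).inChart c ((momCharts m n π).coord c ∘ extLegendre L η) =ᶠ[𝓝 v]
      fun v => rho2L m n (hamMap (lagRep L η c) (legMap (lagRep L η c) v)) := by
    filter_upwards [(isOpen_jetTarget 3 c).mem_nhds hv] with v hv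
    obtain ⟨j, -, hj, rfl⟩ := Jet.exists_coord_eq hv
    rw [jetCharts_inChart _ hj, comp_apply]
    have hex : ∃ w : WL L η, rho1L L η w = j := rho1L_surjective hη hL j
    rw [extLegendre, dif_pos hex]
    have hw := hex.choose_spec
    set w := hex.choose
    have hwj : w.1.1.1 = j := hw
    have hwc : w.1.1.1.eval ∈ c.e.source := by rwa [hwj]
    have h1 := coord_ham L η hwc
    rw [mem_WL_iff.1 w.2 c hwc, hwj] at h1
    rw [← h1]
    rw [rho2L_apply]
    refine Prod.ext ?_ rfl
    exact W.coord_base (w := ham L η w.1) (by rwa [ham_fst])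
  have hl := smoothNear_lagRep hη hL (trunc_mem_jetTarget (r := 2) hv)
  have h1 := smoothNear_legMap hl
  have h2 : SmoothNear (hamMap (lagRep L η c)) (legMap (lagRep L η c) v) := smoothNear_hamMap hl
  have h3 := ((rho2L m n).hasFDerivAt.comp v
    (h2.differentiableAt.hasFDerivAt.comp v h1.differentiableAt.hasFDerivAt)).fderiv
  have h4 : (rho2L m n (hamMap (lagRep L η c) (legMap (lagRep L η c) v))).1 ∈ jetTarget 1 c := by
    rw [rho2L_apply]
    exact trunc_mem_jetTarget (r := 1) hv
  rw [omegaL, Charts.pullback_eq _ h, omegaR_eq hv, liouvilleOmega_eq h4]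
  exact congrArg (fun A => ContinuousAlternatingMap.compContinuousLinearMap _ A) h3

end Lagrangian

end LocalForms

/-! ### Vector fields on jet bundles and the field equations -/

section FieldEquations

open Function

variable {m n : ℕ} {M : Type*} [TopologicalSpace M] [ChartedSpace (BaseV m) M]
  {E : Type*} [TopologicalSpace E] [ChartedSpace (BaseV m × FibV n) E] {π : E → M}

open Classical in
/-- A vector at a point of `J^kπ` extends to a vector field. -/
theorem exists_vField [T2Space E] [IsManifold 𝓘(ℝ, BaseV m × FibV n) ∞ E] {k : ℕ}
    {c₀ : AdaptedChart m n π} {j₀ : Jet m n π k} (hj₀ : j₀.eval ∈ c₀.e.source) (a : JetV m n k) :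
    ∃ X : (jetCharts m n π k).VField, X.val c₀ (Jet.coord c₀ j₀) = a := by
  -- A bump function on `E` with support inside the domain of `c₀`. The field has constant
  -- components `a` in the chart `c₀`, multiplied by the cut-off and extended by zero.
  obtain ⟨χ, -, hχ⟩ := (SmoothBumpFunction.nhds_basis_tsupport (I := 𝓘(ℝ, BaseV m × FibV n))
    j₀.eval).mem_iff.1 (c₀.e.open_source.mem_nhds hj₀)
  let Y : AdaptedChart m n π → Jet m n π k → JetV m n k := fun c j =>
    if j.eval ∈ c₀.e.source then
      χ j.eval • fderiv ℝ ((c₀.transition c).F k) (Jet.coord c₀ j) a else 0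
  refine ⟨⟨fun c => (jetCharts m n π k).inChart c (Y c), fun c => ?_, fun c c' j hj => ?_⟩, ?_⟩
  · rw [jetCharts_target]
    intro v hv
    refine ContDiffAt.contDiffWithinAt ?_
    have hpt : ∀ w ∈ jetTarget k c, ∃ j : Jet m n π k, j.eval = c.e.symm (w.1, w.u 0) ∧
        j.eval ∈ c.e.source ∧ Jet.coord c j = w ∧
        (jetCharts m n π k).inChart c (Y c) w = Y c j := fun w hw => by
      obtain ⟨j, h1, h2, rfl⟩ := Jet.exists_coord_eq hw
      exact ⟨j, h1, h2, rfl, jetCharts_inChart _ h2⟩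
    have hu : ContDiff ℝ ∞ fun w : JetV m n k => (w.1, w.u 0) := by
      simp only [← uL_apply]
      exact contDiff_fst.prodMk (uL m n k 0).contDiff
    have hes : ContMDiffAt 𝓘(ℝ, JetV m n k) 𝓘(ℝ, BaseV m × FibV n) ∞
        (fun w : JetV m n k => c.e.symm (w.1, w.u 0)) v :=
      ContMDiffAt.comp (g := c.e.symm) v (c.contMDiffAt_e_symm hv) hu.contMDiff.contMDiffAt
    by_cases h0 : c.e.symm (v.1, v.u 0) ∈ c₀.e.source
    · have hvd : v ∈ (c.transition c₀).dom k := (c.mem_transition_O c₀).2 ⟨hv, h0⟩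
      have e : (jetCharts m n π k).inChart c (Y c) =ᶠ[𝓝 v] fun w =>
          χ (c.e.symm (w.1, w.u 0)) •
            fderiv ℝ ((c₀.transition c).F k) ((c.transition c₀).F k w) a := by
        filter_upwards [((c.transition c₀).isOpen_dom k).mem_nhds hvd] with w hw
        have hw' := (c.mem_transition_O c₀).1 hw
        obtain ⟨j, h1, h2, h3, h4⟩ := hpt w hw'.1
        have hj : j.eval ∈ c₀.e.source := by rw [h1]; exact hw'.2
        rw [h4, ← h1, ← h3, ← Jet.coord_transition h2 hj]
        exact if_pos hj
      refine ContDiffAt.congr_of_eventuallyEq (ContDiffAt.fun_smul ?_ ?_) e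
      · exact contMDiffAt_iff_contDiffAt.1
          (ContMDiffAt.comp (g := χ) v χ.contMDiff.contMDiffAt hes)
      · have hF : (c.transition c₀).F k v ∈ (c₀.transition c).dom k := by
          obtain ⟨j, hj, hj', rfl⟩ := exists_of_mem_dom hvd
          rw [← Jet.coord_transition hj hj']
          exact Jet.coord_mem_dom hj' hj
        exact (SmoothNear.comp (g := fun w => fderiv ℝ ((c₀.transition c).F k) w a)
          (((c₀.transition c).smoothNear_F hF).fderiv_apply a)
          ((c.transition c₀).smoothNear_F hvd)).contDiffAt
    · have e : (jetCharts m n π k).inChart c (Y c) =ᶠ[𝓝 v] fun _ => 0 := by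
        -- Outside the domain of `c₀` one is outside the closed support of the cut-off, so the field
        -- vanishes on a whole neighbourhood.
        have h1 : ∀ᶠ w in 𝓝 v, c.e.symm (w.1, w.u 0) ∈ (tsupport χ)ᶜ :=
          hes.continuousAt.eventually ((isClosed_tsupport χ).isOpen_compl.mem_nhds
            fun h => h0 (hχ h))
        filter_upwards [h1, (isOpen_jetTarget k c).mem_nhds hv] with w hw hw'
        obtain ⟨j, h1, -, -, h4⟩ := hpt w hw'
        rw [h4]
        simp only [Y, h1, image_eq_zero_of_notMem_tsupport hw, zero_smul, ite_self]
      exact contDiffAt_const.congr_of_eventuallyEq e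
  · have hc : j.eval ∈ c.e.source := hj.1
    have hc' : j.eval ∈ c'.e.source := hj.2
    change (jetCharts m n π k).inChart c' (Y c') (Jet.coord c' j) =
      fderiv ℝ ((jetCharts m n π k).trans c c') (Jet.coord c j)
        ((jetCharts m n π k).inChart c (Y c) (Jet.coord c j))
    rw [jetCharts_inChart _ hc, jetCharts_inChart _ hc', fderiv_trans hc hc']
    simp only [Y]
    split_ifs with h
    · rw [fderiv_F_comp h hc hc', map_smul]
      rfl
    · rw [map_zero]
  · change (jetCharts m n π k).inChart c₀ (Y c₀) (Jet.coord c₀ j₀) = a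
    rw [jetCharts_inChart _ hj₀]
    simp only [Y, if_pos hj₀, fderiv_F_self hj₀, χ.eq_one, one_smul]
    rfl

theorem tot_trunc {k r : ℕ} (hr : r ≤ k) (v : JetV m n (k + 1)) (w : BaseV m) :
    (tot v w).trunc r = tot (v.trunc (r + 1)) w := by
  rw [tot_apply, tot_apply]
  refine Prod.ext rfl (funext fun I => ?_)
  refine (JetV.u_of_mem _ (mem_multiIdx_mono hr I.2)).trans ?_
  change ∑ l, w l • v.u (I.1 + one l) = ∑ l, w l • (v.trunc (r + 1)).u (I.1 + one l)
  exact Finset.sum_congr rfl fun l _ => by rw [trunc_u _ (add_one_mem_multiIdx I.2 l)]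

/-- The momenta contribute linearly to the coupling form. -/
def couplingL (v : JetV m n 2) : MomV m n →L[ℝ] ℝ :=
  (ContinuousAlternatingMap.apply ℝ (JetV m n 1) ℝ fun l => tot v (ev l)).comp
    ((momForm m n).comp (ContinuousLinearMap.inr ℝ ℝ (MomV m n)))

theorem couplingL_apply (v : JetV m n 2) (ν : MomV m n) : couplingL v ν = coupling ν v :=
  (coupling_eq ν v).symm

/-- On the image of `ĥ`, `p = l - coupling`, and the coupling is linear in the momenta while `l`
does not involve them. -/
theorem fderiv_hamMap_vertical {l : JetV m n 2 → ℝ} {y : JetV m n 3 × MomV m n}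
    (hl : SmoothNear l (y.1.trunc 2)) (μ : MomV m n) :
    fderiv ℝ (hamMap l) y (0, μ) = (0, -coupling μ (y.1.trunc 2), μ) := by
  rw [← fderiv_slice (smoothNear_hamMap hl).differentiableAt μ]
  have h : HasFDerivAt (fun ν => hamMap l (y.1, ν))
      ((0 : MomV m n →L[ℝ] JetV m n 3).prod
        ((-couplingL (y.1.trunc 2)).prod (ContinuousLinearMap.id ℝ (MomV m n)))) y.2 := by
    refine (hasFDerivAt_const _ _).prodMk (HasFDerivAt.prodMk ?_ (hasFDerivAt_id _))
    simp only [← couplingL_apply]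
    exact (couplingL (y.1.trunc 2)).hasFDerivAt.const_sub _
  rw [h.fderiv, ← couplingL_apply]
  rfl

theorem fderiv_hamMap_fst {l : JetV m n 2 → ℝ} {y : JetV m n 3 × MomV m n}
    (hl : SmoothNear l (y.1.trunc 2)) (w : JetV m n 3 × MomV m n) :
    (fderiv ℝ (hamMap l) y w).1 = w.1 :=
  congrArg (fun A : JetV m n 3 × MomV m n →L[ℝ] JetV m n 3 => A w)
    ((smoothNear_hamMap hl).differentiableAt.hasFDerivAt.fst.unique hasFDerivAt_fst)

theorem fderiv_legMap_fst {l : JetV m n 2 → ℝ} {v : JetV m n 3}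
    (hl : SmoothNear l (v.trunc 2)) (w : JetV m n 3) :
    (fderiv ℝ (legMap l) v w).1 = w :=
  congrArg (fun A : JetV m n 3 →L[ℝ] JetV m n 3 => A w)
    ((smoothNear_legMap hl).differentiableAt.hasFDerivAt.fst.unique (hasFDerivAt_id v))

/-- The contraction of `Ω_r` with a momentum vector vanishes on holonomic tangent vectors. -/
theorem omegaR_vertical {L : Jet m n π 2 → ℝ}
    {η : (x : M) → (TangentSpace (𝓡 m) x) [⋀^Fin m]→L[ℝ] ℝ} {c : AdaptedChart m n π}
    {y : JetV m n 3 × MomV m n} (hy : y.1 ∈ jetTarget 3 c)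
    (hl : SmoothNear (lagRep L η c) (y.1.trunc 2)) (μ : MomV m n)
    {w : Fin m → JetV m n 3 × MomV m n} {b : Fin m → BaseV m}
    (hw : ∀ i, (w i).1.trunc 1 = tot (y.1.trunc 2) (b i)) :
    omegaR L η c y (Matrix.vecCons (0, μ) w) = 0 := by
  set H := hamMap (lagRep L η c)
  set A := (rho2L m n).comp (fderiv ℝ H y) with hA
  have h0 : A (0, μ) = (0, -coupling μ (y.1.trunc 2), μ) := by
    rw [hA, ContinuousLinearMap.comp_apply, fderiv_hamMap_vertical hl, rho2L_apply]
    refine Prod.ext ?_ rfl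
    exact (truncL_apply _).symm.trans (map_zero _)
  have h1 : ∀ i, (A (w i)).1 = tot (y.1.trunc 2) (b i) := fun i => by
    rw [hA, ContinuousLinearMap.comp_apply, rho2L_apply]
    change (fderiv ℝ H y (w i)).1.trunc 1 = _
    rw [fderiv_hamMap_fst hl, hw]
  have h2 : (fun i => A (Matrix.vecCons (0, μ) w i)) =
      Matrix.vecCons ((0 : JetV m n 1), -coupling μ (y.1.trunc 2), μ) fun i => A (w i) := by
    funext i
    refine Fin.cases ?_ (fun i => ?_) i
    · exact h0
    · rfl
  rw [omegaR_eq hy]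
  change -(extDeriv stdTheta (rho2L m n (H y)) fun i => A (Matrix.vecCons (0, μ) w i)) = 0
  rw [h2, extDeriv_stdTheta_vertical, neg_eq_zero]
  simp only [h1]
  -- Pulled back by the total derivatives, the form with coordinates `(-coupling μ, μ)` is a
  -- multiple of `d^m x`. Its coefficient `-coupling μ + coupling μ` is zero.
  have h3 := top_form_apply ((momForm m n (-coupling μ (y.1.trunc 2),
    μ)).compContinuousLinearMap (tot (y.1.trunc 2))) b
  refine h3.trans ?_
  rw [mul_eq_zero]
  refine Or.inl ((momForm_tot _ _).trans ?_)
  exact neg_add_cancel _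

end FieldEquations

end SecondOrderField

end

/-! ### The proposition -/

open SecondOrderField in
theorem mainTheorem6 {m n : ℕ}
    {M : Type*} [TopologicalSpace M] [T2Space M] [SecondCountableTopology M]
    [ChartedSpace (BaseV m) M] [IsManifold (𝓡 m) ∞ M]
    {E : Type*} [TopologicalSpace E] [T2Space E] [SecondCountableTopology E]
    [ChartedSpace (BaseV m × FibV n) E] [IsManifold 𝓘(ℝ, BaseV m × FibV n) ∞ E]
    (π : E → M) (hπ : Manifold.IsSubmersion 𝓘(ℝ, BaseV m × FibV n) (𝓡 m) ∞ π)
    (hπs : Function.Surjective π)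
    (η : (x : M) → (TangentSpace (𝓡 m) x) [⋀^Fin m]→L[ℝ] ℝ) (hη : IsVolumeForm η)
    (L : Jet m n π 2 → ℝ) (hL : (jetCharts m n π 2).SmoothFun L)
    (U : Set M) (hU : IsOpen U)
    (ψL : M → Jet m n π 3) (hψL : (jetCharts m n π 3).IsSection Jet.base ψL U)
    (hhol : IsHolonomic ψL U)
    (heq : (jetCharts m n π 3).FieldEq (omegaL L η) ψL U) :
    ∃ ρ : WL L η ≃ Jet m n π 3, (∀ w, ρ w = rho1L L η w) ∧
      (wrCharts m n π).IsSection rhoMr (fun x => (ρ.symm (ψL x)).1) U ∧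
      IsHolonomic (fun x => rho1r (ρ.symm (ψL x)).1) U ∧
      (wrCharts m n π).FieldEq (omegaR L η) (fun x => (ρ.symm (ψL x)).1) U := by
  let ρ := Equiv.ofBijective (rho1L L η) ⟨rho1L_injective, rho1L_surjective hη hL⟩
  have hρ : ∀ j, rho1r (ρ.symm j).1 = j := ρ.apply_symm_apply
  have hcoord : ∀ j (c : AdaptedChart m n π), j.eval ∈ c.e.source →
      (wrCharts m n π).coord c (ρ.symm j).1 = legMap (lagRep L η c) (Jet.coord c j) :=
    fun j c hj => by
      have h := mem_WL_iff.1 (ρ.symm j).2 c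
      change (rho1r (ρ.symm j).1).eval ∈ c.e.source → _ = legMap _ (Jet.coord c (rho1r _)) at h
      rw [hρ j] at h
      exact h hj
  have hdom : ∀ x (c : AdaptedChart m n π), (ρ.symm (ψL x)).1 ∈ (wrCharts m n π).dom c ↔
      (ψL x).eval ∈ c.e.source := fun x c => by
    change (rho1r (ρ.symm (ψL x)).1).eval ∈ c.e.source ↔ _
    rw [hρ]
  have hlag : ∀ {c : AdaptedChart m n π} {j : Jet m n π 3}, j.eval ∈ c.e.source →
      SmoothNear (lagRep L η c) ((Jet.coord c j).trunc 2) := fun hj =>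
    smoothNear_lagRep hη hL (trunc_mem_jetTarget (mem_jetTarget hj))
  refine ⟨ρ, fun _ => rfl, fun x hx => ⟨?_, fun c hc => ?_⟩, ?_, ?_⟩
  · change (rho1r (ρ.symm (ψL x)).1).base = x
    rw [hρ]
    exact (hψL x hx).1
  · obtain ⟨h1, h2⟩ := (hψL x hx).2 c ((hdom x c).1 hc)
    refine ⟨h1.mono fun y hy => (hdom y c).2 hy, ?_⟩
    have h3 : ContDiffAt ℝ ∞ (legMap (lagRep L η c)) (Jet.coord c (ψL x)) :=
      (smoothNear_legMap (hlag ((hdom x c).1 hc))).contDiffAt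
    refine (h3.comp_contMDiffAt (x := x) h2).congr_of_eventuallyEq ?_
    filter_upwards [h1] with y hy
    exact hcoord _ c hy
  · simp only [hρ]
    exact hhol
  · intro X x hx c hc
    have hxc := (hdom x c).1 hc
    obtain ⟨hs, hsx⟩ := hhol x hx
    set φ : M → E := fun y => (ψL y).eval with hφ
    set P := comps c φ with hP
    have hPx : SmoothNear P (c.b x) := c.smoothNear_comps hs hxc
    -- As `U` is open, holonomy holds at all points near `x`. So `ψ_𝓛` is locally a prolongation,
    -- and its derivative can be computed.
    have hloc : (jetCharts m n π 3).coord c ∘ ψL ∘ c.b.symm =ᶠ[𝓝 (c.b x)] jet 3 P := by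
      filter_upwards [c.eventually_symm (hs.mem_source hxc)
        (Filter.Eventually.and (hU.mem_nhds hx) (hs.eventually_mem c.e.open_source hxc))] with
        z ⟨hz, hzU, hzc⟩
      obtain ⟨hs', hsz⟩ := hhol _ hzU
      change Jet.coord c (ψL (c.b.symm z)) = _
      rw [hsz, Jet.coord_mk hzc]
      change jet 3 P (c.b (c.b.symm z)) = _
      rw [c.b.right_inv hz]
    have hv : Jet.coord c (ψL x) = jet 3 P (c.b x) := by rw [hsx, Jet.coord_mk hxc]
    have hl := hlag hxc
    set v := Jet.coord c (ψL x) with hvdef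
    set G := legMap (lagRep L η c) with hG
    have hGv : DifferentiableAt ℝ G v := (smoothNear_legMap hl).differentiableAt
    have hD : fderiv ℝ ((wrCharts m n π).coord c ∘ (fun x => (ρ.symm (ψL x)).1) ∘ c.b.symm)
        (c.b x) = (fderiv ℝ G v).comp (fderiv ℝ (jet 3 P) (c.b x)) := by
      have e : (wrCharts m n π).coord c ∘ (fun x => (ρ.symm (ψL x)).1) ∘ c.b.symm
          =ᶠ[𝓝 (c.b x)] G ∘ jet 3 P := by
        filter_upwards [hloc, c.eventually_symm (hs.mem_source hxc)
          (hs.eventually_mem c.e.open_source hxc)] with z hz ⟨_, hzc⟩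
        exact (hcoord _ c hzc).trans (congrArg G hz)
      rw [e.fderiv_eq, hv]
      rw [hv] at hGv
      exact fderiv_comp _ hGv (hPx.jet 3).differentiableAt
    have hyc : (wrCharts m n π).coord c (ρ.symm (ψL x)).1 = G v := hcoord _ c hxc
    rw [hyc, hD]
    ext w
    set Z := X.val c (G v) with hZ
    -- The projection of `X` to `J³π` need not be a vector field there, since `X` may vary along the
    -- fibres. Only its value at the point matters, and that value extends.
    obtain ⟨X', hX'⟩ := exists_vField hxc Z.1
    have h1 := heq X' x hx c hxc
    have h1' : (((omegaL L η) c v).curryLeft Z.1).compContinuousLinearMap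
        (fderiv ℝ (jet 3 P) (c.b x)) = 0 := by
      rw [hloc.fderiv_eq] at h1
      rw [← hX']
      exact h1
    have h2 := congrArg (fun β => β w) h1'
    rw [omegaL_eq hη hL (mem_jetTarget hxc)] at h2
    -- The Legendre section lifts the projection `Z.1`, so the difference is a pure momentum vector.
    have hsplit : Z = fderiv ℝ G v Z.1 + (0, Z.2 - (fderiv ℝ G v Z.1).2) := by
      refine Prod.ext ?_ ?_
      · rw [Prod.fst_add, fderiv_legMap_fst hl, add_zero]
      · rw [Prod.snd_add, add_sub_cancel]
    have h3 : omegaR L η c (G v) (Matrix.vecCons (fderiv ℝ G v Z.1)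
        fun i => fderiv ℝ G v (fderiv ℝ (jet 3 P) (c.b x) (w i))) = 0 := by
      refine Eq.trans (congrArg _ ?_) h2
      funext i
      refine Fin.cases ?_ (fun i => ?_) i <;> rfl
    -- Tangent vectors of the prolongation `j³P` are total derivatives; after truncation to first
    -- order they depend on the 2-jet only, as `omegaR_vertical` requires.
    have h4 : omegaR L η c (G v) (Matrix.vecCons (0, Z.2 - (fderiv ℝ G v Z.1).2)
        fun i => fderiv ℝ G v (fderiv ℝ (jet 3 P) (c.b x) (w i))) = 0 := by
      refine omegaR_vertical (y := G v) (mem_jetTarget hxc) hl _ (b := w) fun i => ?_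
      rw [fderiv_legMap_fst hl, fderiv_jet hPx]
      change (tot (jet 4 P (c.b x)) (w i)).trunc 1 = tot (v.trunc 2) (w i)
      rw [hv, trunc_jet (by norm_num), tot_trunc (by norm_num), trunc_jet (by norm_num)]
    change (omegaR L η c (G v)).curryLeft Z (fun i => fderiv ℝ G v
      (fderiv ℝ (jet 3 P) (c.b x) (w i))) = 0
    rw [hsplit, map_add]
    exact (congrArg₂ (· + ·) h3 h4).trans (add_zero 0)
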